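/- **Setting.** A (one-player) game structure $\mathcal T$ is a finite rooted tree with a non-terminal root, whose non-terminal nodes are partitioned into player nodes and chance nodes. The player nodes are partitioned into information sets $I$; every information set has a finite non-empty set of actions $\mathrm{Act}(I)$, the sets $\mathrm{Act}(I)$ are pairwise disjoint, and the edges leaving any node of $I$ are labelled bijectively by $\mathrm{Act}(I)$. The size $|\mathcal T|$ is the number of leaves. The history $\mathrm{hist}(v)$ of a node $v$ is the sequence of the player's actions on the path from the root to $v$. All structures that are compared are over a common family of information sets $I$ with action sets $\mathrm{Act}(I)$. $\mathcal T$ is *non-absentminded* if no two distinct nodes on a path from the root lie in the same information set. $\mathcal T$ has *A-loss recall* (ALR) if for any two distinct nodes $u,v$ of the same information set, either $\mathrm{hist}(u)=\mathrm{hist}(v)$, or $\mathrm{hist}(u)=s\,a\,s_1$ and $\mathrm{hist}(v)=s\,b\,s_2$ with $a\neq b$ and $a,b\in\mathrm{Act}(I')$ for some information set $I'$. With a variable $x_a$ for each action $a$, the leaf monomial of a leaf $t$ is $\prod x_a$ over the actions $a$ on the path to $t$; $X(\mathcal T)$ is the set of leaf monomials of $\mathcal T$. A polynomial $f$ *reduces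 to* $g$ under strategy constraints if $g$ is obtained from $f$ by finitely many substitutions of the form $\sum_{a\in \mathrm{Act}(I)}x_a=1$. A game structure $\mathcal T'$ is an *ALR-span* of $\mathcal T$ if $\mathcal T'$ has ALR and for every $\mu\in X(\mathcal T)$ there are real coefficients $c_{\mu'}$, $\mu'\in X(\mathcal T')$, such that $\sum_{\mu'\in X(\mathcal T')}c_{\mu'}\,\mu'$ reduces to $\mu$ under strategy constraints. **MIN-ALR-SPAN.** Given a non-absentminded one-player game structure $\mathcal T$ (written out as a tree, with the names of its information sets in binary) and an integer $k>0$ (written in unary), is there a game structure $\mathcal T'$ with $|\mathcal T'|\le k$ that is an ALR-span of $\mathcal T$? **Theorem.** The decision problem MIN-ALR-SPAN is in $\mathrm{NP}$. -/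

import Mathlib

/-! ### Game structures -/

/-- An action: `(I, i)` is the `i`-th action available at the information set named `I`.  Thus
actions of distinct information sets are distinct, and actions identify information sets. -/
abbrev GameAction := ℕ × ℕ

/-- Finite rooted trees underlying one-player game structures.  A non-terminal node belongs
either to chance or to the player, and has at least one child.  A player node carries the name
`I` of its information set, and its `i`-th outgoing edge is labelled with the action `(I, i)`. -/
inductive GameTree : Type
  | leaf : GameTree
  | chance (n : ℕ) (child : Fin (n + 1) → GameTree) : GameTree
  | player (I n : ℕ) (child : Fin (n + 1) → GameTree) : GameTree

namespace GameTree

/-- Vertices are addressed by the list of child indices on the path from the root;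
`T.subtree? p` is the subtree rooted at the vertex `p`, if there is such a vertex. -/
def subtree? : GameTree → List ℕ → Option GameTree
  | T, [] => some T
  | leaf, _ :: _ => none
  | chance n c, i :: p => if h : i < n + 1 then (c ⟨i, h⟩).subtree? p else none
  | player _ n c, i :: p => if h : i < n + 1 then (c ⟨i, h⟩).subtree? p else none

/-- The history of the vertex `p`: the sequence of the player's actions on the path to `p`. -/
def hist : GameTree → List ℕ → List GameAction
  | _, [] => []
  | leaf, _ :: _ => []
  | chance n c, i :: p => if h : i < n + 1 then (c ⟨i, h⟩).hist p else []
  | player I n c, i :: p => if h : i < n + 1 then (I, i) :: (c ⟨i, h⟩).hist p else []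

/-- The vertex `p` is a player node in the information set `I`. -/
def InInfoSet (T : GameTree) (p : List ℕ) (I : ℕ) : Prop :=
  ∃ n c, T.subtree? p = some (player I n c)

/-- The finite set of (addresses of) leaves. -/
def leaves : GameTree → Finset (List ℕ)
  | leaf => {[]}
  | chance _ c => Finset.univ.biUnion fun i => (c i).leaves.image fun p => (i : ℕ) :: p
  | player _ _ c => Finset.univ.biUnion fun i => (c i).leaves.image fun p => (i : ℕ) :: p

theorem mem_leaves (T : GameTree) (p : List ℕ) :
    p ∈ T.leaves ↔ T.subtree? p = some leaf := by
  induction T generalizing p with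
  | leaf => cases p <;> simp [leaves, subtree?]
  | chance n c ih =>
    cases p with
    | nil => simp [leaves, subtree?]
    | cons i p =>
      by_cases h : i < n + 1
      · simp only [leaves, subtree?, h, dif_pos, ← ih]
        simp only [Finset.mem_biUnion, Finset.mem_univ, true_and, Finset.mem_image,
          List.cons.injEq, exists_eq_right_right]
        constructor
        · rintro ⟨a, ha, rfl⟩; exact ha
        · intro ha; exact ⟨⟨i, h⟩, ha, rfl⟩
      · simp only [leaves, subtree?, h, dif_neg, not_false_eq_true]
        simp only [Finset.mem_biUnion, Finset.mem_univ, true_and, Finset.mem_image,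
          List.cons.injEq, exists_eq_right_right, reduceCtorEq, iff_false]
        rintro ⟨a, -, rfl⟩; exact h a.2
  | player I n c ih =>
    cases p with
    | nil => simp [leaves, subtree?]
    | cons i p =>
      by_cases h : i < n + 1
      · simp only [leaves, subtree?, h, dif_pos, ← ih]
        simp only [Finset.mem_biUnion, Finset.mem_univ, true_and, Finset.mem_image,
          List.cons.injEq, exists_eq_right_right]
        constructor
        · rintro ⟨a, ha, rfl⟩; exact ha
        · intro ha; exact ⟨⟨i, h⟩, ha, rfl⟩
      · simp only [leaves, subtree?, h, dif_neg, not_false_eq_true]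
        simp only [Finset.mem_biUnion, Finset.mem_univ, true_and, Finset.mem_image,
          List.cons.injEq, exists_eq_right_right, reduceCtorEq, iff_false]
        rintro ⟨a, -, rfl⟩; exact h a.2

/-- The size of a game structure: its number of leaves. -/
def size (T : GameTree) : ℕ := T.leaves.card

/-- `T` is a game structure over the information sets `I : ℕ` with `act I ≥ 1` actions each:
the root is non-terminal, and all nodes of an information set `I` have the same outgoing
actions `(I, 0), …, (I, act I - 1)`. -/
def IsGameStructure (act : ℕ → ℕ+) (T : GameTree) : Prop :=
  T ≠ leaf ∧ ∀ p I n c, T.subtree? p = some (player I n c) → n + 1 = (act I : ℕ)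

/-- Non-absentmindedness: no two distinct vertices on a path lie in the same information set. -/
def NAM (T : GameTree) : Prop :=
  ∀ p q I, q ≠ [] → T.InInfoSet p I → ¬ T.InInfoSet (p ++ q) I

/-- A-loss recall: any two distinct vertices of an information set have the same history, or
their histories branch at two distinct actions of one information set. -/
def ALR (T : GameTree) : Prop :=
  ∀ I p q, p ≠ q → T.InInfoSet p I → T.InInfoSet q I →
    T.hist p = T.hist q ∨
    ∃ (s s₁ s₂ : List GameAction) (I' i j : ℕ), i ≠ j ∧
      T.hist p = s ++ (I', i) :: s₁ ∧ T.hist q = s ++ (I', j) :: s₂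

end GameTree

/-! ### Leaf monomials, reduction under strategy constraints, spans -/

/-- The monomial `∏ x_a`, the product being taken along a history. -/
noncomputable def histMonomial (h : List GameAction) : MvPolynomial GameAction ℝ :=
  (h.map MvPolynomial.X).prod

open scoped Classical in
/-- The finite set `X(T)` of leaf monomials of `T`. -/
noncomputable def GameTree.leafMonomials (T : GameTree) : Finset (MvPolynomial GameAction ℝ) :=
  T.leaves.image fun p => histMonomial (T.hist p)

/-- One substitution `∑_{a ∈ Act(I)} x_a = 1`: some occurrence of the sum as a factor,
`f = r + h * ∑_{a ∈ Act(I)} x_a`, is replaced by `1`, which gives `g = r + h`. -/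
def SubstStep (act : ℕ → ℕ+) (f g : MvPolynomial GameAction ℝ) : Prop :=
  ∃ (I : ℕ) (h r : MvPolynomial GameAction ℝ),
    f = r + h * ∑ i ∈ Finset.range (act I : ℕ), MvPolynomial.X (I, i) ∧ g = r + h

/-- `f` reduces to `g` under strategy constraints: finitely many substitutions lead from `f`
to `g`. -/
def ReducesTo (act : ℕ → ℕ+) : MvPolynomial GameAction ℝ → MvPolynomial GameAction ℝ → Prop :=
  Relation.ReflTransGen (SubstStep act)

/-- `T'` is an ALR-span of `T`: it has A-loss recall, and every leaf monomial of `T` is obtained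
by reduction from a real linear combination of the leaf monomials of `T'`. -/
def IsALRSpan (act : ℕ → ℕ+) (T' T : GameTree) : Prop :=
  T'.ALR ∧ ∀ μ ∈ T.leafMonomials, ∃ c : MvPolynomial GameAction ℝ → ℝ,
    ReducesTo act (∑ μ' ∈ T'.leafMonomials, c μ' • μ') μ

/-! ### The class NP -/

/-- A pair of words over `α` and `β`, written as one word over the disjoint union. -/
def encodePair {α β : Type} (x : List α × List β) : List (α ⊕ β) :=
  x.1.map Sum.inl ++ x.2.map Sum.inr

/-- The language `L` is in NP: there are a polynomial `p` and a predicate `V`, computable by a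
deterministic Turing machine in polynomial time, such that `x ∈ L` iff `V (x, w)` holds for some
certificate `w` (a word over a finite alphabet) of length at most `p |x|`. -/
def InNP {α : Type} [Fintype α] (L : Language α) : Prop :=
  ∃ (β : Type) (_ : Fintype β) (p : Polynomial ℕ) (V : List α × List β → Bool),
    Nonempty (Turing.TM2ComputableInPolyTime encodePair Computability.encodeBool V) ∧
    ∀ x : List α, x ∈ L ↔ ∃ w : List β, w.length ≤ p.eval x.length ∧ V (x, w) = true

/-! ### The decision problem -/

/-- The alphabet in which instances are written. -/
inductive Token : Type
  | leaf | chance | player | close | zero | one | tick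
  deriving DecidableEq

instance : Fintype Token where
  elems := {.leaf, .chance, .player, .close, .zero, .one, .tick}
  complete t := by cases t <;> simp

/-- A tree as a word: the node kind, for player nodes the name of the information set in binary
(least significant bit first), the words of the children, and a closing bracket. -/
def GameTree.encode : GameTree → List Token
  | .leaf => [.leaf]
  | .chance _ c => .chance :: ((List.ofFn fun i => (c i).encode).flatten ++ [.close])
  | .player I _ c => .player :: (I.bits.map fun b => if b then Token.one else Token.zero) ++
      ((List.ofFn fun i => (c i).encode).flatten ++ [.close])

/-- An instance `(T, k)` as a word, with `k` in unary. -/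
def encodeInstance (T : GameTree) (k : ℕ) : List Token :=
  T.encode ++ List.replicate k Token.tick

/-- MIN-ALR-SPAN: the words encoding a non-absentminded one-player game structure `T` and an
integer `k > 0` such that `T` has an ALR-span `T'` with at most `k` leaves. -/
def MinALRSpan : Language Token :=
  {x | ∃ (act : ℕ → ℕ+) (T : GameTree) (k : ℕ),
    T.IsGameStructure act ∧ T.NAM ∧ 0 < k ∧ x = encodeInstance T k ∧
    ∃ T' : GameTree, T'.IsGameStructure act ∧ T'.size ≤ k ∧ IsALRSpan act T' T}

/-! The certificate is neither the spanning tree nor its real coefficients, but a derivation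
(`QueryDerivation`) on sets of monomials that starts from the leaf monomials of the given structure.
A set of empty monomials is finished at the cost of one leaf. Otherwise a set is either queried at
an information set `I` occurring in it, which replaces it by its conditionings on the actions of
`I`, or split into two parts with no information set in common. An ALR-span with at most `k` leaves
exists iff some derivation costs at most `k`, and a cheap derivation can be chosen short.

Soundness (`QueryDerivation.exists_yields`): finished sets become leaves, queries player nodes and
splits binary chance nodes. A-loss recall holds because separated parts use different information
sets and because nodes below different actions of `I` branch there. A monomial without a factor at
`I` is recovered from the branches by `∑ x_a = 1`.

Completeness (`SpannedBy.derivable`): at pure strategies the constraints hold, so reductions become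
invisible and leaf monomials become indicator functions. Consider a forest with joint A-loss recall
whose indicators span those of the monomials, with all chance nodes at the roots removed. The trees
with root set `I` then share no information set with the others. An indicator that is a sum of two
functions of disjoint sets of coordinates depends on one of these sets only, provided that every
occurring information set has two actions. Hence each monomial belongs to one side
(`SpannedBy.mem_span_or`): the monomials split, or one side suffices, and in the latter case they
can be conditioned on the actions of `I`. Leaf counts add up along the way, so the cost is at most
the size of the span. Single-action sets are queried beforehand at no cost.

The verifier parses the instance, checks that it is well formed and non-absentminded, and executes
the rules named by the certificate. Its running time is bounded by a calculus of polynomial-time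
functions on binary trees (`PolyTime`), closed under composition, case distinction and folds with
polynomially bounded states. These are realised by structured stack programs, which compile to
Turing machines (`StackProg.nonempty_computable`). -/

/-! ### Structured programs on stacks of bits -/

/-- Structured programs acting on stacks of bits that are indexed by natural numbers. -/
inductive StackProg : Type
  | skip : StackProg
  | push (k : ℕ) (b : Bool) : StackProg
  | seq (P Q : StackProg) : StackProg
  | pop (k : ℕ) (N T F : StackProg) : StackProg
  | loop (k : ℕ) (P : StackProg) : StackProg

namespace StackProg

/-- The contents of all stacks. -/
abbrev Store := ℕ → List Bool

open Function

/-- `Run P s s' t`: the program `P` transforms the store `s` into `s'` in `t` steps. -/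
inductive Run : StackProg → Store → Store → ℕ → Prop
  | skip (s) : Run skip s s 1
  | push (k b s) : Run (push k b) s (update s k (b :: s k)) 1
  | seq {P Q s s' s'' t t'} : Run P s s' t → Run Q s' s'' t' → Run (seq P Q) s s'' (t + t')
  | popNil {k N T F s s' t} : s k = [] → Run N s s' t → Run (pop k N T F) s s' (t + 1)
  | popTrue {k N T F s s' t l} : s k = true :: l → Run T (update s k l) s' t →
      Run (pop k N T F) s s' (t + 1)
  | popFalse {k N T F s s' t l} : s k = false :: l → Run F (update s k l) s' t →
      Run (pop k N T F) s s' (t + 1)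
  | loopNil {k P s} : s k = [] → Run (loop k P) s s 1
  | loopCons {k P s s' s'' t t'} : s k ≠ [] → Run P s s' t → Run (loop k P) s' s'' t' →
      Run (loop k P) s s'' (t + t' + 1)

/-- The control points of a program. -/
def Label : StackProg → Type
  | skip => Unit
  | push _ _ => Unit
  | seq P Q => P.Label ⊕ Q.Label
  | pop _ N T F => Option (N.Label ⊕ T.Label ⊕ F.Label)
  | loop _ P => Option P.Label

/-- The control point at which a program starts. -/
def entry : (P : StackProg) → P.Label
  | skip => ()
  | push _ _ => ()
  | seq P _ => Sum.inl P.entry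
  | pop _ _ _ _ => none
  | loop _ _ => none

/-- Programs have finitely many control points. -/
@[reducible] def fintypeLabel : (P : StackProg) → Fintype P.Label
  | skip => inferInstanceAs (Fintype Unit)
  | push _ _ => inferInstanceAs (Fintype Unit)
  | seq P Q =>
    letI := P.fintypeLabel
    letI := Q.fintypeLabel
    inferInstanceAs (Fintype (P.Label ⊕ Q.Label))
  | pop _ N T F =>
    letI := N.fintypeLabel
    letI := T.fintypeLabel
    letI := F.fintypeLabel
    inferInstanceAs (Fintype (Option (N.Label ⊕ T.Label ⊕ F.Label)))
  | loop _ P =>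
    letI := P.fintypeLabel
    inferInstanceAs (Fintype (Option P.Label))

instance (P : StackProg) : Fintype P.Label := P.fintypeLabel

/-- A bound for the indices of the stacks that a program uses. -/
def maxStack : StackProg → ℕ
  | skip => 0
  | push k _ => k
  | seq P Q => max P.maxStack Q.maxStack
  | pop k N T F => max k (max N.maxStack (max T.maxStack F.maxStack))
  | loop k P => max k P.maxStack

variable {α : Type} {n : ℕ} {Λ : Type}

/-- The alphabets of the stacks of the machine that runs a program: there are an input stack, an
output stack and `n + 1` stacks of bits. -/
def Alphabet (α : Type) (n : ℕ) : Bool ⊕ Fin (n + 1) → Type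
  | .inl true => α
  | .inl false => Bool
  | .inr _ => Bool

/-- The internal state of the machine: the last input letter and the last bit that were read. -/
abbrev MachineState (α : Type) := Option α × Option Bool

/-- The statements that execute a program at its control points, after renaming these by `ι`. The
machine continues at `exit` when the program ends. -/
def compile : (P : StackProg) → (P.Label → Λ) → Λ → P.Label →
    Turing.TM2.Stmt (Alphabet α n) Λ (MachineState α)
  | skip, _, exit, _ => .goto fun _ => exit
  | push k b, _, exit, _ => .push (.inr (Fin.ofNat (n + 1) k)) (fun _ => b) (.goto fun _ => exit)
  | seq P Q, ι, _, .inl l => P.compile (ι ∘ Sum.inl) (ι (.inr Q.entry)) l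
  | seq _ Q, ι, exit, .inr l => Q.compile (ι ∘ Sum.inr) exit l
  | pop k N T F, ι, _, none => .pop (.inr (Fin.ofNat (n + 1) k)) (fun v o => (v.1, o)) <|
      .goto fun v => match v.2 with
        | none => ι (some (.inl N.entry))
        | some true => ι (some (.inr (.inl T.entry)))
        | some false => ι (some (.inr (.inr F.entry)))
  | pop _ N _ _, ι, exit, some (.inl l) => N.compile (fun l => ι (some (.inl l))) exit l
  | pop _ _ T _, ι, exit, some (.inr (.inl l)) =>
      T.compile (fun l => ι (some (.inr (.inl l)))) exit l
  | pop _ _ _ F, ι, exit, some (.inr (.inr l)) =>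
      F.compile (fun l => ι (some (.inr (.inr l)))) exit l
  | loop k P, ι, exit, none => .peek (.inr (Fin.ofNat (n + 1) k)) (fun v o => (v.1, o)) <|
      .goto fun v => match v.2 with
        | none => exit
        | some _ => ι (some P.entry)
  | loop _ P, ι, _, some l => P.compile (ι ∘ some) (ι none) l

/-- The stacks of the machine, given the input stack, the output stack and a store. -/
def storeStacks (i : List α) (o : List Bool) (s : Store) : ∀ k, List (Alphabet α n k)
  | .inl true => i
  | .inl false => o
  | .inr k => s k

/-- Stack indices are reduced modulo `n + 1` by `Fin.ofNat`; the bound on `k` makes this the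
identity. -/
theorem update_storeStacks_inr (i : List α) (o : List Bool) (s : Store) {k : ℕ} (hk : k ≤ n)
    (l : List Bool) :
    update (storeStacks (n := n) i o s) (.inr (Fin.ofNat (n + 1) k)) l = storeStacks i o (update s k l) := by
  have hv : (Fin.ofNat (n + 1) k : Fin (n + 1)).val = k := by
    simp [Fin.ofNat, Nat.mod_eq_of_lt (Nat.lt_succ_of_le hk)]
  funext j
  rcases j with (_ | _) | j
  · exact update_of_ne (by simp) _ _
  · exact update_of_ne (by simp) _ _
  · by_cases h : j = Fin.ofNat (n + 1) k
    · subst h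
      exact (update_self _ _ _).trans 
        ((congrArg (update s k l) hv).trans (update_self _ _ _)).symm
    · have hne : (j : ℕ) ≠ k := fun h' => h (Fin.ext (h'.trans hv.symm))
      exact (update_of_ne (by simpa using h) _ _).trans (update_of_ne hne _ _).symm

theorem update_storeStacks_input (i i' : List α) (o : List Bool) (s : Store) :
    update (storeStacks (n := n) i o s) (.inl true) i' = storeStacks i' o s := by
  funext j
  rcases j with (_ | _) | j
  · exact update_of_ne (by simp) _ _
  · exact update_self _ _ _
  · exact update_of_ne (by simp) _ _

theorem update_storeStacks_output (i : List α) (o o' : List Bool) (s : Store) :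
    update (storeStacks (n := n) i o s) (.inl false) o' = storeStacks i o' s := by
  funext j
  rcases j with (_ | _) | j
  · exact update_self _ _ _
  · exact update_of_ne (by simp) _ _
  · exact update_of_ne (by simp) _ _

theorem storeStacks_ofNat (i : List α) (o : List Bool) (s : Store) {k : ℕ} (hk : k ≤ n) :
    storeStacks (n := n) i o s (.inr (Fin.ofNat (n + 1) k)) = s k := by
  have hv : (Fin.ofNat (n + 1) k : Fin (n + 1)).val = k := by
    simp [Fin.ofNat, Nat.mod_eq_of_lt (Nat.lt_succ_of_le hk)]
  exact congrArg s hv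

/-- The machine `M` leads from `c` to `c'` in `t` steps. -/
def Steps (M : Λ → Turing.TM2.Stmt (Alphabet α n) Λ (MachineState α))
    (c c' : Turing.TM2.Cfg (Alphabet α n) Λ (MachineState α)) (t : ℕ) : Prop :=
  (flip bind (Turing.TM2.step M))^[t] (some c) = some c'

variable {M : Λ → Turing.TM2.Stmt (Alphabet α n) Λ (MachineState α)}
  {c c' c'' : Turing.TM2.Cfg (Alphabet α n) Λ (MachineState α)}

theorem Steps.trans {t t' : ℕ} (h : Steps M c c' t) (h' : Steps M c' c'' t') :
    Steps M c c'' (t + t') := by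
  unfold Steps at *
  rw [Nat.add_comm t t', Function.iterate_add_apply, h, h']

theorem Steps.single (h : Turing.TM2.step M c = some c') : Steps M c c' 1 := h

/-- The costs in `Run` are chosen so that every rule accounts for exactly one machine step besides
those of its subprograms. Renaming and exit are arbitrary because subprograms sit inside larger
ones. The final internal state is left open: every `pop` and `peek` overwrites the bit before it is
tested. -/
theorem Run.steps {P : StackProg} {s s' : Store} {t : ℕ} (h : Run P s s' t)
    (ι : P.Label → Λ) (exit : Λ) (hn : P.maxStack ≤ n) (hM : ∀ l, M (ι l) = P.compile ι exit l)
    (v : MachineState α) (i : List α) (o : List Bool) :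
    ∃ v', Steps M ⟨some (ι P.entry), v, storeStacks i o s⟩ ⟨some exit, v', storeStacks i o s'⟩ t := by
  induction h generalizing exit v with
  | skip s =>
    refine ⟨v, Steps.single ?_⟩
    rw [Turing.TM2.step, hM]; simp [compile]
  | push k b s =>
    refine ⟨v, Steps.single ?_⟩
    rw [Turing.TM2.step, hM]
    have := update_storeStacks_inr (n := n) i o s (k := k) hn (b :: s k)
    simp only [compile, Turing.TM2.stepAux, storeStacks_ofNat i o s (k := k) hn]
    exact congrArg (fun S => some (Turing.TM2.Cfg.mk (some exit) v S)) this
  | @seq P Q s s' s'' t t' _ _ ih₁ ih₂ =>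
    simp only [maxStack, max_le_iff] at hn
    obtain ⟨v₁, h₁⟩ := ih₁ (ι ∘ Sum.inl) (ι (.inr Q.entry)) hn.1 (fun l => hM (.inl l)) v
    obtain ⟨v₂, h₂⟩ := ih₂ (ι ∘ Sum.inr) exit hn.2 (fun l => hM (.inr l)) v₁
    exact ⟨v₂, h₁.trans h₂⟩
  | @popNil k N T F s s' t hk _ ih =>
    simp only [maxStack, max_le_iff] at hn
    obtain ⟨v₁, h₁⟩ := ih (fun l => ι (some (.inl l))) exit hn.2.1
      (fun l => hM (some (.inl l))) (v.1, none)
    refine ⟨v₁, Nat.add_comm 1 t ▸ Steps.trans (Steps.single ?_) h₁⟩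
    rw [Turing.TM2.step, hM]
    have hu := update_storeStacks_inr (n := n) i o s hn.1 []
    -- Popping an empty stack leaves the store unchanged.
    rw [show update s k [] = s from hk ▸ update_eq_self k s] at hu
    simp only [entry, compile, Turing.TM2.stepAux, storeStacks_ofNat i o s hn.1]
    simp only [hk]
    exact congrArg (fun S => some (Turing.TM2.Cfg.mk _ (v.1, none) S)) hu
  | @popTrue k N T F s s' t r hk _ ih =>
    simp only [maxStack, max_le_iff] at hn
    obtain ⟨v₁, h₁⟩ := ih (fun l => ι (some (.inr (.inl l)))) exit hn.2.2.1
      (fun l => hM (some (.inr (.inl l)))) (v.1, some true)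
    refine ⟨v₁, Nat.add_comm 1 t ▸ Steps.trans (Steps.single ?_) h₁⟩
    rw [Turing.TM2.step, hM]
    have hu := update_storeStacks_inr (n := n) i o s hn.1 r
    simp only [entry, compile, Turing.TM2.stepAux, storeStacks_ofNat i o s hn.1]
    simp only [hk]
    exact congrArg (fun S => some (Turing.TM2.Cfg.mk _ (v.1, some true) S)) hu
  | @popFalse k N T F s s' t r hk _ ih =>
    simp only [maxStack, max_le_iff] at hn
    obtain ⟨v₁, h₁⟩ := ih (fun l => ι (some (.inr (.inr l)))) exit hn.2.2.2
      (fun l => hM (some (.inr (.inr l)))) (v.1, some false)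
    refine ⟨v₁, Nat.add_comm 1 t ▸ Steps.trans (Steps.single ?_) h₁⟩
    rw [Turing.TM2.step, hM]
    have hu := update_storeStacks_inr (n := n) i o s hn.1 r
    simp only [entry, compile, Turing.TM2.stepAux, storeStacks_ofNat i o s hn.1]
    simp only [hk]
    exact congrArg (fun S => some (Turing.TM2.Cfg.mk _ (v.1, some false) S)) hu
  | @loopNil k P s hk =>
    simp only [maxStack, max_le_iff] at hn
    refine ⟨(v.1, none), Steps.single ?_⟩
    rw [Turing.TM2.step, hM]
    simp only [entry, compile, Turing.TM2.stepAux, storeStacks_ofNat i o s hn.1]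
    simp only [hk]
    rfl
  | @loopCons k P s s' s'' t t' hk _ _ ih₁ ih₂ =>
    have hn' := hn
    simp only [maxStack, max_le_iff] at hn
    obtain ⟨b, r, hb⟩ := List.exists_cons_of_ne_nil hk
    obtain ⟨v₁, h₁⟩ := ih₁ (ι ∘ some) (ι none) hn.2 (fun l => hM (some l)) (v.1, some b)
    obtain ⟨v₂, h₂⟩ := ih₂ ι exit hn' hM v₁
    refine ⟨v₂, Nat.add_comm 1 (t + t') ▸ Steps.trans (Steps.single ?_) (h₁.trans h₂)⟩
    rw [Turing.TM2.step, hM]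
    simp only [entry, compile, Turing.TM2.stepAux, storeStacks_ofNat i o s hn.1]
    simp only [hb]
    rfl

/-! ### Reading the input and writing the answer -/

/-- The statement that pushes the word `l` onto stack `0`, so that its first letter is on top. -/
def pushWord (l : List Bool) (q : Turing.TM2.Stmt (Alphabet α n) Λ (MachineState α)) :
    Turing.TM2.Stmt (Alphabet α n) Λ (MachineState α) :=
  match l with
  | [] => q
  | b :: l => pushWord l (.push (.inr 0) (fun _ => b) q)

/-- The pushes are chained within one statement, so a whole code word costs a single machine step.
-/
theorem stepAux_pushWord (l : List Bool) (q : Turing.TM2.Stmt (Alphabet α n) Λ (MachineState α))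
    (v : MachineState α) (i : List α) (o : List Bool) (s : Store) :
    Turing.TM2.stepAux (pushWord l q) v (storeStacks i o s) =
      Turing.TM2.stepAux q v (storeStacks i o (update s 0 (l ++ s 0))) := by
  induction l generalizing q with
  | nil => simp [pushWord]
  | cons b l ih =>
    rw [pushWord, ih]
    have := update_storeStacks_inr (n := n) i o (update s 0 (l ++ s 0)) (Nat.zero_le n)
      (b :: update s 0 (l ++ s 0) 0)
    refine congrArg (Turing.TM2.stepAux q v) (this.trans ?_)
    rw [update_idem, update_self, List.cons_append]

/-- The machine that writes the reversed input on stack `0`, coding its letters by words, and then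
runs a program.  It outputs whether the first letter of stack `0` is `true` in the end. -/
def machine [Fintype α] (P : StackProg) (code : α → List Bool) : Turing.FinTM2 where
  K := Bool ⊕ Fin (P.maxStack + 1)
  k₀ := .inl true
  k₁ := .inl false
  Γ := Alphabet α P.maxStack
  Λ := P.Label ⊕ α ⊕ Fin 3
  main := .inr (.inr 0)
  σ := MachineState α
  initialState := (none, none)
  Γk₀Fin := inferInstanceAs (Fintype α)
  m
    -- The bottom letter `false` is the code of the empty list; it terminates the list of input
    -- letters.
    | .inr (.inr 0) => .push (.inr 0) (fun _ => false) (.goto fun _ => .inr (.inr 1))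
    | .inr (.inr 1) => .pop (.inl true) (fun _ o => (o, none)) <|
        .goto fun v => match v.1 with
          | none => .inl P.entry
          | some a => .inr (.inl a)
    | .inr (.inl a) => pushWord (code a) (.goto fun _ => .inr (.inr 1))
    | .inl l => P.compile Sum.inl (.inr (.inr 2)) l
    | .inr (.inr 2) => .pop (.inr 0) (fun v o => (v.1, o)) <|
        .branch (fun v => v.2 == some true)
          -- The word of `true` has three letters, and a halting configuration must have empty work
          -- stacks.
          (.pop (.inr 0) (fun v _ => v) <| .pop (.inr 0) (fun v _ => v) <|
            .push (.inl false) (fun _ => true) <| .load (fun _ => (none, none)) .halt)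
          (.push (.inl false) (fun _ => false) <| .load (fun _ => (none, none)) .halt)

/-- The word of a truth value. -/
def boolWord (b : Bool) : List Bool := if b then [true, false, false] else [false]

/-- Each letter costs two steps, one to pop it and one to push its code; the last step notices the
end of the input. Stacking reverses the order of the letters. -/
theorem steps_read [Fintype α] (P : StackProg) (code : α → List Bool) (l : List α)
    (v : MachineState α) (u : List Bool) :
    ∃ v', Steps (n := P.maxStack) (P.machine code).m
      ⟨some (.inr (.inr 1)), v, storeStacks l [] (update (fun _ => []) 0 u)⟩
      ⟨some (.inl P.entry), v',
        storeStacks [] [] (update (fun _ => []) 0 ((l.map code).reverse.flatten ++ u))⟩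
      (2 * l.length + 1) := by
  induction l generalizing v u with
  | nil =>
    refine ⟨(none, none), Steps.single ?_⟩
    refine congrArg (fun S => some (Turing.TM2.Cfg.mk _ (none, none) S)) ?_
    exact update_storeStacks_input _ _ _ _
  | cons a l ih =>
    obtain ⟨v', h⟩ := ih (some a, none) (code a ++ u)
    refine ⟨v', ?_⟩
    have h₁ : Steps (n := P.maxStack) (P.machine code).m
      ⟨some (.inr (.inr 1)), v, storeStacks (a :: l) [] (update (fun _ => []) 0 u)⟩
      ⟨some (.inr (.inl a)), (some a, none), storeStacks l [] (update (fun _ => []) 0 u)⟩ 1 :=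
      Steps.single (congrArg (fun S => some (Turing.TM2.Cfg.mk _ (some a, none) S))
        (update_storeStacks_input _ _ _ _))
    have h₂ : Steps (n := P.maxStack) (P.machine code).m
      ⟨some (.inr (.inl a)), (some a, none), storeStacks l [] (update (fun _ => []) 0 u)⟩
      ⟨some (.inr (.inr 1)), (some a, none), storeStacks l [] (update (fun _ => []) 0 (code a ++ u))⟩
      1 := by
      refine Steps.single (congrArg some ?_)
      refine (stepAux_pushWord (n := P.maxStack) (code a) _ _ l [] _).trans ?_
      rw [update_idem, update_self]
      rfl
    have := (h₁.trans h₂).trans h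
    simp only [List.map_cons, List.reverse_cons, List.flatten_append, List.length_cons,
      List.flatten_cons, List.flatten_nil, List.append_nil, List.append_assoc]
    rwa [show 2 * (l.length + 1) + 1 = 1 + 1 + (2 * l.length + 1) by ring]

/-- The overhead `2 * X + 3` consists of one step for the terminator, `2 * l.length + 1` for reading
and one for the output. -/
theorem nonempty_computable [Fintype α] {X : Type} (e : X → List α) (f : List α → Bool)
    (P : StackProg) (code : α → List Bool) (p : Polynomial ℕ)
    (h : ∀ l, ∃ t ≤ p.eval l.length,
      Run P (update (fun _ => []) 0 ((l.map code).reverse.flatten ++ [false]))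
        (update (fun _ => []) 0 (boolWord (f l))) t) :
    Nonempty (Turing.TM2ComputableInPolyTime e Computability.encodeBool (fun x => f (e x))) := by
  refine ⟨⟨⟨P.machine code, Equiv.refl _, Equiv.refl _⟩, p + 2 * Polynomial.X + 3, fun x => ?_⟩⟩
  generalize e x = l
  -- The goal is data, whereas the run is only known to exist.
  apply Classical.choice
  obtain ⟨t, ht, hr⟩ := h l
  have h₀ : Steps (n := P.maxStack) (P.machine code).m
      ⟨some (.inr (.inr 0)), (none, none), storeStacks l [] (fun _ => [])⟩
      ⟨some (.inr (.inr 1)), (none, none), storeStacks l [] (update (fun _ => []) 0 [false])⟩ 1 :=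
    Steps.single (congrArg (fun S => some (Turing.TM2.Cfg.mk _ (none, none) S))
      (update_storeStacks_inr _ _ _ (Nat.zero_le _) _))
  obtain ⟨v₁, h₁⟩ := steps_read P code l (none, none) [false]
  obtain ⟨v₂, h₂⟩ := hr.steps (M := (P.machine code).m) Sum.inl (.inr (.inr 2)) le_rfl
    (fun _ => rfl) v₁ ([] : List α) []
  have h₃ : Steps (n := P.maxStack) (P.machine code).m
      ⟨some (.inr (.inr 2)), v₂, storeStacks [] [] (update (fun _ => []) 0 (boolWord (f l)))⟩
      ⟨none, (none, none), storeStacks [] [f l] (fun _ => [])⟩ 1 := by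
    refine Steps.single (congrArg some ?_)
    have hp (w : List Bool) (s : Store) := update_storeStacks_inr (n := P.maxStack) ([] : List α) []
      s (Nat.zero_le _) w
    have hz : update (fun _ => ([] : List Bool)) 0 [] = fun _ => [] := update_eq_self 0 _
    cases f l
    · refine congrArg (Turing.TM2.Cfg.mk none (none, none)) ?_
      refine (congrArg (fun S => update S _ _) (hp [] _)).trans ?_
      rw [update_idem, hz]
      exact update_storeStacks_output _ _ _ _
    · refine congrArg (Turing.TM2.Cfg.mk none (none, none)) ?_
      refine (congrArg (fun S => update (update (update S _ _) _ _) _ _)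
        (hp [false, false] _)).trans ?_
      refine (congrArg (fun S => update (update S _ _) _ _) (hp [false] _)).trans ?_
      refine (congrArg (fun S => update S _ _) (hp [] _)).trans ?_
      rw [update_idem, update_idem, update_idem, hz]
      exact update_storeStacks_output _ _ _ _
  have h₄ := ((h₀.trans h₁).trans h₂).trans h₃
  refine ⟨⟨⟨1 + (2 * l.length + 1) + t + 1, ?_⟩, ?_⟩⟩
  · unfold Steps at h₄
    have hi : Turing.initList (P.machine code) (l.map (Equiv.refl α).invFun) =
        ⟨some (.inr (.inr 0)), (none, none), storeStacks l [] (fun _ => [])⟩ := by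
      refine (congrArg (Turing.initList (P.machine code)) (List.map_id l)).trans ?_
      refine congrArg (Turing.TM2.Cfg.mk _ _) ?_
      funext k
      rcases k with (_ | _) | k <;> rfl
    have ho : Turing.haltList (P.machine code) ((Computability.encodeBool (f l)).map
        (Equiv.refl Bool).invFun) = ⟨none, (none, none), storeStacks [] [f l] (fun _ => [])⟩ := by
      refine congrArg (Turing.TM2.Cfg.mk _ _) ?_
      funext k
      rcases k with (_ | _) | k <;> rfl
    refine Eq.trans (congrArg _ (congrArg some hi)) (h₄.trans (congrArg some ho.symm))
  · simp only [Polynomial.eval_add, Polynomial.eval_mul, Polynomial.eval_X, Polynomial.eval_ofNat]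
    omega

end StackProg

/-! ### Data trees as words -/

/-- Binary trees, the values of the functional programs below. -/
inductive Data : Type
  | nil : Data
  | cons (a b : Data) : Data
  deriving DecidableEq

namespace Data

/-- The prefix code of a binary tree. -/
def word : Data → List Bool
  | nil => [false]
  | cons a b => true :: (a.word ++ b.word)

end Data

/-! ### Moving, copying and delimiting words -/

namespace StackProg

open Function

/-- Move the contents of stack `a` onto stack `b`, in reversed order. -/
def move (a b : ℕ) : StackProg := loop a (pop a skip (push b true) (push b false))

/-- Empty the stack `a`. -/
def clear (a : ℕ) : StackProg := loop a (pop a skip skip skip)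

/-- Move the word on stack `a` onto stack `b` in the same order, through the empty stack `c`. -/
def transfer (a b c : ℕ) : StackProg := seq (move a c) (move c b)

/-- Append the contents of stack `a`, reversed, to both `b` and `c`. -/
def move₂ (a b c : ℕ) : StackProg :=
  loop a (pop a skip (seq (push b true) (push c true)) (seq (push b false) (push c false)))

/-- Copy stack `a` onto stack `b`, through the empty stack `c`. -/
def copy (a b c : ℕ) : StackProg := seq (move a c) (move₂ c a b)

/-- Push the word `l`. -/
def pushAll (a : ℕ) : List Bool → StackProg
  | [] => skip
  | x :: l => seq (pushAll a l) (push a x)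

/-- Move the first tree on stack `a` onto `b`, in reversed order, using the empty stack `c` to
count the trees that are still to be read. -/
def moveTree (a b c : ℕ) : StackProg :=
  seq (push c true) <| loop c <| pop c skip
    (pop a skip (seq (push b true) (seq (push c true) (push c true))) (push b false)) skip

theorem Run.cast {P : StackProg} {s s' s'' : Store} {t t' : ℕ} (h : Run P s s' t)
    (hs : s' = s'') (ht : t = t') : Run P s s'' t' := hs ▸ ht ▸ h

theorem run_move {a b : ℕ} (hab : a ≠ b) (l : List Bool) (s : Store) (hs : s a = l) :
    Run (move a b) s (update (update s a []) b (l.reverse ++ s b)) (3 * l.length + 1) := by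
  induction l generalizing s with
  | nil =>
    refine (Run.loopNil hs).cast ?_ rfl
    rw [← hs, update_eq_self, hs]
    simp
  | cons x l ih =>
    have h₁ : Run (pop a skip (push b true) (push b false)) s
        (update (update s a l) b (x :: s b)) 2 := by
      cases x
      · exact .popFalse hs ((Run.push b false _).cast (by rw [update_of_ne hab.symm]) rfl)
      · exact .popTrue hs ((Run.push b true _).cast (by rw [update_of_ne hab.symm]) rfl)
    refine (Run.loopCons (by simp [hs]) h₁ (ih _ (by simp [hab]))).cast ?_ ?_
    · funext k
      by_cases hb : k = b
      · subst hb; simp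
      · by_cases ha : k = a
        · subst ha; simp [hb]
        · simp [ha, hb]
    · simp only [List.length_cons]; ring

theorem run_clear {a : ℕ} (l : List Bool) (s : Store) (hs : s a = l) :
    Run (clear a) s (update s a []) (3 * l.length + 1) := by
  induction l generalizing s with
  | nil => exact (Run.loopNil hs).cast (by simp [← hs]) rfl
  | cons x l ih =>
    have h₁ : Run (pop a skip skip skip) s (update s a l) 2 := by
      cases x
      · exact .popFalse hs (.skip _)
      · exact .popTrue hs (.skip _)
    refine (Run.loopCons (by simp [hs]) h₁ (ih _ (by simp))).cast (by simp) ?_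
    simp only [List.length_cons]; ring

theorem run_transfer {a b c : ℕ} (hab : a ≠ b) (hac : a ≠ c) (hbc : b ≠ c) (l : List Bool)
    (s : Store) (hs : s a = l) (hc : s c = []) :
    Run (transfer a b c) s (update (update s a []) b (l ++ s b)) (6 * l.length + 2) := by
  refine ((run_move hac l s hs).seq (run_move hbc.symm l.reverse _ (by simp [hc]))).cast ?_ ?_
  · funext k
    by_cases hb : k = b
    · subst hb; simp [hbc, hab.symm]
    · by_cases h : k = c
      · subst h; simp [hb, hc, hac.symm]
      · simp [hb, h, update_apply]
  · simp only [List.length_reverse]; ring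

theorem run_move₂ {a b c : ℕ} (hab : a ≠ b) (hac : a ≠ c) (hbc : b ≠ c) (l : List Bool)
    (s : Store) (hs : s a = l) :
    Run (move₂ a b c) s
      (update (update (update s a []) b (l.reverse ++ s b)) c (l.reverse ++ s c))
      (4 * l.length + 1) := by
  induction l generalizing s with
  | nil =>
    refine (Run.loopNil hs).cast ?_ rfl
    rw [← hs, update_eq_self, hs]
    simp
  | cons x l ih =>
    have h₁ : Run (pop a skip (seq (push b true) (push c true)) (seq (push b false) (push c false)))
        s (update (update (update s a l) b (x :: s b)) c (x :: s c)) 3 := by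
      cases x
      · refine .popFalse hs (((Run.push b false _).seq (Run.push c false _)).cast ?_ rfl)
        simp [hab.symm, hac.symm, hbc.symm]
      · refine .popTrue hs (((Run.push b true _).seq (Run.push c true _)).cast ?_ rfl)
        simp [hab.symm, hac.symm, hbc.symm]
    refine (Run.loopCons (by simp [hs]) h₁ (ih _ (by simp [hab, hac]))).cast ?_ ?_
    · funext k
      by_cases hb : k = b
      · subst hb; simp [hbc]
      · by_cases hc : k = c
        · subst hc; simp
        · by_cases ha : k = a
          · subst ha; simp [hb, hc]
          · simp [ha, hb, hc]
    · simp only [List.length_cons]; ring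

theorem run_copy {a b c : ℕ} (hab : a ≠ b) (hac : a ≠ c) (hbc : b ≠ c) (l : List Bool)
    (s : Store) (hs : s a = l) (hc : s c = []) :
    Run (copy a b c) s (update s b (l ++ s b)) (7 * l.length + 2) := by
  refine ((run_move hac l s hs).seq
    (run_move₂ hac.symm hbc.symm hab l.reverse _ (by simp [hc]))).cast ?_ ?_
  · funext k
    by_cases hb : k = b
    · subst hb; simp [hbc, hab.symm]
    · by_cases h : k = c
      · subst h; simp [hb, hc, hac.symm]
      · by_cases ha : k = a
        · subst ha; simp [hb, h, hs]
        · simp [hb, h, ha]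
  · simp only [List.length_reverse]; ring

theorem run_pushAll (a : ℕ) (l : List Bool) (s : Store) :
    Run (pushAll a l) s (update s a (l ++ s a)) (l.length + 1) := by
  induction l with
  | nil => exact (Run.skip s).cast (by simp) rfl
  | cons x l ih =>
    refine (ih.seq (Run.push a x _)).cast (by simp) ?_
    simp only [List.length_cons]

/-- In a prefix code, `true` replaces one pending tree by two and `false` completes one; stack `c`
counts the pending trees in unary. The loop does not pause between subtrees, so the run after `d`
enters as a hypothesis. A round costs at most six steps per letter. -/
theorem run_moveTree_loop {a b c : ℕ} (hab : a ≠ b) (hac : a ≠ c) (hbc : b ≠ c) (d : Data)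
    (l r : List Bool) (s s' : Store) (t : ℕ) (hs : s a = d.word ++ l) (hc : s c = true :: r)
    (h : Run (loop c <| pop c skip
      (pop a skip (seq (push b true) (seq (push c true) (push c true))) (push b false)) skip)
      (update (update (update s a l) b (d.word.reverse ++ s b)) c r) s' t) :
    ∃ t' ≤ 6 * d.word.length + t, Run (loop c <| pop c skip
      (pop a skip (seq (push b true) (seq (push c true) (push c true))) (push b false)) skip)
      s s' t' := by
  induction d generalizing s l r t with
  | nil =>
    have hs' : s a = false :: l := hs
    have h₁ : Run (pop c skip
        (pop a skip (seq (push b true) (seq (push c true) (push c true))) (push b false)) skip)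
        s (update (update (update s a l) b (false :: s b)) c r) 3 := by
      refine .popTrue hc (.popFalse (l := l) (by simpa [hac] using hs') ?_)
      refine (Run.push b false _).cast ?_ rfl
      funext k
      simp only [update_apply]
      split_ifs <;> simp_all
    refine ⟨_, ?_, Run.loopCons (by simp [hc]) h₁ h⟩
    simp [Data.word]
  | cons d e ihd ihe =>
    have hs' : s a = true :: (d.word ++ (e.word ++ l)) := by simp [hs, Data.word]
    have h₁ : Run (pop c skip
        (pop a skip (seq (push b true) (seq (push c true) (push c true))) (push b false)) skip)
        s (update (update (update s a (d.word ++ (e.word ++ l))) b (true :: s b)) c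
          (true :: true :: r)) 5 := by
      refine .popTrue hc (.popTrue (l := d.word ++ (e.word ++ l)) (by simpa [hac] using hs') ?_)
      refine ((Run.push b true _).seq ((Run.push c true _).seq (Run.push c true _))).cast ?_ rfl
      funext k
      simp only [update_apply]
      split_ifs <;> simp_all
    obtain ⟨t₁, ht₁, h₂⟩ := ihe l r (update (update (update s a (e.word ++ l)) b
      (d.word.reverse ++ true :: s b)) c (true :: r)) t (by simp [hab, hac]) (by simp) (by
        refine (congrArg (fun S => Run _ S s' t) ?_).mp h
        funext k
        simp only [update_apply]
        split_ifs <;> simp_all [Data.word])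
    obtain ⟨t₂, ht₂, h₃⟩ := ihd (e.word ++ l) (true :: r) (update (update (update s a
      (d.word ++ (e.word ++ l))) b (true :: s b)) c (true :: true :: r)) t₁ (by simp [hab, hac])
      (by simp) (by
        refine (congrArg (fun S => Run _ S s' t₁) ?_).mp h₂
        funext k
        simp only [update_apply]
        split_ifs <;> simp_all [Data.word])
    refine ⟨_, ?_, Run.loopCons (by simp [hc]) h₁ h₃⟩
    simp only [Data.word, List.length_cons, List.length_append]
    omega

theorem run_moveTree {a b c : ℕ} (hab : a ≠ b) (hac : a ≠ c) (hbc : b ≠ c) (d : Data)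
    (l : List Bool) (s : Store) (hs : s a = d.word ++ l) (hc : s c = []) :
    ∃ t ≤ 6 * d.word.length + 2, Run (moveTree a b c) s
      (update (update s a l) b (d.word.reverse ++ s b)) t := by
  obtain ⟨t, ht, h⟩ := run_moveTree_loop hab hac hbc d l [] (update s c [true])
    (update (update s a l) b (d.word.reverse ++ s b)) 1 (by simpa [hac] using hs) (by simp) (by
      refine (Run.loopNil (by simp)).cast ?_ rfl
      funext k
      simp only [update_apply]
      split_ifs <;> simp_all)
  refine ⟨_, ?_, ((Run.push c true s).cast (by rw [hc]) rfl).seq h⟩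
  omega

end StackProg

/-! ### Computations relative to a base stack -/

namespace StackProg

open Function

/-- The store that agrees with `s` below `b`, and holds the words `L` from `b` on. -/
def place (s : Store) (b : ℕ) (L : List (List Bool)) : Store :=
  fun k => if k < b then s k else L.getD (k - b) []

@[simp] theorem place_add (s : Store) (b i : ℕ) (L : List (List Bool)) :
    place s b L (b + i) = L.getD i [] := by simp [place]

@[simp] theorem place_self (s : Store) (b : ℕ) (L : List (List Bool)) :
    place s b L b = L.getD 0 [] := by simp [place]

theorem update_place_add (s : Store) (b i : ℕ) (L : List (List Bool)) (hi : i < L.length)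
    (l : List Bool) : update (place s b L) (b + i) l = place s b (L.set i l) := by
  funext k
  by_cases hk : k = b + i
  · subst hk; simp [List.getD_eq_getElem?_getD, hi]
  · rw [update_of_ne hk]
    unfold place
    split_ifs with h
    · rfl
    · rw [List.getD_eq_getElem?_getD, List.getD_eq_getElem?_getD, List.getElem?_set_ne (by omega)]

theorem update_place_self (s : Store) (b : ℕ) (L : List (List Bool)) (hi : 0 < L.length)
    (l : List Bool) : update (place s b L) b l = place s b (L.set 0 l) :=
  update_place_add s b 0 L hi l

theorem eq_place {s : Store} {b : ℕ} (h : ∀ k > b, s k = []) (n : ℕ) :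
    s = place s b (s b :: List.replicate n []) := by
  funext k
  unfold place
  split_ifs with hk
  · rfl
  · obtain ⟨j, rfl⟩ := Nat.exists_eq_add_of_le (Nat.le_of_not_lt hk)
    cases j with
    | zero => simp
    | succ j =>
      rw [h _ (by omega)]
      simp only [List.getD_eq_getElem?_getD, Nat.add_sub_cancel_left, List.getElem?_cons_succ,
        List.getElem?_replicate]
      split_ifs <;> rfl

theorem place_replicate (s : Store) (b n : ℕ) (l : List Bool) (h : ∀ k > b, s k = []) :
    place s b (l :: List.replicate n []) = update s b l := by
  conv_rhs => rw [eq_place h n]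
  rw [update_place_self _ _ _ (by simp)]
  rfl

/-- The programs `P b` turn the tree `d` on stack `b` into the tree `d'` in at most `t` steps. The
stacks above `b` are used as empty workspace and left empty. -/
def Computes (P : ℕ → StackProg) (d d' : Data) (t : ℕ) : Prop :=
  ∀ b s, s b = d.word → (∀ k > b, s k = []) → ∃ t' ≤ t, Run (P b) s (update s b d'.word) t'

variable {P Q R : ℕ → StackProg} {x y z : Data} {t t' t'' : ℕ}

theorem Computes.mono (h : Computes P x y t) (ht : t ≤ t') : Computes P x y t' := by
  intro b s hs he
  obtain ⟨u, hu, hr⟩ := h b s hs he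
  exact ⟨u, hu.trans ht, hr⟩

/-- A subroutine call: since `Computes` holds at every base, the program can be run above the values
`L`, which it leaves untouched. -/
theorem Computes.place_run (h : Computes P x y t) (s : Store) (b : ℕ) (L : List (List Bool))
    (n : ℕ) : ∃ t' ≤ t, Run (P (b + L.length)) (place s b (L ++ x.word :: List.replicate n []))
      (place s b (L ++ y.word :: List.replicate n [])) t' := by
  obtain ⟨u, hu, hr⟩ := h (b + L.length) (place s b (L ++ x.word :: List.replicate n []))
    (by simp [List.getD_eq_getElem?_getD]) (by
      intro k hk
      unfold place
      rw [if_neg (by omega), List.getD_eq_getElem?_getD, List.getElem?_append_right (by omega)]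
      obtain ⟨j, hj⟩ : ∃ j, k - b - L.length = j + 1 := ⟨k - b - L.length - 1, by omega⟩
      rw [hj, List.getElem?_cons_succ, List.getElem?_replicate]
      split_ifs <;> rfl)
  refine ⟨u, hu, hr.cast ?_ rfl⟩
  rw [update_place_add _ _ _ _ (by simp)]
  simp

/-- Reading a window beyond its listed words gives empty stacks, so it suffices to follow the
finitely many stacks that a program uses. -/
theorem computes_of_place {n : ℕ} (h : ∀ s b, ∃ t' ≤ t,
    Run (P b) (place s b (x.word :: List.replicate n [])) (place s b (y.word :: List.replicate n []))
      t') : Computes P x y t := by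
  intro b s hs he
  obtain ⟨u, hu, hr⟩ := h s b
  rw [← hs, ← eq_place he] at hr
  exact ⟨u, hu, hr.cast (place_replicate s b n _ he) rfl⟩

theorem Computes.comp (h : Computes P x y t) (h' : Computes Q y z t') :
    Computes (fun b => seq (P b) (Q b)) x z (t + t') := by
  intro b s hs he
  obtain ⟨u, hu, hr⟩ := h b s hs he
  obtain ⟨u', hu', hr'⟩ := h' b (update s b y.word) (by simp) (fun k hk => by
    rw [update_of_ne (by omega)]; exact he k hk)
  exact ⟨u + u', by omega, (hr.seq hr').cast (by simp) rfl⟩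

theorem computes_const (x y : Data) :
    Computes (fun b => seq (clear b) (pushAll b y.word)) x y
      (3 * x.word.length + y.word.length + 2) := by
  intro b s hs he
  exact ⟨_, by omega, ((run_clear x.word s hs).seq (run_pushAll b y.word _)).cast (by simp) rfl⟩

/-- Replace `x` by the pair of the values that `P` and `Q` compute from `x`. -/
def pairProg (P Q : ℕ → StackProg) (b : ℕ) : StackProg :=
  seq (copy b (b + 1) (b + 2)) <| seq (P (b + 1)) <| seq (copy b (b + 2) (b + 3)) <|
  seq (Q (b + 2)) <| seq (clear b) <| seq (transfer (b + 2) b (b + 3)) <|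
  seq (transfer (b + 1) b (b + 3)) (push b true)

theorem Computes.pair (h : Computes P x y t) (h' : Computes Q x z t') :
    Computes (pairProg P Q) x (.cons y z)
      (t + t' + 17 * x.word.length + 6 * y.word.length + 6 * z.word.length + 10) := by
  refine computes_of_place (n := 3) fun s b => ?_
  have h₁ := run_copy (a := b) (b := b + 1) (c := b + 2) (by omega) (by omega) (by omega) x.word
    (place s b [x.word, [], [], []]) (by simp) (by simp)
  obtain ⟨u₂, hu₂, h₂⟩ := h.place_run s b [x.word] 2
  have h₃ := run_copy (a := b) (b := b + 2) (c := b + 3) (by omega) (by omega) (by omega) x.word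
    (place s b [x.word, y.word, [], []]) (by simp) (by simp)
  obtain ⟨u₄, hu₄, h₄⟩ := h'.place_run s b [x.word, y.word] 1
  have h₅ := run_clear x.word (place s b [x.word, y.word, z.word, []]) (a := b) (by simp)
  have h₆ := run_transfer (a := b + 2) (b := b) (c := b + 3) (by omega) (by omega) (by omega)
    z.word (place s b [[], y.word, z.word, []]) (by simp) (by simp)
  have h₇ := run_transfer (a := b + 1) (b := b) (c := b + 3) (by omega) (by omega) (by omega)
    y.word (place s b [z.word, y.word, [], []]) (by simp) (by simp)
  have h₈ := Run.push b true (place s b [y.word ++ z.word, [], [], []])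
  -- Normalising the updates to explicit lists of stack contents makes the end of each run match the
  -- start of the next.
  simp [update_place_add, update_place_self] at h₁ h₂ h₃ h₄ h₅ h₆ h₇ h₈
  refine ⟨_, ?_, h₁.seq <| h₂.seq <| h₃.seq <| h₄.seq <| h₅.seq <| h₆.seq <| h₇.seq h₈⟩
  omega

end StackProg

/-! ### Projections, conditionals and folds -/

/-- The first component of a pair. -/
def Data.fst : Data → Data
  | .nil => .nil
  | .cons a _ => a

/-- The second component of a pair. -/
def Data.snd : Data → Data
  | .nil => .nil
  | .cons _ b => b

namespace StackProg

open Function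

variable {P Q R : ℕ → StackProg} {x y z : Data} {t t' t'' : ℕ}

/-- After the leading `true`, the words of the components are merely concatenated; `moveTree` finds
where the first one ends. It leaves that word reversed, which the final `move` undoes. -/
theorem computes_fst (x : Data) :
    Computes (fun b => pop b (push b false)
      (seq (moveTree b (b + 1) (b + 2)) (seq (clear b) (move (b + 1) b))) (push b false))
      x x.fst (9 * x.word.length + 5) := by
  refine computes_of_place (n := 2) fun s b => ?_
  cases x with
  | nil =>
    refine ⟨2, by omega, .popFalse (l := []) (by simp [Data.word]) ?_⟩
    refine (Run.push b false _).cast ?_ rfl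
    simp [update_place_self, Data.fst, Data.word]
  | cons x y =>
    obtain ⟨u₁, hu₁, h₁⟩ := run_moveTree (a := b) (b := b + 1) (c := b + 2) (by omega) (by omega)
      (by omega) x y.word (place s b [x.word ++ y.word, [], []]) (by simp) (by simp)
    have h₂ := run_clear y.word (place s b [y.word, x.word.reverse, []]) (a := b) (by simp)
    have h₃ := run_move (a := b + 1) (b := b) (by omega) x.word.reverse
      (place s b [[], x.word.reverse, []]) (by simp)
    simp [update_place_add, update_place_self] at h₁ h₂ h₃
    refine ⟨_, ?_, .popTrue (l := x.word ++ y.word) (by simp [Data.word])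
      (Run.seq (t := u₁) (s' := place s b [y.word, x.word.reverse, []]) ?_ <| h₂.seq h₃)⟩
    · simp only [Data.word, List.length_cons, List.length_append]
      omega
    · simpa [update_place_self] using h₁

theorem computes_snd (x : Data) :
    Computes (fun b => pop b (push b false)
      (seq (moveTree b (b + 1) (b + 2)) (clear (b + 1))) (push b false))
      x x.snd (9 * x.word.length + 5) := by
  refine computes_of_place (n := 2) fun s b => ?_
  cases x with
  | nil =>
    refine ⟨2, by omega, .popFalse (l := []) (by simp [Data.word]) ?_⟩
    refine (Run.push b false _).cast ?_ rfl
    simp [update_place_self, Data.snd, Data.word]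
  | cons x y =>
    obtain ⟨u₁, hu₁, h₁⟩ := run_moveTree (a := b) (b := b + 1) (c := b + 2) (by omega) (by omega)
      (by omega) x y.word (place s b [x.word ++ y.word, [], []]) (by simp) (by simp)
    have h₂ := run_clear x.word.reverse (place s b [y.word, x.word.reverse, []]) (a := b + 1)
      (by simp)
    simp [update_place_add, update_place_self] at h₁ h₂
    refine ⟨_, ?_, .popTrue (l := x.word ++ y.word) (by simp [Data.word])
      (Run.seq (t := u₁) (s' := place s b [y.word, x.word.reverse, []]) ?_ h₂)⟩
    · simp only [Data.word, List.length_cons, List.length_append]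
      omega
    · simpa [update_place_self] using h₁

/-- Run `P` or `Q` on `x`, depending on whether `C` computes a pair or `nil` from `x`. -/
def iteProg (C P Q : ℕ → StackProg) (b : ℕ) : StackProg :=
  seq (copy b (b + 1) (b + 2)) <| seq (C (b + 1)) <|
  pop (b + 1) skip (seq (clear (b + 1)) (P b)) (Q b)

/-- The condition is evaluated on a copy, so that `x` survives for the branch. One letter decides,
and for `nil` it is the whole word, so nothing has to be cleared. -/
theorem Computes.iteNil (hC : Computes R x .nil t) (h : Computes Q x y t') :
    Computes (iteProg R P Q) x y (t + t' + 7 * x.word.length + 3) := by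
  refine computes_of_place (n := 2) fun s b => ?_
  have h₁ := run_copy (a := b) (b := b + 1) (c := b + 2) (by omega) (by omega) (by omega) x.word
    (place s b [x.word, [], []]) (by simp) (by simp)
  obtain ⟨u₂, hu₂, h₂⟩ := hC.place_run s b [x.word] 1
  obtain ⟨u₃, hu₃, h₃⟩ := h.place_run s b [] 2
  simp [update_place_add] at h₁ h₂ h₃
  refine ⟨_, ?_, h₁.seq <| h₂.seq <| .popFalse (l := []) (by simp [Data.word]) (t := u₃) ?_⟩
  · omega
  · simpa [update_place_add] using h₃

theorem Computes.iteCons {a c : Data} (hC : Computes R x (.cons a c) t) (h : Computes P x y t') :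
    Computes (iteProg R P Q) x y
      (t + t' + 7 * x.word.length + 3 * (Data.cons a c).word.length + 4) := by
  refine computes_of_place (n := 2) fun s b => ?_
  have h₁ := run_copy (a := b) (b := b + 1) (c := b + 2) (by omega) (by omega) (by omega) x.word
    (place s b [x.word, [], []]) (by simp) (by simp)
  obtain ⟨u₂, hu₂, h₂⟩ := hC.place_run s b [x.word] 1
  have h₃ := run_clear (a.word ++ c.word) (place s b [x.word, a.word ++ c.word, []]) (a := b + 1)
    (by simp)
  obtain ⟨u₄, hu₄, h₄⟩ := h.place_run s b [] 2
  simp [update_place_add] at h₁ h₂ h₃ h₄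
  refine ⟨_, ?_, h₁.seq <| h₂.seq <| .popTrue (l := a.word ++ c.word) (by simp [Data.word])
    (t := 3 * (a.word.length + c.word.length) + 1 + u₄) ?_⟩
  · simp only [Data.word, List.length_cons, List.length_append]
    omega
  · refine Run.seq (s' := place s b [x.word, [], []]) ?_ (by simpa using h₄)
    simpa [update_place_add] using h₃

/-- A list of trees as a tree. -/
def _root_.Data.ofList (l : List Data) : Data := l.foldr .cons .nil

/-- One round of a fold: stack `b` holds the parameter, stack `b + 1` the rest of the list, and
stack `b + 2` the state. -/
def foldStep (P : ℕ → StackProg) (b : ℕ) : StackProg :=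
  seq (copy b (b + 3) (b + 4)) <| seq (moveTree (b + 1) (b + 4) (b + 5)) <|
  seq (move (b + 4) (b + 3)) <| seq (push (b + 3) true) <|
  seq (transfer (b + 2) (b + 3) (b + 4)) <| seq (push (b + 3) true) <|
  seq (P (b + 3)) (transfer (b + 3) (b + 2) (b + 4))

/-- Fold the list that `L` computes, starting from the state that `I` computes, and computing the
next state by `P` from the state, the list item and the parameter. -/
def foldProg (L I P : ℕ → StackProg) (b : ℕ) : StackProg :=
  seq (copy b (b + 1) (b + 2)) <| seq (L (b + 1)) <|
  seq (copy b (b + 2) (b + 3)) <| seq (I (b + 2)) <|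
  seq (loop (b + 1) (pop (b + 1) skip (foldStep P b) skip)) <|
  seq (clear b) (transfer (b + 2) b (b + 3))

/-- The argument of `P` is assembled from its end: the parameter, then the item, then the state,
with a `true` for each pairing. -/
theorem run_foldStep {st d st' : Data} (l : List Bool)
    (h : Computes P (.cons st (.cons d x)) st' t) (s : Store) (b : ℕ) :
    ∃ t' ≤ t + 10 * x.word.length + 10 * d.word.length + 6 * st.word.length + 6 * st'.word.length
      + 20, Run (foldStep P b) (place s b [x.word, d.word ++ l, st.word, [], [], []])
        (place s b [x.word, l, st'.word, [], [], []]) t' := by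
  have h₁ := run_copy (a := b) (b := b + 3) (c := b + 4) (by omega) (by omega) (by omega) x.word
    (place s b [x.word, d.word ++ l, st.word, [], [], []]) (by simp) (by simp)
  obtain ⟨u₂, hu₂, h₂⟩ := run_moveTree (a := b + 1) (b := b + 4) (c := b + 5) (by omega) (by omega)
    (by omega) d l (place s b [x.word, d.word ++ l, st.word, x.word, [], []]) (by simp) (by simp)
  have h₃ := run_move (a := b + 4) (b := b + 3) (by omega) d.word.reverse
    (place s b [x.word, l, st.word, x.word, d.word.reverse, []]) (by simp)
  have h₄ := Run.push (b + 3) true (place s b [x.word, l, st.word, d.word ++ x.word, [], []])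
  have h₅ := run_transfer (a := b + 2) (b := b + 3) (c := b + 4) (by omega) (by omega) (by omega)
    st.word (place s b [x.word, l, st.word, (Data.cons d x).word, [], []]) (by simp) (by simp)
  have h₆ := Run.push (b + 3) true
    (place s b [x.word, l, [], st.word ++ (Data.cons d x).word, [], []])
  obtain ⟨u₇, hu₇, h₇⟩ := h.place_run s b [x.word, l, []] 2
  have h₈ := run_transfer (a := b + 3) (b := b + 2) (c := b + 4) (by omega) (by omega) (by omega)
    st'.word (place s b [x.word, l, [], st'.word, [], []]) (by simp) (by simp)
  simp [update_place_add, Data.word] at h₁ h₂ h₃ h₄ h₅ h₆ h₇ h₈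
  refine ⟨_, ?_, h₁.seq <| h₂.seq <| h₃.seq <| h₄.seq <| h₅.seq <| h₆.seq <| h₇.seq h₈⟩
  omega

/-- One bound `B` for the items and for the states after all prefixes makes the cost of every round
uniform: `22 * B` collects `10` for the item and `6` each for the old and the new state. -/
theorem run_foldLoop {σ β : Type} (f : σ → β → σ) (cσ : σ → Data) (cβ : β → Data) (B : ℕ)
    (hP : ∀ st d, (cσ st).word.length ≤ B → (cβ d).word.length ≤ B →
      Computes P (.cons (cσ st) (.cons (cβ d) x)) (cσ (f st d)) t)
    (l : List β) (st : σ) (hl : ∀ d ∈ l, (cβ d).word.length ≤ B)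
    (hst : ∀ l', l' <+: l → (cσ (l'.foldl f st)).word.length ≤ B) (s : Store) (b : ℕ) :
    ∃ t' ≤ l.length * (t + 10 * x.word.length + 22 * B + 22) + 4,
      Run (loop (b + 1) (pop (b + 1) skip (foldStep P b) skip))
        (place s b [x.word, (Data.ofList (l.map cβ)).word, (cσ st).word, [], [], []])
        (place s b [x.word, [], (cσ (l.foldl f st)).word, [], [], []]) t' := by
  induction l generalizing st with
  | nil =>
    -- The terminator of the list is consumed by one extra round, which accounts for the final `4`.
    refine ⟨_, le_rfl, (Run.loopCons (t := 2) (t' := 1) (by simp [Data.ofList, Data.word])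
      (.popFalse (l := []) (by simp [Data.ofList, Data.word]) (.skip _))
      (Run.loopNil ?_)).cast ?_ (by simp)⟩
    · simp
    · simp [update_place_add]
  | cons d l ih =>
    obtain ⟨u₂, hu₂, h₂⟩ := ih (f st d) (fun e he => hl e (by simp [he]))
      (fun l' hl' => hst (d :: l') (by simpa using hl'))
    have hs := hst [] (by simp)
    have hs' := hst [d] (by simp)
    have hd := hl d (by simp)
    obtain ⟨u₁, hu₁, h₁⟩ := run_foldStep (Data.ofList (l.map cβ)).word (hP st d hs hd) s b
    refine ⟨_, ?_, Run.loopCons (by simp [Data.ofList, Data.word])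
      (.popTrue (l := (cβ d).word ++ (Data.ofList (l.map cβ)).word)
        (t := u₁) (by simp [Data.ofList, Data.word]) ?_) h₂⟩
    · simp only [List.foldl_nil, List.foldl_cons] at hs hs'
      simp only [List.length_cons, Nat.add_mul]
      omega
    · simpa [update_place_add] using h₁

theorem computes_fold {σ β : Type} (f : σ → β → σ) (cσ : σ → Data) (cβ : β → Data) (B : ℕ)
    (hP : ∀ st d, (cσ st).word.length ≤ B → (cβ d).word.length ≤ B →
      Computes P (.cons (cσ st) (.cons (cβ d) x)) (cσ (f st d)) t)
    (l : List β) (st : σ) (hl : ∀ d ∈ l, (cβ d).word.length ≤ B)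
    (hst : ∀ l', l' <+: l → (cσ (l'.foldl f st)).word.length ≤ B)
    (hL : Computes Q x (Data.ofList (l.map cβ)) t') (hI : Computes R x (cσ st) t'') :
    Computes (foldProg Q R P) x (cσ (l.foldl f st))
      (t' + t'' + l.length * (t + 10 * x.word.length + 22 * B + 22) + 17 * x.word.length
        + 6 * B + 20) := by
  refine computes_of_place (n := 5) fun s b => ?_
  have h₁ := run_copy (a := b) (b := b + 1) (c := b + 2) (by omega) (by omega) (by omega) x.word
    (place s b [x.word, [], [], [], [], []]) (by simp) (by simp)
  obtain ⟨u₂, hu₂, h₂⟩ := hL.place_run s b [x.word] 4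
  have h₃ := run_copy (a := b) (b := b + 2) (c := b + 3) (by omega) (by omega) (by omega) x.word
    (place s b [x.word, (Data.ofList (l.map cβ)).word, [], [], [], []]) (by simp) (by simp)
  obtain ⟨u₄, hu₄, h₄⟩ := hI.place_run s b [x.word, (Data.ofList (l.map cβ)).word] 3
  obtain ⟨u₅, hu₅, h₅⟩ := run_foldLoop f cσ cβ B hP l st hl hst s b
  have h₆ := run_clear x.word
    (place s b [x.word, [], (cσ (l.foldl f st)).word, [], [], []]) (a := b) (by simp)
  have h₇ := run_transfer (a := b + 2) (b := b) (c := b + 3) (by omega) (by omega) (by omega)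
    (cσ (l.foldl f st)).word (place s b [[], [], (cσ (l.foldl f st)).word, [], [], []])
    (by simp) (by simp)
  have hB := hst l (List.prefix_refl l)
  simp [update_place_add, update_place_self]
    at h₁ h₂ h₃ h₄ h₆ h₇
  refine ⟨_, ?_, h₁.seq <| h₂.seq <| h₃.seq <| h₄.seq <| h₅.seq <| h₆.seq h₇⟩
  omega

end StackProg

section

/-! ### Polynomial-time functions between types with a code -/

/-- A representation of the elements of a type by binary trees. -/
class DataCode (α : Type) where
  /-- The tree that represents an element. -/
  toData : α → Data

open DataCode

instance : DataCode Data := ⟨id⟩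
instance : DataCode Unit := ⟨fun _ => .nil⟩
instance : DataCode Bool := ⟨fun b => if b then .cons .nil .nil else .nil⟩
instance {α β : Type} [DataCode α] [DataCode β] : DataCode (α × β) :=
  ⟨fun x => .cons (toData x.1) (toData x.2)⟩
instance {α : Type} [DataCode α] : DataCode (List α) := ⟨fun l => .ofList (l.map toData)⟩
-- Numbers are written in unary. This is affordable because those of the verifier are arities,
-- action indices, counters and the budget, all bounded in terms of the input.
instance : DataCode ℕ := ⟨fun n => toData (List.replicate n ())⟩

/-- The size of the representation. -/
def dsize {α : Type} [DataCode α] (a : α) : ℕ := (toData a).word.length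

section

variable {α β γ σ : Type} [DataCode α] [DataCode β] [DataCode γ] [DataCode σ]

@[simp] theorem toData_true : toData true = .cons .nil .nil := rfl
@[simp] theorem toData_false : toData false = .nil := rfl
@[simp] theorem toData_prod (a : α) (b : β) : toData (a, b) = .cons (toData a) (toData b) := rfl
@[simp] theorem toData_nil : toData ([] : List α) = .nil := rfl
@[simp] theorem toData_cons (a : α) (l : List α) :
    toData (a :: l) = .cons (toData a) (toData l) := rfl

@[simp] theorem dsize_unit (a : Unit) : dsize a = 1 := rfl
@[simp] theorem dsize_prod (a : α) (b : β) : dsize (a, b) = dsize a + dsize b + 1 := by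
  simp [dsize, Data.word]
@[simp] theorem dsize_nil : dsize ([] : List α) = 1 := rfl
@[simp] theorem dsize_cons (a : α) (l : List α) : dsize (a :: l) = dsize a + dsize l + 1 := by
  simp [dsize, Data.word]
theorem dsize_bool_le (b : Bool) : dsize b ≤ 3 := by cases b <;> simp [dsize, Data.word]
@[simp] theorem dsize_nat (n : ℕ) : dsize n = 2 * n + 1 := by
  have : ∀ n, dsize (List.replicate n ()) = 2 * n + 1 := by
    intro n
    induction n with
    | zero => rfl
    | succ n ih => rw [List.replicate_succ, dsize_cons, ih, dsize_unit]; ring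
  exact this n

theorem one_le_dsize (a : α) : 1 ≤ dsize a := by
  unfold dsize
  cases toData a <;> simp [Data.word]

theorem dsize_append (l l' : List α) : dsize (l ++ l') + 1 = dsize l + dsize l' := by
  induction l with
  | nil => simp; ring
  | cons a l ih => simp only [List.cons_append, dsize_cons]; omega

theorem dsize_reverse (l : List α) : dsize l.reverse = dsize l := by
  induction l with
  | nil => rfl
  | cons a l ih =>
    have := dsize_append l.reverse [a]
    simp only [List.reverse_cons, dsize_cons, dsize_nil] at *
    omega

theorem dsize_le_of_sublist {l l' : List α} (h : l.Sublist l') : dsize l ≤ dsize l' := by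
  induction h with
  | slnil => rfl
  | cons a _ ih => simp only [dsize_cons]; omega
  | cons_cons a _ ih => simp only [dsize_cons]; omega

theorem dsize_le_of_mem {a : α} {l : List α} (h : a ∈ l) : dsize a + 2 ≤ dsize l := by
  have := dsize_le_of_sublist (List.singleton_sublist.mpr h)
  simp only [dsize_cons, dsize_nil] at this
  omega

theorem length_lt_dsize (l : List α) : 2 * l.length < dsize l := by
  induction l with
  | nil => simp
  | cons a l ih => have := one_le_dsize a; simp only [dsize_cons, List.length_cons]; omega

theorem dsize_le_length_mul {l : List α} {B : ℕ} (h : ∀ a ∈ l, dsize a ≤ B) :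
    dsize l ≤ l.length * (B + 1) + 1 := by
  induction l with
  | nil => simp
  | cons a l ih =>
    have h₁ := h a (by simp)
    have h₂ := ih (fun b hb => h b (by simp [hb]))
    simp only [dsize_cons, List.length_cons, Nat.add_mul]
    omega

theorem polynomial_eval_mono (p : Polynomial ℕ) {m n : ℕ} (h : m ≤ n) : p.eval m ≤ p.eval n := by
  induction p using Polynomial.induction_on' with
  | add p q hp hq => simp only [Polynomial.eval_add]; omega
  | monomial k a => simp only [Polynomial.eval_monomial]; gcongr

/-- The function `T` is bounded by a polynomial in the size of its argument. -/
def PolyBounded (T : α → ℕ) : Prop := ∃ p : Polynomial ℕ, ∀ a, T a ≤ p.eval (dsize a)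

namespace PolyBounded

variable {S T : α → ℕ}

theorem mono (h : PolyBounded T) (hS : ∀ a, S a ≤ T a) : PolyBounded S := by
  obtain ⟨p, hp⟩ := h
  exact ⟨p, fun a => (hS a).trans (hp a)⟩

theorem const (n : ℕ) : PolyBounded fun _ : α => n := ⟨.C n, fun _ => by simp⟩

theorem size : PolyBounded fun a : α => dsize a := ⟨.X, fun _ => by simp⟩

theorem add (hS : PolyBounded S) (hT : PolyBounded T) : PolyBounded fun a => S a + T a := by
  obtain ⟨p, hp⟩ := hS
  obtain ⟨q, hq⟩ := hT
  exact ⟨p + q, fun a => by simpa using add_le_add (hp a) (hq a)⟩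

theorem mul (hS : PolyBounded S) (hT : PolyBounded T) : PolyBounded fun a => S a * T a := by
  obtain ⟨p, hp⟩ := hS
  obtain ⟨q, hq⟩ := hT
  exact ⟨p * q, fun a => by simpa using Nat.mul_le_mul (hp a) (hq a)⟩

theorem eval (hT : PolyBounded T) (p : Polynomial ℕ) : PolyBounded fun a => p.eval (T a) := by
  obtain ⟨q, hq⟩ := hT
  exact ⟨p.comp q, fun a => by simpa using polynomial_eval_mono p (hq a)⟩

theorem comp {f : β → α} (hT : PolyBounded T) (hf : PolyBounded fun b => dsize (f b)) :
    PolyBounded fun b => T (f b) := by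
  obtain ⟨p, hp⟩ := hT
  exact (hf.eval p).mono fun b => hp (f b)

end PolyBounded

open StackProg in
/-- The function `f` is computed by a structured program in polynomial time. -/
def PolyTime (f : α → β) : Prop :=
  ∃ (P : ℕ → StackProg) (T : α → ℕ), PolyBounded T ∧ PolyBounded (fun a => dsize (f a)) ∧
    ∀ a, Computes P (toData a) (toData (f a)) (T a)

namespace PolyTime

open StackProg PolyBounded

variable {f : α → β} {g : α → γ}

theorem size_bounded (hf : PolyTime f) : PolyBounded fun a => dsize (f a) := by
  obtain ⟨P, T, hT, hs, h⟩ := hf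
  exact hs

/-- Programs see codes only, so functions into different types share a program when their values
have the same code. Pairs and non-empty lists, or numbers and lists of units, are exchanged in this
way. -/
theorem of_code {g : α → γ} (hg : PolyTime g) (h : ∀ a, toData (f a) = toData (g a)) :
    PolyTime f := by
  obtain ⟨P, T, hT, hs, hP⟩ := hg
  refine ⟨P, T, hT, hs.mono fun a => ?_, fun a => h a ▸ hP a⟩
  simp [dsize, h]

theorem of_eq {g : α → β} (hg : PolyTime g) (h : ∀ a, f a = g a) : PolyTime f :=
  hg.of_code fun a => by rw [h]

/-- The size bound carried by `PolyTime` is what bounds the time of the second program in terms of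
the original argument. -/
theorem comp {g : β → γ} (hg : PolyTime g) (hf : PolyTime f) : PolyTime fun a => g (f a) := by
  obtain ⟨P, T, hT, hs, hP⟩ := hf
  obtain ⟨Q, U, hU, hr, hQ⟩ := hg
  exact ⟨_, fun a => T a + U (f a), hT.add (hU.comp hs), hr.comp hs, fun a => (hP a).comp (hQ (f a))⟩

theorem id : PolyTime fun a : α => a :=
  ⟨fun _ => .skip, fun _ => 1, .const 1, .size, fun a b s hs _ =>
    ⟨1, le_rfl, (Run.skip s).cast (by rw [← hs, Function.update_eq_self]) rfl⟩⟩

theorem const (b : β) : PolyTime fun _ : α => b :=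
  ⟨_, fun a => 3 * dsize a + dsize b + 2, ((mul (.const 3) .size).add (.const _)).add (.const 2),
    .const _, fun a => computes_const (toData a) (toData b)⟩

theorem prod (hf : PolyTime f) (hg : PolyTime g) : PolyTime fun a => (f a, g a) := by
  obtain ⟨P, T, hT, hs, hP⟩ := hf
  obtain ⟨Q, U, hU, hr, hQ⟩ := hg
  refine ⟨_, fun a => T a + U a + 17 * dsize a + 6 * dsize (f a) + 6 * dsize (g a) + 10,
    ((((hT.add hU).add (mul (.const 17) .size)).add (mul (.const 6) hs)).add
      (mul (.const 6) hr)).add (.const 10), ?_, fun a => (hP a).pair (hQ a)⟩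
  simp only [dsize_prod]
  exact (hs.add hr).add (.const 1)

theorem dataFst : PolyTime Data.fst := by
  refine ⟨_, fun a => 9 * dsize a + 5, (mul (.const 9) .size).add (.const 5), size.mono fun a => ?_,
    fun a => computes_fst a⟩
  cases a with
  | nil => rfl
  | cons a b => simp only [dsize, toData, _root_.id, Data.word, Data.fst, List.length_cons,
      List.length_append]; omega

theorem dataSnd : PolyTime Data.snd := by
  refine ⟨_, fun a => 9 * dsize a + 5, (mul (.const 9) .size).add (.const 5), size.mono fun a => ?_,
    fun a => computes_snd a⟩
  cases a with
  | nil => rfl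
  | cons a b => simp only [dsize, toData, _root_.id, Data.word, Data.snd, List.length_cons,
      List.length_append]; omega

theorem data : PolyTime (toData : α → Data) := of_code (g := fun a : α => a) id fun _ => rfl

theorem fst {f : α → β × γ} (hf : PolyTime f) : PolyTime fun a => (f a).1 :=
  of_code (dataFst.comp (data.comp hf)) fun _ => rfl

theorem snd {f : α → β × γ} (hf : PolyTime f) : PolyTime fun a => (f a).2 :=
  of_code (dataSnd.comp (data.comp hf)) fun _ => rfl

theorem ite_data {c : α → Data} {g : α → β} (hc : PolyTime c) (hf : PolyTime f)
    (hg : PolyTime g) : PolyTime fun a => if c a = .nil then f a else g a := by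
  obtain ⟨R, V, hV, hq, hR⟩ := hc
  obtain ⟨P, T, hT, hs, hP⟩ := hf
  obtain ⟨Q, U, hU, hr, hQ⟩ := hg
  refine ⟨iteProg R Q P, fun a => V a + (T a + U a) + 7 * dsize a + 3 * dsize (c a) + 4,
    (((hV.add (hT.add hU)).add (mul (.const 7) .size)).add (mul (.const 3) hq)).add (.const 4),
    (hs.add hr).mono fun a => ?_, fun a => ?_⟩
  · dsimp only
    split_ifs <;> omega
  · have hR : Computes R (toData a) (c a) (V a) := hR a
    dsimp only
    cases hc : c a with
    | nil =>
      rw [hc] at hR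
      rw [if_pos rfl]
      exact (Computes.iteNil (P := Q) hR (hP a)).mono (by simp only [dsize]; omega)
    | cons u v =>
      rw [hc] at hR
      rw [if_neg (by simp)]
      refine (Computes.iteCons (Q := P) hR (hQ a)).mono ?_
      have : (toData (Data.cons u v)).word.length = (Data.cons u v).word.length := rfl
      simp only [dsize] at this ⊢
      omega

theorem cond {c : α → Bool} {g : α → β} (hc : PolyTime c) (hf : PolyTime f) (hg : PolyTime g) :
    PolyTime fun a => bif c a then f a else g a :=
  of_eq (ite_data (data.comp hc) hg hf) fun a => by cases c a <;> simp

theorem ite {p : α → Prop} [DecidablePred p] {g : α → β} (hc : PolyTime fun a => decide (p a))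
    (hf : PolyTime f) (hg : PolyTime g) : PolyTime fun a => if p a then f a else g a :=
  of_eq (cond hc hf hg) fun a => by by_cases h : p a <;> simp [h]

theorem and {f g : α → Bool} (hf : PolyTime f) (hg : PolyTime g) :
    PolyTime fun a => f a && g a :=
  of_eq (cond hf hg (const false)) fun a => by cases f a <;> rfl

theorem or {f g : α → Bool} (hf : PolyTime f) (hg : PolyTime g) :
    PolyTime fun a => f a || g a :=
  of_eq (cond hf (const true) hg) fun a => by cases f a <;> rfl

theorem not {f : α → Bool} (hf : PolyTime f) : PolyTime fun a => !f a :=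
  of_eq (cond hf (const false) (const true)) fun a => by cases f a <;> rfl

theorem cons {f : α → β} {l : α → List β} (hf : PolyTime f) (hl : PolyTime l) :
    PolyTime fun a => f a :: l a :=
  of_code (prod hf hl) fun _ => rfl

/-- For a non-empty list, the code of `(a, l a)` is already that of `(a, b, t)`: pairing the
argument with the list is enough to match on it. -/
theorem list_cases {l : α → List β} {f : α → γ} {g : α → β → List β → γ} (hl : PolyTime l)
    (hf : PolyTime f) (hg : PolyTime fun y : α × β × List β => g y.1 y.2.1 y.2.2) :
    PolyTime fun a => match l a with
      | [] => f a
      | b :: t => g a b t := by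
  obtain ⟨R, V, hV, hq, hR⟩ := hl
  obtain ⟨P, T, hT, hs, hP⟩ := hf
  obtain ⟨Q, U, ⟨u, hU⟩, ⟨v, hr⟩, hQ⟩ := hg
  let M : α → ℕ := fun a => dsize a + dsize (l a) + 1
  have hM : PolyBounded M := (size.add hq).add (.const 1)
  refine ⟨iteProg R (fun b => seq (pairProg (fun _ => .skip) R b) (Q b)) P,
    fun a => V a + T a + V a + u.eval (M a) + 30 * dsize a + 9 * dsize (l a) + 15,
    (((((hV.add hT).add hV).add (hM.eval u)).add (mul (.const 30) .size)).add
      (mul (.const 9) hq)).add (.const 15), (hs.add (hM.eval v)).mono fun a => ?_, fun a => ?_⟩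
  · dsimp only
    split
    · exact Nat.le_add_right _ _
    · rename_i b t hl
      refine (hr (a, b, t)).trans ((polynomial_eval_mono v ?_).trans (Nat.le_add_left _ _))
      simp only [dsize_prod, M, hl, dsize_cons]
      omega
  · have hR := hR a
    dsimp only
    have hid : Computes (fun _ => .skip) (toData a) (toData a) 1 := fun b s hs _ =>
      ⟨1, le_rfl, (Run.skip s).cast (by rw [← hs, Function.update_eq_self]) rfl⟩
    have h₁ := hid.pair hR
    split
    · rename_i hl
      rw [hl] at hR
      exact (Computes.iteNil hR (hP a)).mono (by simp only [dsize]; omega)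
    · rename_i b t hl
      rw [hl] at hR h₁
      refine (Computes.iteCons (a := toData b) (c := toData t) hR (h₁.comp (hQ (a, b, t)))).mono ?_
      have h₂ := (hU (a, b, t)).trans (polynomial_eval_mono u (n := M a) (by
        simp only [dsize_prod, M, hl, dsize_cons]
        omega))
      have h₃ : (toData (l a)).word.length = (toData (b :: t)).word.length := by rw [hl]
      simp only [dsize, toData_cons] at h₃ ⊢
      omega

/-- Iterating a polynomial-time step may let the state explode, so a polynomial bound on all
intermediate states is demanded. With it, the cost is the number of items times the cost of a step
of bounded size. -/
theorem foldl {l : α → List β} {i : α → σ} {f : α → σ → β → σ} {B : α → ℕ} (hl : PolyTime l)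
    (hi : PolyTime i) (hf : PolyTime fun y : σ × β × α => f y.2.2 y.1 y.2.1) (hB : PolyBounded B)
    (h : ∀ a l', l' <+: l a → dsize (l'.foldl (f a) (i a)) ≤ B a) :
    PolyTime fun a => (l a).foldl (f a) (i a) := by
  obtain ⟨Q, T, hT, hq, hQ⟩ := hl
  obtain ⟨R, U, hU, hr, hR⟩ := hi
  obtain ⟨P, V, ⟨p, hp⟩, hs, hP⟩ := hf
  let M : α → ℕ := fun a => B a + dsize (l a)
  have hM : PolyBounded M := hB.add hq
  refine ⟨foldProg Q R P, fun a => T a + U a + dsize (l a) *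
      (p.eval (M a + (M a + dsize a + 1) + 1) + 10 * dsize a + 22 * M a + 22) + 17 * dsize a
      + 6 * M a + 20, ?_, hB.mono fun a => h a _ (List.prefix_refl _), fun a => ?_⟩
  · exact (((((hT.add hU).add (hq.mul ((((((hM.add ((hM.add .size).add (.const 1))).add
      (.const 1)).eval p).add (mul (.const 10) .size)).add (mul (.const 22) hM)).add
      (.const 22)))).add (mul (.const 17) .size)).add (mul (.const 6) hM)).add (.const 20))
  · refine (computes_fold (f a) toData toData (M a) (fun st d hst hd => ?_) (l a) (i a)
      (fun d hd => ?_) (fun l' hl' => (h a l' hl').trans (Nat.le_add_right _ _)) (hQ a)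
      (hR a) (t := p.eval (M a + (M a + dsize a + 1) + 1))).mono ?_
    · refine (hP (st, d, a)).mono ((hp _).trans (polynomial_eval_mono p ?_))
      simp only [dsize_prod]
      simp only [dsize] at *
      omega
    · have := dsize_le_of_mem hd
      simp only [dsize, M] at *
      omega
    · have h₁ := length_lt_dsize (l a)
      have h₂ := Nat.mul_le_mul_right
        (p.eval (M a + (M a + dsize a + 1) + 1) + 10 * dsize a + 22 * M a + 22)
        (show (l a).length ≤ dsize (l a) by omega)
      simp only [dsize] at *
      omega

end PolyTime

end

/-! ### Polynomial-time functions on lists and numbers -/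

namespace PolyTime

open StackProg PolyBounded

variable {α β γ σ : Type} [DataCode α] [DataCode β] [DataCode γ] [DataCode σ]

theorem _root_.foldl_cons_eq {β : Type} (u v : List β) :
    u.foldl (fun s b => b :: s) v = u.reverse ++ v := by
  induction u generalizing v with
  | nil => simp
  | cons b u ih => simp [ih]

theorem reverse {l : α → List β} (hl : PolyTime l) : PolyTime fun a => (l a).reverse := by
  refine of_eq (foldl (f := fun _ s b => b :: s) (B := fun a => dsize (l a)) hl (const [])
    (cons (fst (snd id)) (fst id)) hl.size_bounded fun a l' h => ?_) fun a => ?_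
  · rw [foldl_cons_eq, List.append_nil, dsize_reverse]
    exact dsize_le_of_sublist h.sublist
  · rw [foldl_cons_eq, List.append_nil]

theorem append {l m : α → List β} (hl : PolyTime l) (hm : PolyTime m) :
    PolyTime fun a => l a ++ m a := by
  refine of_eq (foldl (f := fun _ s b => b :: s) (B := fun a => dsize (l a) + dsize (m a))
    (reverse hl) hm (cons (fst (snd id)) (fst id)) (hl.size_bounded.add hm.size_bounded)
    fun a l' h => ?_) fun a => ?_
  · rw [foldl_cons_eq]
    have h₁ := dsize_append l'.reverse (m a)
    have h₂ := dsize_le_of_sublist h.sublist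
    rw [dsize_reverse] at h₁ h₂
    omega
  · rw [foldl_cons_eq, List.reverse_reverse]

/-- A fold that appends the images. Its states are the images of prefixes, hence bounded by the
number of items times the largest image. -/
theorem flatMap {l : α → List β} {f : α → β → List γ} (hl : PolyTime l)
    (hf : PolyTime fun y : α × β => f y.1 y.2) : PolyTime fun a => (l a).flatMap (f a) := by
  have key : ∀ (g : β → List γ) (u : List β) (v : List γ),
      u.foldl (fun s b => s ++ g b) v = v ++ u.flatMap g := by
    intro g u
    induction u with
    | nil => simp
    | cons b u ih => intro v; simp [ih]
  obtain ⟨p, hp⟩ := hf.size_bounded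
  refine of_eq (foldl (f := fun a s b => s ++ f a b)
    (B := fun a => dsize (l a) * (p.eval (dsize a + dsize (l a) + 1) + 1) + 1) hl (const [])
    (append (fst id) (hf.comp (prod (snd (snd id)) (fst (snd id)))))
    ((hl.size_bounded.mul ((((size.add hl.size_bounded).add (.const 1)).eval p).add
      (.const 1))).add (.const 1)) fun a l' h => ?_) fun a => ?_
  · have h₁ : ∀ b ∈ l', dsize (f a b) ≤ p.eval (dsize a + dsize (l a) + 1) := by
      intro b hb
      refine (hp (a, b)).trans (polynomial_eval_mono p ?_)
      have := dsize_le_of_mem (h.subset hb)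
      simp only [dsize_prod]
      omega
    have h₂ : dsize (l'.flatMap (f a)) ≤
        l'.length * (p.eval (dsize a + dsize (l a) + 1) + 1) + 1 := by
      clear h
      induction l' with
      | nil => simp
      | cons b l' ih =>
        have h₃ := ih fun c hc => h₁ c (by simp [hc])
        have h₄ := h₁ b (by simp)
        have h₅ := dsize_append (f a b) (l'.flatMap (f a))
        simp only [List.flatMap_cons, List.length_cons, Nat.add_mul] at *
        omega
    have h₃ := Nat.mul_le_mul_right (p.eval (dsize a + dsize (l a) + 1) + 1)
      (show l'.length ≤ dsize (l a) from by
        have := length_lt_dsize (l a)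
        have := h.length_le
        omega)
    rw [key, List.nil_append]
    omega
  · rw [key, List.nil_append]

theorem map {l : α → List β} {f : α → β → γ} (hl : PolyTime l)
    (hf : PolyTime fun y : α × β => f y.1 y.2) : PolyTime fun a => (l a).map (f a) :=
  of_eq (flatMap (f := fun a b => [f a b]) hl (cons hf (const []))) fun a => by
    induction l a <;> simp_all

theorem filter {l : α → List β} {f : α → β → Bool} (hl : PolyTime l)
    (hf : PolyTime fun y : α × β => f y.1 y.2) : PolyTime fun a => (l a).filter (f a) :=
  of_eq (flatMap (f := fun a b => bif f a b then [b] else []) hl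
    (cond hf (cons (snd id) (const [])) (const []))) fun a => by
    induction l a with
    | nil => rfl
    | cons b l ih => cases h : f a b <;> simp [h, ih]

theorem isEmpty {l : α → List β} (hl : PolyTime l) : PolyTime fun a => (l a).isEmpty :=
  of_eq (list_cases hl (const true) (const (α := α × β × List β) false))
    fun a => by cases l a <;> rfl

theorem all {l : α → List β} {f : α → β → Bool} (hl : PolyTime l)
    (hf : PolyTime fun y : α × β => f y.1 y.2) : PolyTime fun a => (l a).all (f a) :=
  of_eq (isEmpty (filter (f := fun a b => !f a b) hl (not hf))) fun a => by
    rw [Bool.eq_iff_iff]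
    simp [List.isEmpty_iff, List.filter_eq_nil_iff]

theorem any {l : α → List β} {f : α → β → Bool} (hl : PolyTime l)
    (hf : PolyTime fun y : α × β => f y.1 y.2) : PolyTime fun a => (l a).any (f a) :=
  of_eq (not (all (f := fun a b => !f a b) hl (not hf))) fun a => by
    rw [Bool.eq_iff_iff]
    simp

theorem tail {l : α → List β} (hl : PolyTime l) : PolyTime fun a => (l a).tail :=
  of_eq (list_cases (g := fun _ _ t => t) hl (const []) (snd (snd id)))
    fun a => by cases l a <;> rfl

/-- The program is built by recursion on the fixed tree `d`, so it inspects `x` only as deeply as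
`d` reaches. -/
theorem beq_data (d : Data) : PolyTime fun x : Data => decide (x = d) := by
  induction d with
  | nil =>
    exact of_eq (ite_data (c := fun x : Data => x) id (const true) (const false)) fun x => by
      by_cases h : x = .nil
      · rw [if_pos h]; simp [h]
      · rw [if_neg h]; simp [h]
  | cons a b iha ihb =>
    refine of_eq (ite_data (c := fun x : Data => x) id (const false)
      (and (iha.comp dataFst) (ihb.comp dataSnd))) fun x => ?_
    cases x with
    | nil => simp
    | cons u v =>
      change _ = if _ then _ else (decide (u = a) && decide (v = b))
      simp

/-- Every function on a finite type is computable in polynomial time. -/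
theorem of_finite [Finite α] (h : Function.Injective (toData : α → Data)) (f : α → β) :
    PolyTime f := by
  classical
  -- A table lookup. Results are wrapped in lists, with `[]` for a missing entry, because `β` offers
  -- no default value; the head is extracted at the end.
  have key : ∀ l : List α, ∃ g : Data → List β, PolyTime g ∧ ∀ a ∈ l, g (toData a) = [f a] := by
    intro l
    induction l with
    | nil => exact ⟨fun _ => [], const _, by simp⟩
    | cons a l ih =>
      obtain ⟨g, hg, h'⟩ := ih
      refine ⟨fun x => if x = toData a then [f a] else g x,
        ite (p := fun x => x = toData a) (beq_data _) (const _) hg, fun b hb => ?_⟩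
      by_cases hab : b = a
      · simp [hab]
      · simp only [List.mem_cons, hab, false_or] at hb
        simp [h.eq_iff, hab, h' b hb]
  obtain ⟨l, hl⟩ : ∃ l : List α, ∀ a, a ∈ l := by
    have := Fintype.ofFinite α
    exact ⟨Finset.univ.toList, fun a => by simp⟩
  obtain ⟨g, hg, h'⟩ := key l
  refine of_code (dataFst.comp (data.comp (hg.comp data))) fun a => ?_
  rw [h' a (hl a)]
  rfl

/-- Equality of lists, given a test for the equality of their elements. -/
theorem beq_list [DecidableEq β] {l m : α → List β} (hl : PolyTime l) (hm : PolyTime m)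
    (h : PolyTime fun y : β × β => decide (y.1 = y.2)) :
    PolyTime fun a => decide (l a = m a) := by
  let f : List β × Bool → β → List β × Bool := fun s b => match s.1 with
    | [] => ([], false)
    | c :: t => (t, s.2 && decide (b = c))
  -- The flag records the matches so far; equality also requires that nothing of the second list is
  -- left.
  have key : ∀ (u v : List β) (c : Bool), ((u.foldl f (v, c)).2 && (u.foldl f (v, c)).1.isEmpty)
      = (c && decide (u = v)) := by
    intro u
    induction u with
    | nil => intro v c; cases v <;> simp
    | cons b u ih =>
      intro v c
      cases v with
      | nil => simp [f, ih]
      | cons d v => simp [f, ih, Bool.and_assoc]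
  have hsize : ∀ (u v : List β) (c : Bool), dsize (u.foldl f (v, c)) ≤ dsize v + 4 := by
    intro u
    induction u with
    | nil => intro v c; simp only [List.foldl_nil, dsize_prod]; have := dsize_bool_le c; omega
    | cons b u ih =>
      intro v c
      cases v with
      | nil => exact ih [] false
      | cons d v =>
        refine (ih v _).trans ?_
        simp only [dsize_cons]
        omega
  have hf : PolyTime fun y : (List β × Bool) × β × α => f y.1 y.2.1 :=
    of_eq (list_cases (l := fun y : (List β × Bool) × β × α => y.1.1)
      (f := fun _ => (([] : List β), false))
      (g := fun y c t => (t, y.1.2 && decide (y.2.1 = c))) (fst (fst id)) (const _)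
      (prod (snd (snd id)) (and (snd (fst (fst id)))
        (h.comp (prod (fst (snd (fst id))) (fst (snd id))))))) fun y => rfl
  have := foldl (f := fun _ => f) (B := fun a => dsize (m a) + 4) hl (prod hm (const true)) hf
    (hm.size_bounded.add (.const 4)) fun a l' _ => hsize l' (m a) true
  refine of_eq (and (snd this) (isEmpty (fst this))) fun a => ?_
  rw [key]
  simp

theorem beq_unit : PolyTime fun y : Unit × Unit => decide (y.1 = y.2) :=
  of_eq (const true) fun _ => by simp

theorem beq_bool : PolyTime fun y : Bool × Bool => decide (y.1 = y.2) :=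
  of_eq (cond (fst id) (snd id) (not (snd id))) fun y => by
    obtain ⟨a, b⟩ := y
    cases a <;> cases b <;> rfl

/-- The list of `n` units. -/
theorem units {n : α → ℕ} (hn : PolyTime n) : PolyTime fun a => List.replicate (n a) () :=
  of_code hn fun _ => rfl

theorem of_units {n : α → ℕ} (h : PolyTime fun a => List.replicate (n a) ()) : PolyTime n :=
  of_code h fun _ => rfl

theorem beq_nat {m n : α → ℕ} (hm : PolyTime m) (hn : PolyTime n) :
    PolyTime fun a => decide (m a = n a) :=
  of_eq (beq_list (units hm) (units hn) beq_unit) fun a => by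
    rw [Bool.eq_iff_iff]
    simp

theorem length {l : α → List β} (hl : PolyTime l) : PolyTime fun a => (l a).length :=
  of_units (of_eq (map (f := fun _ _ => ()) hl (const ())) fun a => by simp [List.map_const'])

theorem succ {n : α → ℕ} (hn : PolyTime n) : PolyTime fun a => n a + 1 :=
  of_units (of_eq (cons (const ()) (units hn)) fun _ => rfl)

theorem pred {n : α → ℕ} (hn : PolyTime n) : PolyTime fun a => n a - 1 :=
  of_units (of_eq (tail (units hn)) fun a => by simp)

/-- The list of the numbers below `n`, in decreasing order. -/
def _root_.downFrom (n : ℕ) : List ℕ := (List.range n).reverse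

/-- Putting the current length in front of the list, `n` times, produces decreasing order; the
derivations enumerate actions in the same order. -/
theorem downFrom {n : α → ℕ} (hn : PolyTime n) : PolyTime fun a => downFrom (n a) := by
  let f : List ℕ → Unit → List ℕ := fun s _ => s.length :: s
  have key : ∀ k, (List.replicate k ()).foldl f [] = _root_.downFrom k := by
    intro k
    have : (List.replicate k ()).foldl f [] =
        (List.replicate k ()).foldr (fun _ s => f s ()) [] := by
      rw [← List.foldr_reverse, List.reverse_replicate]
    rw [this]
    induction k with
    | zero => rfl
    | succ k ih =>
      rw [List.replicate_succ, List.foldr_cons, ih (by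
        rw [← List.foldr_reverse, List.reverse_replicate])]
      simp [f, _root_.downFrom, List.range_succ]
  have hd : ∀ k, dsize (_root_.downFrom k) ≤ k * (2 * k + 2) + 1 := by
    intro k
    have := dsize_le_length_mul (l := _root_.downFrom k) (B := 2 * k + 1) fun a ha => by
      simp only [_root_.downFrom, List.mem_reverse, List.mem_range] at ha
      simp only [dsize_nat]
      omega
    simpa [_root_.downFrom] using this
  refine of_eq (foldl (f := fun _ => f)
    (B := fun a => dsize (n a) * (2 * dsize (n a) + 2) + 1) (units hn) (const [])
    (cons (length (fst id)) (fst id))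
    ((hn.size_bounded.mul ((mul (.const 2) hn.size_bounded).add (.const 2))).add (.const 1))
    fun a l' h => ?_) fun a => (key (n a)).symm
  obtain ⟨h₁, h₂⟩ := List.prefix_replicate_iff.mp h
  rw [h₂, key]
  have h₃ : l'.length ≤ dsize (n a) := by simp only [dsize_nat]; omega
  refine (hd _).trans ?_
  gcongr

end PolyTime

end

/-! ### Recursive descriptions of the notions for game trees -/

namespace GameTree

@[simp] theorem subtree?_chance {n : ℕ} (c : Fin (n + 1) → GameTree) (i : Fin (n + 1))
    (p : List ℕ) : (chance n c).subtree? ((i : ℕ) :: p) = (c i).subtree? p := by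
  rw [subtree?, dif_pos i.2]

@[simp] theorem subtree?_player {I n : ℕ} (c : Fin (n + 1) → GameTree) (i : Fin (n + 1))
    (p : List ℕ) : (player I n c).subtree? ((i : ℕ) :: p) = (c i).subtree? p := by
  rw [subtree?, dif_pos i.2]

@[simp] theorem hist_chance {n : ℕ} (c : Fin (n + 1) → GameTree) (i : Fin (n + 1))
    (p : List ℕ) : (chance n c).hist ((i : ℕ) :: p) = (c i).hist p := by
  rw [hist, dif_pos i.2]

@[simp] theorem hist_player {I n : ℕ} (c : Fin (n + 1) → GameTree) (i : Fin (n + 1))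
    (p : List ℕ) : (player I n c).hist ((i : ℕ) :: p) = (I, (i : ℕ)) :: (c i).hist p := by
  rw [hist, dif_pos i.2]

/-- Some node of the information set `I` has history `h`. -/
def HasNode (T : GameTree) (h : List GameAction) (I : ℕ) : Prop :=
  ∃ p, T.InInfoSet p I ∧ T.hist p = h

theorem not_hasNode_leaf (h : List GameAction) (I : ℕ) : ¬ leaf.HasNode h I := by
  rintro ⟨p, ⟨n, c, hp⟩, -⟩
  cases p <;> simp [subtree?] at hp

theorem hasNode_chance {n : ℕ} {c : Fin (n + 1) → GameTree} {h : List GameAction} {I : ℕ} :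
    (chance n c).HasNode h I ↔ ∃ i, (c i).HasNode h I := by
  constructor
  · rintro ⟨p, ⟨m, d, hp⟩, hh⟩
    cases p with
    | nil => simp [subtree?] at hp
    | cons i p =>
      by_cases hi : i < n + 1
      · simp only [subtree?, hist, hi, dif_pos] at hp hh
        exact ⟨_, p, ⟨m, d, hp⟩, hh⟩
      · simp [subtree?, hi] at hp
  · rintro ⟨i, p, ⟨m, d, hp⟩, hh⟩
    exact ⟨(i : ℕ) :: p, ⟨m, d, by simpa using hp⟩, by simpa using hh⟩

theorem hasNode_player {J n : ℕ} {c : Fin (n + 1) → GameTree} {h : List GameAction} {I : ℕ} :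
    (player J n c).HasNode h I ↔
      (h = [] ∧ I = J) ∨ ∃ (i : Fin (n + 1)) (h' : _), h = (J, (i : ℕ)) :: h' ∧ (c i).HasNode h' I := by
  constructor
  · rintro ⟨p, ⟨m, d, hp⟩, hh⟩
    cases p with
    | nil =>
      simp only [subtree?, Option.some.injEq, player.injEq] at hp
      exact .inl ⟨hh.symm, hp.1.symm⟩
    | cons i p =>
      by_cases hi : i < n + 1
      · simp only [subtree?, hist, hi, dif_pos] at hp hh
        exact .inr ⟨⟨i, hi⟩, _, hh.symm, p, ⟨m, d, hp⟩, rfl⟩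
      · simp [subtree?, hi] at hp
  · rintro (⟨rfl, rfl⟩ | ⟨i, h', rfl, p, ⟨m, d, hp⟩, hh⟩)
    · exact ⟨[], ⟨n, c, rfl⟩, rfl⟩
    · exact ⟨(i : ℕ) :: p, ⟨m, d, by simpa using hp⟩, by simpa using hh⟩

/-- Two histories branch at distinct actions of one information set. -/
def Branching (h h' : List GameAction) : Prop :=
  ∃ (s s₁ s₂ : List GameAction) (I i j : ℕ), i ≠ j ∧ h = s ++ (I, i) :: s₁ ∧ h' = s ++ (I, j) :: s₂

theorem branching_cons {l l' : GameAction} {h h' : List GameAction} :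
    Branching (l :: h) (l' :: h') ↔ (l.1 = l'.1 ∧ l.2 ≠ l'.2) ∨ (l = l' ∧ Branching h h') := by
  constructor
  · rintro ⟨s, s₁, s₂, I, i, j, hij, h₁, h₂⟩
    cases s with
    | nil =>
      simp only [List.nil_append, List.cons.injEq] at h₁ h₂
      exact .inl (by simp [h₁.1, h₂.1, hij])
    | cons a s =>
      simp only [List.cons_append, List.cons.injEq] at h₁ h₂
      exact .inr ⟨h₁.1.trans h₂.1.symm, s, s₁, s₂, I, i, j, hij, h₁.2, h₂.2⟩
  · rintro (⟨h₁, h₂⟩ | ⟨rfl, s, s₁, s₂, I, i, j, hij, rfl, rfl⟩)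
    · refine ⟨[], h, h', l.1, l.2, l'.2, h₂, rfl, ?_⟩
      rw [h₁]
      rfl
    · exact ⟨l :: s, s₁, s₂, I, i, j, hij, rfl, rfl⟩

theorem not_branching_nil_left (h : List GameAction) : ¬ Branching [] h := by
  rintro ⟨s, s₁, s₂, I, i, j, -, h₁, -⟩
  simp at h₁

theorem not_branching_nil_right (h : List GameAction) : ¬ Branching h [] := by
  rintro ⟨s, s₁, s₂, I, i, j, -, -, h₁⟩
  simp at h₁

/-- Equal vertices have equal histories, so the distinctness of vertices may be dropped. What
remains speaks of histories only and can be compared across trees. -/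
theorem alr_iff {T : GameTree} :
    T.ALR ↔ ∀ I h h', T.HasNode h I → T.HasNode h' I → h = h' ∨ Branching h h' := by
  constructor
  · rintro hT I _ _ ⟨p, hp, rfl⟩ ⟨q, hq, rfl⟩
    by_cases hpq : p = q
    · exact .inl (by rw [hpq])
    · exact hT I p q hpq hp hq
  · intro hT I p q _ hp hq
    exact hT I _ _ ⟨p, hp, rfl⟩ ⟨q, hq, rfl⟩

/-- The histories of the leaves. -/
def leafHists : GameTree → List (List GameAction)
  | leaf => [[]]
  | chance _ c => (List.ofFn fun i => (c i).leafHists).flatten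
  | player I _ c => (List.ofFn fun i => (c i).leafHists.map ((I, (i : ℕ)) :: ·)).flatten

theorem mem_leafHists_chance {n : ℕ} {c : Fin (n + 1) → GameTree} {h : List GameAction} :
    h ∈ (chance n c).leafHists ↔ ∃ i, h ∈ (c i).leafHists := by
  simp only [leafHists, List.mem_flatten, List.mem_ofFn]
  constructor
  · rintro ⟨_, ⟨i, rfl⟩, hh⟩
    exact ⟨i, hh⟩
  · rintro ⟨i, hh⟩
    exact ⟨_, ⟨i, rfl⟩, hh⟩

theorem mem_leafHists_player {I n : ℕ} {c : Fin (n + 1) → GameTree} {h : List GameAction} :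
    h ∈ (player I n c).leafHists ↔ ∃ i, ∃ h' ∈ (c i).leafHists, h = (I, (i : ℕ)) :: h' := by
  simp only [leafHists, List.mem_flatten, List.mem_ofFn]
  constructor
  · rintro ⟨_, ⟨i, rfl⟩, hh⟩
    obtain ⟨h', hh', rfl⟩ := List.mem_map.mp hh
    exact ⟨i, h', hh', rfl⟩
  · rintro ⟨i, h', hh, rfl⟩
    exact ⟨_, ⟨i, rfl⟩, List.mem_map.mpr ⟨h', hh, rfl⟩⟩

theorem mem_leafHists_iff {T : GameTree} {h : List GameAction} :
    h ∈ T.leafHists ↔ ∃ p ∈ T.leaves, T.hist p = h := by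
  induction T generalizing h with
  | leaf => simp [leafHists, leaves, hist, eq_comm]
  | chance n c ih =>
    rw [mem_leafHists_chance]
    simp only [ih, leaves, Finset.mem_biUnion, Finset.mem_univ, true_and, Finset.mem_image]
    constructor
    · rintro ⟨i, p, hp, rfl⟩
      exact ⟨(i : ℕ) :: p, ⟨i, p, hp, rfl⟩, by simp⟩
    · rintro ⟨_, ⟨i, p, hp, rfl⟩, rfl⟩
      exact ⟨i, p, hp, by simp⟩
  | player I n c ih =>
    rw [mem_leafHists_player]
    simp only [ih, leaves, Finset.mem_biUnion, Finset.mem_univ, true_and, Finset.mem_image]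
    constructor
    · rintro ⟨i, _, ⟨p, hp, rfl⟩, rfl⟩
      exact ⟨(i : ℕ) :: p, ⟨i, p, hp, rfl⟩, by simp⟩
    · rintro ⟨_, ⟨i, p, hp, rfl⟩, rfl⟩
      exact ⟨i, _, ⟨p, hp, rfl⟩, by simp⟩

theorem mem_leafMonomials {T : GameTree} {μ : MvPolynomial GameAction ℝ} :
    μ ∈ T.leafMonomials ↔ ∃ h ∈ T.leafHists, histMonomial h = μ := by
  simp only [leafMonomials, Finset.mem_image, mem_leafHists_iff]
  constructor
  · rintro ⟨p, hp, rfl⟩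
    exact ⟨_, ⟨p, hp, rfl⟩, rfl⟩
  · rintro ⟨_, ⟨p, hp, rfl⟩, rfl⟩
    exact ⟨p, hp, rfl⟩

theorem card_biUnion_cons {n : ℕ} (s : Fin (n + 1) → Finset (List ℕ)) :
    (Finset.univ.biUnion fun i => (s i).image fun p => (i : ℕ) :: p).card = ∑ i, (s i).card := by
  rw [Finset.card_biUnion]
  · refine Finset.sum_congr rfl fun i _ => Finset.card_image_of_injective _ ?_
    intro p q h
    simpa using h
  · intro i _ j _ hij
    simp only [Function.onFun]
    rw [Finset.disjoint_left]
    simp only [Finset.mem_image]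
    rintro _ ⟨p, -, rfl⟩ ⟨q, -, h⟩
    simp only [List.cons.injEq] at h
    exact hij (Fin.ext h.1.symm)

theorem size_leaf : leaf.size = 1 := rfl

theorem size_chance {n : ℕ} (c : Fin (n + 1) → GameTree) :
    (chance n c).size = ∑ i, (c i).size := card_biUnion_cons _

theorem size_player {I n : ℕ} (c : Fin (n + 1) → GameTree) :
    (player I n c).size = ∑ i, (c i).size := card_biUnion_cons _

theorem one_le_size (T : GameTree) : 1 ≤ T.size := by
  induction T with
  | leaf => exact le_rfl
  | chance n c ih =>
    rw [size_chance]
    exact (ih 0).trans (Finset.single_le_sum (f := fun i => (c i).size) (fun _ _ => Nat.zero_le _)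
      (Finset.mem_univ 0))
  | player I n c ih =>
    rw [size_player]
    exact (ih 0).trans (Finset.single_le_sum (f := fun i => (c i).size) (fun _ _ => Nat.zero_le _)
      (Finset.mem_univ 0))

/-- The information sets have as many actions as `act` says. -/
def Arity (act : ℕ → ℕ+) : GameTree → Prop
  | leaf => True
  | chance _ c => ∀ i, (c i).Arity act
  | player I n c => n + 1 = (act I : ℕ) ∧ ∀ i, (c i).Arity act

theorem arity_iff {act : ℕ → ℕ+} {T : GameTree} :
    T.Arity act ↔ ∀ p I n c, T.subtree? p = some (player I n c) → n + 1 = (act I : ℕ) := by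
  induction T with
  | leaf =>
    refine ⟨fun _ p I n c h => ?_, fun _ => trivial⟩
    cases p <;> simp [subtree?] at h
  | chance m d ih =>
    simp only [Arity, ih]
    constructor
    · intro H p I n c h
      cases p with
      | nil => simp [subtree?] at h
      | cons i p =>
        by_cases hi : i < m + 1
        · simp only [subtree?, hi, dif_pos] at h
          exact H _ p I n c h
        · simp [subtree?, hi] at h
    · intro H i p I n c h
      exact H ((i : ℕ) :: p) I n c (by simpa using h)
  | player J m d ih =>
    simp only [Arity, ih]
    constructor
    · rintro ⟨H₀, H⟩ p I n c h
      cases p with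
      | nil =>
        simp only [subtree?, Option.some.injEq, player.injEq] at h
        obtain ⟨rfl, rfl, -⟩ := h
        exact H₀
      | cons i p =>
        by_cases hi : i < m + 1
        · simp only [subtree?, hi, dif_pos] at h
          exact H _ p I n c h
        · simp [subtree?, hi] at h
    · intro H
      refine ⟨H [] J m d rfl, fun i p I n c h => ?_⟩
      exact H ((i : ℕ) :: p) I n c (by simpa using h)

theorem isGameStructure_iff {act : ℕ → ℕ+} {T : GameTree} :
    T.IsGameStructure act ↔ T ≠ leaf ∧ T.Arity act := by
  rw [IsGameStructure, arity_iff]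

/-- Every player node lies above some leaf, so the occurring information sets can be read off the
leaf histories. -/
theorem exists_hasNode_iff {T : GameTree} {I : ℕ} :
    (∃ h, T.HasNode h I) ↔ ∃ h ∈ T.leafHists, ∃ l ∈ h, l.1 = I := by
  induction T with
  | leaf => simp [not_hasNode_leaf, leafHists]
  | chance n c ih =>
    simp only [hasNode_chance, mem_leafHists_chance]
    rw [exists_comm]
    simp only [ih]
    grind
  | player J n c ih =>
    simp only [hasNode_player, mem_leafHists_player]
    constructor
    · rintro ⟨h, ⟨-, rfl⟩ | ⟨i, h', rfl, hn⟩⟩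
      · obtain ⟨h, hh⟩ : ∃ h, h ∈ (c 0).leafHists := by
          obtain ⟨p, hp⟩ := Finset.card_pos.mp (one_le_size (c 0))
          exact ⟨_, mem_leafHists_iff.mpr ⟨p, hp, rfl⟩⟩
        exact ⟨_, ⟨0, h, hh, rfl⟩, (I, _), List.mem_cons_self, rfl⟩
      · obtain ⟨h, hh, l, hl, rfl⟩ := (ih i).mp ⟨h', hn⟩
        exact ⟨_, ⟨i, h, hh, rfl⟩, l, List.mem_cons_of_mem _ hl, rfl⟩
    · rintro ⟨_, ⟨i, h, hh, rfl⟩, l, hl, rfl⟩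
      rcases List.mem_cons.mp hl with rfl | hl
      · exact ⟨[], .inl ⟨rfl, rfl⟩⟩
      · obtain ⟨h', hn⟩ := (ih i).mpr ⟨h, hh, l, hl, rfl⟩
        exact ⟨_, .inr ⟨i, h', rfl, hn⟩⟩

theorem nam_chance {n : ℕ} {c : Fin (n + 1) → GameTree} :
    (chance n c).NAM ↔ ∀ i, (c i).NAM := by
  constructor
  · rintro H i p q I hq ⟨m, d, hp⟩ ⟨m', d', hpq⟩
    exact H ((i : ℕ) :: p) q I hq ⟨m, d, by simpa using hp⟩
      ⟨m', d', by simpa using hpq⟩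
  · rintro H p q I hq ⟨m, d, hp⟩ ⟨m', d', hpq⟩
    cases p with
    | nil => simp [subtree?] at hp
    | cons i p =>
      by_cases hi : i < n + 1
      · simp only [List.cons_append, subtree?, hi, dif_pos] at hp hpq
        exact H _ p q I hq ⟨m, d, hp⟩ ⟨m', d', hpq⟩
      · simp [subtree?, hi] at hp

theorem nam_player {J n : ℕ} {c : Fin (n + 1) → GameTree} :
    (player J n c).NAM ↔ ∀ i, (c i).NAM ∧ ∀ h, ¬ (c i).HasNode h J := by
  constructor
  · intro H i
    refine ⟨?_, ?_⟩
    · rintro p q I hq ⟨m, d, hp⟩ ⟨m', d', hpq⟩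
      exact H ((i : ℕ) :: p) q I hq ⟨m, d, by simpa using hp⟩
        ⟨m', d', by simpa using hpq⟩
    · rintro h ⟨p, ⟨m, d, hp⟩, -⟩
      exact H [] ((i : ℕ) :: p) J (by simp) ⟨n, c, rfl⟩ ⟨m, d, by simpa using hp⟩
  · rintro H p q I hq ⟨m, d, hp⟩ ⟨m', d', hpq⟩
    cases p with
    | nil =>
      simp only [subtree?, Option.some.injEq, player.injEq] at hp
      obtain ⟨rfl, -, -⟩ := hp
      cases q with
      | nil => exact hq rfl
      | cons i q =>
        by_cases hi : i < n + 1
        · simp only [List.nil_append, subtree?, hi, dif_pos] at hpq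
          exact (H ⟨i, hi⟩).2 _ ⟨q, ⟨m', d', hpq⟩, rfl⟩
        · simp [subtree?, hi] at hpq
    | cons i p =>
      by_cases hi : i < n + 1
      · simp only [List.cons_append, subtree?, hi, dif_pos] at hp hpq
        exact (H ⟨i, hi⟩).1 p q I hq ⟨m, d, hp⟩ ⟨m', d', hpq⟩
      · simp [subtree?, hi] at hp

/-- Two nodes of `I` on one path yield a leaf whose history repeats `I`. This is the form that the
verifier tests. -/
theorem nam_iff {T : GameTree} : T.NAM ↔ ∀ h ∈ T.leafHists, (h.map Prod.fst).Nodup := by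
  induction T with
  | leaf =>
    simp only [leafHists, List.mem_singleton, forall_eq, List.map_nil, List.nodup_nil, iff_true]
    rintro p q I hq ⟨m, d, hp⟩
    cases p <;> simp [subtree?] at hp
  | chance n c ih =>
    simp only [nam_chance, ih, mem_leafHists_chance]
    grind
  | player J n c ih =>
    simp only [nam_player, ih, mem_leafHists_player]
    constructor
    · rintro H _ ⟨i, h, hh, rfl⟩
      rw [List.map_cons, List.nodup_cons]
      refine ⟨fun hm => ?_, (H i).1 h hh⟩
      obtain ⟨l, hl, hJ⟩ := List.mem_map.mp hm
      obtain ⟨h', hn⟩ := exists_hasNode_iff.mpr ⟨h, hh, l, hl, hJ⟩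
      exact (H i).2 h' hn
    · intro H i
      refine ⟨fun h hh => ?_, fun h hn => ?_⟩
      · exact (List.nodup_cons.mp (H _ ⟨i, h, hh, rfl⟩)).2
      · obtain ⟨h', hh, l, hl, hJ⟩ := exists_hasNode_iff.mp ⟨h, hn⟩
        exact (List.nodup_cons.mp (H _ ⟨i, h', hh, rfl⟩)).1 (List.mem_map.mpr ⟨l, hl, hJ⟩)

theorem lt_act_of_mem {act : ℕ → ℕ+} {T : GameTree} (hT : T.Arity act) {h : List GameAction}
    (hh : h ∈ T.leafHists) : ∀ l ∈ h, l.2 < (act l.1 : ℕ) := by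
  induction T generalizing h with
  | leaf =>
    obtain rfl : h = [] := by simpa [leafHists] using hh
    simp
  | chance n c ih =>
    obtain ⟨i, hh⟩ := mem_leafHists_chance.mp hh
    exact ih i (hT i) hh
  | player J n c ih =>
    obtain ⟨i, h', hh', rfl⟩ := mem_leafHists_player.mp hh
    intro l hl
    rcases List.mem_cons.mp hl with rfl | hl
    · have := hT.1
      have := i.2
      dsimp only
      omega
    · exact ih i (hT.2 i) hh' l hl

end GameTree

/-! ### Derivations -/

section

variable {ν : Type} [DecidableEq ν]

/-- The monomials that are compatible with the action `a` at `I`, without their factors at `I`. -/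
def condition (I : ν) (M : List (List (ν × ℕ))) (a : ℕ) : List (List (ν × ℕ)) :=
  (M.filter fun μ => μ.all fun l => !decide (l.1 = I) || decide (l.2 = a)).map fun μ =>
    μ.filter fun l => !decide (l.1 = I)

/-- Some monomial has a factor at `I`. -/
def mentions (M : List (List (ν × ℕ))) (I : ν) : Bool :=
  M.any fun μ => μ.any fun l => decide (l.1 = I)

/-- No monomials of `A` and `B` have factors at the same information set. -/
def separated (A B : List (List (ν × ℕ))) : Bool :=
  A.all fun μ => B.all fun μ' => μ.all fun l => μ'.all fun l' => !decide (l.1 = l'.1)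

/-- One step of splitting a list: the item goes to the first part if its mark is `true`. -/
def splitStep {α : Type} (s : List Bool × List α × List α) (μ : α) : List Bool × List α × List α :=
  (s.1.tail, if s.1.head? = some true then (μ :: s.2.1, s.2.2) else (s.2.1, μ :: s.2.2))

/-- Split a list into the items that are marked `true` and the others. -/
def splitBy {α : Type} (bits : List Bool) (M : List α) : List α × List α :=
  (M.foldl splitStep (bits, [], [])).2

/-- `QueryDerivation act S n m`: with `m` rules, the sets of monomials in `S` are reduced to
`n` trivial sets. -/
inductive QueryDerivation (act : ν → ℕ) : List (List (List (ν × ℕ))) → ℕ → ℕ → Prop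
  | nil : QueryDerivation act [] 0 0
  | leaf {M S n m} : M.all List.isEmpty → QueryDerivation act S n m →
      QueryDerivation act (M :: S) (n + 1) (m + 1)
  | branch {M S n m} (I : ν) : mentions M I →
      QueryDerivation act ((List.range (act I)).reverse.map (condition I M) ++ S) n m →
      QueryDerivation act (M :: S) n (m + 1)
  | split {M S n m} (bits : List Bool) : separated (splitBy bits M).1 (splitBy bits M).2 →
      QueryDerivation act ((splitBy bits M).1 :: (splitBy bits M).2 :: S) n m →
      QueryDerivation act (M :: S) n (m + 1)

theorem mentions_iff {M : List (List (ν × ℕ))} {I : ν} :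
    mentions M I ↔ ∃ μ ∈ M, ∃ l ∈ μ, l.1 = I := by
  simp [mentions]

theorem separated_iff {A B : List (List (ν × ℕ))} :
    separated A B ↔ ∀ I, mentions A I → ¬ mentions B I := by
  simp only [mentions_iff, separated, List.all_eq_true, Bool.not_eq_true', decide_eq_false_iff_not]
  constructor
  · rintro H I ⟨μ, hμ, l, hl, rfl⟩ ⟨μ', hμ', l', hl', h⟩
    exact H μ hμ μ' hμ' l hl l' hl' h.symm
  · intro H μ hμ μ' hμ' l hl l' hl' h
    exact H l.1 ⟨μ, hμ, l, hl, rfl⟩ ⟨μ', hμ', l', hl', h.symm⟩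

theorem mem_condition {I : ν} {M : List (List (ν × ℕ))} {a : ℕ} {μ : List (ν × ℕ)} :
    μ ∈ condition I M a ↔ ∃ μ₀ ∈ M, (∀ l ∈ μ₀, l.1 = I → l.2 = a) ∧
      μ₀.filter (fun l => !decide (l.1 = I)) = μ := by
  simp only [condition, List.mem_map, List.mem_filter, List.all_eq_true, Bool.or_eq_true,
    Bool.not_eq_true', decide_eq_false_iff_not, decide_eq_true_eq, and_assoc, imp_iff_not_or]

theorem mentions_condition {I K : ν} {M : List (List (ν × ℕ))} {a : ℕ}
    (h : mentions (condition I M a) K) : mentions M K ∧ K ≠ I := by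
  obtain ⟨_, hμ, l, hl, rfl⟩ := mentions_iff.mp h
  obtain ⟨μ, hμ, -, rfl⟩ := mem_condition.mp hμ
  have := List.mem_filter.mp hl
  exact ⟨mentions_iff.mpr ⟨μ, by assumption, l, this.1, rfl⟩, by simpa using this.2⟩

omit [DecidableEq ν] in
theorem mem_foldl_splitStep {α : Type} (bits : List Bool) (M A B : List α) (μ : α) :
    μ ∈ (M.foldl splitStep (bits, A, B)).2.1 ∨ μ ∈ (M.foldl splitStep (bits, A, B)).2.2 ↔
      μ ∈ M ∨ μ ∈ A ∨ μ ∈ B := by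
  induction M generalizing bits A B with
  | nil => simp
  | cons ν M ih =>
    rw [List.foldl_cons, splitStep]
    split_ifs <;> simp only [ih, List.mem_cons] <;> tauto

theorem mem_splitBy {α : Type} (bits : List Bool) (M : List α) (μ : α) :
    μ ∈ (splitBy bits M).1 ∨ μ ∈ (splitBy bits M).2 ↔ μ ∈ M := by
  exact (mem_foldl_splitStep bits M [] [] μ).trans (by simp)

/-- Marks can realise any partition by a predicate. The parts come out reversed because items are
put in front. -/
theorem splitBy_map {α : Type} (p : α → Bool) (M : List α) :
    splitBy (M.map p) M = ((M.filter p).reverse, (M.filter fun μ => !p μ).reverse) := by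
  have key : ∀ (M A B : List α), M.foldl splitStep (M.map p, A, B) =
      ([], (M.filter p).reverse ++ A, (M.filter fun μ => !p μ).reverse ++ B) := by
    intro M
    induction M with
    | nil => simp
    | cons μ M ih =>
      intro A B
      rw [List.foldl_cons, splitStep]
      cases h : p μ <;> simp [h, ih]
  simp [splitBy, key]

end

/-- The rules act on the head of the stack only, so `S'` can wait below `S`. -/
theorem QueryDerivation.append {ν : Type} [DecidableEq ν] {act : ν → ℕ}
    {S S' : List (List (List (ν × ℕ)))} {n n' m m' : ℕ} (h : QueryDerivation act S n m)
    (h' : QueryDerivation act S' n' m') : QueryDerivation act (S ++ S') (n + n') (m + m') := by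
  induction h with
  | nil => simpa using h'
  | leaf hM _ ih =>
    rw [Nat.add_right_comm _ 1 n', Nat.add_right_comm _ 1 m']
    exact .leaf hM ih
  | branch I hI _ ih =>
    rw [Nat.add_right_comm _ 1 m']
    exact .branch I hI (by simpa using ih)
  | split bits hb _ ih =>
    rw [Nat.add_right_comm _ 1 m']
    exact .split bits hb (by simpa using ih)

/-! ### Reduction and the ideal of the strategy constraints -/

section

open MvPolynomial

variable (act : ℕ → ℕ+)

/-- The ideal generated by the strategy constraints. -/
noncomputable def constraintIdeal : Ideal (MvPolynomial GameAction ℝ) :=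
  Ideal.span (Set.range fun I : ℕ => ∑ i ∈ Finset.range (act I : ℕ), X (I, i) - 1)

variable {act}

/-- Subtracting a multiple `a * (∑ x - 1)` of a generator is one substitution, with `a` as the
cofactor and the rest of `f` adjusted. Allowing every multiplier and every starting polynomial lets
the induction over the ideal chain such steps. -/
theorem reducesTo_of_mem {f g : MvPolynomial GameAction ℝ} (h : f - g ∈ constraintIdeal act) :
    ReducesTo act f g := by
  have key : ∀ d ∈ constraintIdeal act, ∀ a f, ReducesTo act f (f - a * d) := by
    intro d hd
    refine Submodule.span_induction ?_ ?_ ?_ ?_ hd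
    · rintro _ ⟨I, rfl⟩ a f
      refine Relation.ReflTransGen.single
        ⟨I, a, f - a * ∑ i ∈ Finset.range (act I : ℕ), X (I, i), ?_, ?_⟩ <;> ring
    · intro a f
      rw [mul_zero, sub_zero]
      exact Relation.ReflTransGen.refl
    · intro x y _ _ hx hy a f
      rw [show f - a * (x + y) = f - a * x - a * y by ring]
      exact (hx a f).trans (hy a _)
    · intro b x _ hx a f
      rw [smul_eq_mul, ← mul_assoc]
      exact hx (a * b) f
  have := key _ h 1 f
  rwa [one_mul, sub_sub_cancel] at this

variable (act) in
/-- The polynomials that are congruent to a linear combination of leaf monomials of `T`. -/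
noncomputable def GameTree.reach (T : GameTree) : Submodule ℝ (MvPolynomial GameAction ℝ) :=
  Submodule.span ℝ {μ | ∃ h ∈ T.leafHists, histMonomial h = μ} ⊔
    (constraintIdeal act).restrictScalars ℝ

theorem exists_reducesTo {T : GameTree} {μ : MvPolynomial GameAction ℝ} (h : μ ∈ T.reach act) :
    ∃ c : MvPolynomial GameAction ℝ → ℝ,
      ReducesTo act (∑ μ' ∈ T.leafMonomials, c μ' • μ') μ := by
  obtain ⟨u, hu, j, hj, rfl⟩ := Submodule.mem_sup.mp h
  have hs : {μ | ∃ h ∈ T.leafHists, histMonomial h = μ} = (T.leafMonomials : Set _) := by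
    ext μ
    simp [GameTree.mem_leafMonomials]
  rw [hs] at hu
  obtain ⟨c, -, hc⟩ := Submodule.mem_span_finset.mp hu
  refine ⟨c, reducesTo_of_mem ?_⟩
  rw [hc, sub_add_cancel_left]
  exact neg_mem hj

theorem GameTree.reach_chance {n : ℕ} {c : Fin (n + 1) → GameTree} (i : Fin (n + 1)) :
    (c i).reach act ≤ (chance n c).reach act := by
  refine sup_le_sup_right (Submodule.span_mono ?_) _
  rintro _ ⟨h, hh, rfl⟩
  exact ⟨h, mem_leafHists_chance.mpr ⟨i, hh⟩, rfl⟩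

theorem GameTree.X_mul_mem_reach {I n : ℕ} {c : Fin (n + 1) → GameTree} (i : Fin (n + 1))
    {f : MvPolynomial GameAction ℝ} (hf : f ∈ (c i).reach act) :
    X (I, (i : ℕ)) * f ∈ (player I n c).reach act := by
  obtain ⟨u, hu, j, hj, rfl⟩ := Submodule.mem_sup.mp hf
  rw [mul_add]
  refine Submodule.add_mem_sup ?_ (Ideal.mul_mem_left _ _ hj)
  refine Submodule.span_induction ?_ ?_ ?_ ?_ hu
  · rintro _ ⟨h, hh, rfl⟩
    exact Submodule.subset_span ⟨(I, (i : ℕ)) :: h, mem_leafHists_player.mpr ⟨i, h, hh, rfl⟩,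
      by simp [histMonomial]⟩
  · simp
  · intro x y _ _ hx hy
    rw [mul_add]
    exact add_mem hx hy
  · intro a x _ hx
    rw [mul_smul_comm]
    exact Submodule.smul_mem _ _ hx

/-- Without repetitions `(I, a)` is the only factor at `I`, so filtering removes exactly one
variable. -/
theorem histMonomial_eq_mul {I a : ℕ} {μ : List GameAction} (hμ : (μ.map Prod.fst).Nodup)
    (h : (I, a) ∈ μ) :
    histMonomial μ = X (I, a) * histMonomial (μ.filter fun l => !decide (l.1 = I)) := by
  induction μ with
  | nil => simp at h
  | cons l μ ih =>
    rw [List.map_cons, List.nodup_cons] at hμ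
    rcases List.mem_cons.mp h with rfl | h
    · have : (μ.filter fun l => !decide (l.1 = I)) = μ := by
        rw [List.filter_eq_self]
        intro l hl
        have : l.1 ≠ I := fun h => hμ.1 (List.mem_map.mpr ⟨l, hl, h⟩)
        simpa using this
      simp [this, histMonomial]
    · have hl : l.1 ≠ I := fun hl => hμ.1 (List.mem_map.mpr ⟨_, h, hl.symm⟩)
      have := ih hμ.2 h
      simp only [histMonomial, hl, decide_false, Bool.not_false, List.filter_cons_of_pos,
        List.map_cons, List.prod_cons] at this ⊢
      rw [this]
      ring

/-- The tree `T` has A-loss recall, uses only information sets of the monomials in `M`, and yields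
all of these monomials. -/
structure Yields (act : ℕ → ℕ+) (M : List (List GameAction)) (T : GameTree) : Prop where
  arity : T.Arity act
  alr : T.ALR
  mentions : ∀ h I, T.HasNode h I → mentions M I
  mem_reach : ∀ μ ∈ M, histMonomial μ ∈ T.reach act

theorem yields_leaf {M : List (List GameAction)} (hM : M.all List.isEmpty) :
    Yields act M .leaf where
  arity := trivial
  alr := GameTree.alr_iff.mpr fun _ _ _ h => (GameTree.not_hasNode_leaf _ _ h).elim
  mentions _ _ h := (GameTree.not_hasNode_leaf _ _ h).elim
  mem_reach μ hμ := by
    obtain rfl : μ = [] := by simpa using List.all_eq_true.mp hM μ hμ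
    exact Submodule.mem_sup_left (Submodule.subset_span ⟨[], by simp [GameTree.leafHists], rfl⟩)

/-- Each subtree uses only the information sets of its own part. Since the parts are separated, no
information set meets both subtrees and A-loss recall is inherited. -/
theorem yields_chance {M A B : List (List GameAction)} (hM : ∀ μ, μ ∈ A ∨ μ ∈ B ↔ μ ∈ M)
    (hs : separated A B) {T U : GameTree} (hT : Yields act A T) (hU : Yields act B U) :
    Yields act M (.chance 1 ![T, U]) := by
  have hmono : ∀ I, (mentions A I = true ∨ mentions B I = true) → mentions M I := by
    simp only [mentions_iff]
    rintro I (⟨μ, h, l⟩ | ⟨μ, h, l⟩)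
    · exact ⟨μ, (hM μ).mp (.inl h), l⟩
    · exact ⟨μ, (hM μ).mp (.inr h), l⟩
  rw [separated_iff] at hs
  have hnode : ∀ {h I}, (GameTree.chance 1 ![T, U]).HasNode h I ↔ T.HasNode h I ∨ U.HasNode h I := by
    intro h I
    rw [GameTree.hasNode_chance, Fin.exists_fin_two]
    rfl
  refine ⟨?_, GameTree.alr_iff.mpr ?_, ?_, ?_⟩
  · intro i
    fin_cases i
    · exact hT.arity
    · exact hU.arity
  · intro I h h' hn hn'
    rcases hnode.mp hn with hn | hn <;> rcases hnode.mp hn' with hn' | hn'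
    · exact GameTree.alr_iff.mp hT.alr I h h' hn hn'
    · exact (hs I (hT.mentions _ _ hn) (hU.mentions _ _ hn')).elim
    · exact (hs I (hT.mentions _ _ hn') (hU.mentions _ _ hn)).elim
    · exact GameTree.alr_iff.mp hU.alr I h h' hn hn'
  · intro h I hn
    rcases hnode.mp hn with hn | hn
    · exact hmono I (.inl (hT.mentions _ _ hn))
    · exact hmono I (.inr (hU.mentions _ _ hn))
  · intro μ hμ
    rcases (hM μ).mpr hμ with h | h
    · exact GameTree.reach_chance (c := ![T, U]) 0 (hT.mem_reach μ h)
    · exact GameTree.reach_chance (c := ![T, U]) 1 (hU.mem_reach μ h)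

/-- Nodes below different actions branch at `I`, and conditioning removes `I` from the subtrees, so
A-loss recall holds. A monomial with a factor at `I` comes from the child of that action; one
without is yielded by every child and is recovered by summing over all of them. -/
theorem yields_player {M : List (List GameAction)} {I n : ℕ} (hn : n + 1 = (act I : ℕ))
    (hI : mentions M I) (hM : ∀ μ ∈ M, (μ.map Prod.fst).Nodup ∧ ∀ l ∈ μ, l.2 < (act l.1 : ℕ))
    {c : Fin (n + 1) → GameTree} (hc : ∀ i : Fin (n + 1), Yields act (condition I M i) (c i)) :
    Yields act M (.player I n c) := by
  refine ⟨⟨hn, fun i => (hc i).arity⟩, GameTree.alr_iff.mpr ?_, ?_, ?_⟩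
  · intro K h h' hh hh'
    rw [GameTree.hasNode_player] at hh hh'
    rcases hh with ⟨rfl, rfl⟩ | ⟨i, h, rfl, hh⟩ <;> rcases hh' with ⟨rfl, h₀⟩ | ⟨j, h', rfl, hh'⟩
    · exact .inl rfl
    · exact ((mentions_condition ((hc j).mentions _ _ hh')).2 rfl).elim
    · exact ((mentions_condition ((hc i).mentions _ _ hh)).2 h₀).elim
    · rw [GameTree.branching_cons]
      by_cases hij : i = j
      · subst hij
        rcases GameTree.alr_iff.mp (hc i).alr K h h' hh hh' with rfl | hb
        · exact .inl rfl
        · exact .inr (.inr ⟨rfl, hb⟩)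
      · exact .inr (.inl ⟨rfl, fun h => hij (Fin.ext h)⟩)
  · intro h K hh
    rcases GameTree.hasNode_player.mp hh with ⟨-, rfl⟩ | ⟨i, h', -, hh⟩
    · exact hI
    · exact (mentions_condition ((hc i).mentions _ _ hh)).1
  · intro μ hμ
    by_cases h : ∃ l ∈ μ, l.1 = I
    · obtain ⟨⟨_, a⟩, hl, rfl⟩ := h
      rw [histMonomial_eq_mul (hM μ hμ).1 hl]
      have ha : a < n + 1 := hn ▸ (hM μ hμ).2 _ hl
      refine GameTree.X_mul_mem_reach ⟨a, ha⟩ ((hc ⟨a, ha⟩).mem_reach _ ?_)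
      refine mem_condition.mpr ⟨μ, hμ, fun l hl' h => ?_, rfl⟩
      have := List.inj_on_of_nodup_map (hM μ hμ).1 hl' hl h
      rw [this]
    · push Not at h
      have hf : (μ.filter fun l => !decide (l.1 = I)) = μ := by
        rw [List.filter_eq_self]
        intro l hl
        simpa using h l hl
      -- Modulo the constraint at `I`, this sum equals the monomial itself.
      have hs : ∑ i : Fin (n + 1), X (I, (i : ℕ)) * histMonomial μ ∈
          (GameTree.player I n c).reach act := by
        refine sum_mem fun i _ => GameTree.X_mul_mem_reach i ((hc i).mem_reach _ ?_)
        exact mem_condition.mpr ⟨μ, hμ, fun l hl h' => (h l hl h').elim, hf⟩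
      have hj : (∑ i : Fin (n + 1), X (I, (i : ℕ)) - 1) * histMonomial μ ∈
          (GameTree.player I n c).reach act := by
        refine Submodule.mem_sup_right (Ideal.mul_mem_right _ _ (Ideal.subset_span ⟨I, ?_⟩))
        dsimp only
        rw [← hn, Finset.sum_range]
      have := sub_mem hs hj
      rwa [sub_mul, one_mul, ← Finset.sum_mul, sub_sub_cancel] at this

/-- Reindexes a list of trees by the actions they belong to, as needed for the children of a player
node. The value `d` matters only outside of `l`. -/
theorem exists_map_of_forall₂ {α β γ : Type} [DecidableEq α] {f : α → β} {R : β → γ → Prop}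
    (d : γ) {l : List α} (hl : l.Nodup) {ts : List γ} (h : List.Forall₂ R (l.map f) ts) :
    ∃ c : α → γ, ts = l.map c ∧ ∀ a ∈ l, R (f a) (c a) := by
  induction l generalizing ts with
  | nil => exact ⟨fun _ => d, by simpa using h, by simp⟩
  | cons a l ih =>
    rw [List.map_cons] at h
    obtain ⟨t, ts, ht, hts, rfl⟩ := List.forall₂_cons_left_iff.mp h
    rw [List.nodup_cons] at hl
    obtain ⟨c, rfl, hc⟩ := ih hl.2 hts
    have hne : ∀ b ∈ l, b ≠ a := fun b hb hab => hl.1 (hab ▸ hb)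
    refine ⟨Function.update c a t, ?_, ?_⟩
    · simp only [List.map_cons, Function.update_self, List.cons.injEq, true_and]
      exact List.map_congr_left fun b hb => by rw [Function.update_of_ne (hne b hb)]
    · intro b hb
      rcases List.mem_cons.mp hb with rfl | hb
      · rwa [Function.update_self]
      · rw [Function.update_of_ne (hne b hb)]
        exact hc b hb

/-- Soundness of derivations: every set on the stack receives a tree, and the number of trivial sets
is the total number of leaves. Both rules preserve the hypothesis on the monomials. -/
theorem QueryDerivation.exists_yields {S : List (List (List GameAction))} {n m : ℕ}
    (h : QueryDerivation (fun I => (act I : ℕ)) S n m)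
    (hS : ∀ M ∈ S, ∀ μ ∈ M, (μ.map Prod.fst).Nodup ∧ ∀ l ∈ μ, l.2 < (act l.1 : ℕ)) :
    ∃ ts, List.Forall₂ (Yields act) S ts ∧ (ts.map GameTree.size).sum = n := by
  induction h with
  | nil => exact ⟨[], .nil, rfl⟩
  | leaf hM _ ih =>
    obtain ⟨ts, hts, hn⟩ := ih fun M hM => hS M (List.mem_cons_of_mem _ hM)
    refine ⟨.leaf :: ts, .cons (yields_leaf hM) hts, ?_⟩
    rw [List.map_cons, List.sum_cons, hn, GameTree.size_leaf, Nat.add_comm]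
  | @branch M S n m I hI _ ih =>
    have hM := hS M List.mem_cons_self
    obtain ⟨ts, hts, rfl⟩ := ih fun M' hM' => by
      rcases List.mem_append.mp hM' with hM' | hM'
      · obtain ⟨a, -, rfl⟩ := List.mem_map.mp hM'
        intro μ hμ
        obtain ⟨μ₀, hμ₀, -, rfl⟩ := mem_condition.mp hμ
        exact ⟨(hM μ₀ hμ₀).1.sublist (List.filter_sublist.map _),
          fun l hl => (hM μ₀ hμ₀).2 l (List.mem_filter.mp hl).1⟩
      · exact hS M' (List.mem_cons_of_mem _ hM')
    have h₁ := List.forall₂_take_append ts _ _ hts.flip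
    have h₂ := List.forall₂_drop_append ts _ _ hts.flip
    obtain ⟨c, hc, hc'⟩ := exists_map_of_forall₂ GameTree.leaf
      (List.nodup_reverse.mpr List.nodup_range) h₁.flip
    -- Player nodes are parametrised by their number of actions minus one.
    obtain ⟨k, hk⟩ : ∃ k, k + 1 = (act I : ℕ) := ⟨(act I : ℕ) - 1, Nat.sub_add_cancel (act I).2⟩
    refine ⟨.player I k (fun i => c i) :: _, .cons (yields_player hk hI hM fun i => ?_) h₂.flip, ?_⟩
    · refine hc' i ?_
      simp only [List.mem_reverse, List.mem_range]
      omega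
    · conv_rhs => rw [← List.take_append_drop
        ((List.range (act I : ℕ)).reverse.map (condition I M)).length ts, hc]
      rw [List.map_cons, List.sum_cons, GameTree.size_player, List.map_append, List.sum_append,
        List.map_map]
      congr 1
      rw [List.map_reverse, List.sum_reverse, ← hk]
      exact (Finset.sum_range fun i => (c i).size).symm
  | @split M S n m bits hb _ ih =>
    have hM := hS M List.mem_cons_self
    obtain ⟨ts, hts, rfl⟩ := ih fun M' hM' => by
      simp only [List.mem_cons] at hM'
      rcases hM' with rfl | rfl | hM'
      · exact fun μ hμ => hM μ ((mem_splitBy bits M μ).mp (.inl hμ))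
      · exact fun μ hμ => hM μ ((mem_splitBy bits M μ).mp (.inr hμ))
      · exact hS M' (List.mem_cons_of_mem _ hM')
    obtain ⟨T, ts₁, hT, hts₁, rfl⟩ := List.forall₂_cons_left_iff.mp hts
    obtain ⟨U, ts₂, hU, hts₂, rfl⟩ := List.forall₂_cons_left_iff.mp hts₁
    refine ⟨_, .cons (yields_chance (mem_splitBy bits M) hb hT hU) hts₂, ?_⟩
    simp only [List.map_cons, List.sum_cons, GameTree.size_chance]
    exact Nat.add_assoc _ _ _

theorem exists_alrSpan {T : GameTree} (hT : T.Arity act) (hN : T.NAM) {n m : ℕ}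
    (h : QueryDerivation (fun I => (act I : ℕ)) [T.leafHists] n m) :
    ∃ T' : GameTree, T'.IsGameStructure act ∧ T'.size = n ∧ IsALRSpan act T' T := by
  obtain ⟨ts, hts, rfl⟩ := h.exists_yields (act := act) (by
    simp only [List.mem_singleton, forall_eq]
    exact fun μ hμ => ⟨GameTree.nam_iff.mp hN μ hμ, GameTree.lt_act_of_mem hT hμ⟩)
  obtain ⟨U, ts', hU, hts', rfl⟩ := List.forall₂_cons_left_iff.mp hts
  obtain rfl := List.forall₂_nil_left_iff.mp hts'
  -- `U` may be a single leaf, whereas a root must not be terminal. A unary chance node on top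
  -- changes neither the size nor the histories.
  refine ⟨.chance 0 fun _ => U, GameTree.isGameStructure_iff.mpr ⟨by simp, fun _ => hU.arity⟩,
    by simp [GameTree.size_chance], ?_, ?_⟩
  · rw [GameTree.alr_iff]
    intro I h h' hh hh'
    obtain ⟨-, hh⟩ := GameTree.hasNode_chance.mp hh
    obtain ⟨-, hh'⟩ := GameTree.hasNode_chance.mp hh'
    exact GameTree.alr_iff.mp hU.alr I h h' hh hh'
  · intro μ hμ
    obtain ⟨h, hh, rfl⟩ := GameTree.mem_leafMonomials.mp hμ
    exact exists_reducesTo (GameTree.reach_chance (c := fun _ => U) 0 (hU.mem_reach h hh))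

end

/-! ### Pure strategies -/

section

open MvPolynomial

/-- Pure strategies: one action for every information set. -/
abbrev PureStrategy (act : ℕ → ℕ+) := (I : ℕ) → Fin (act I)

variable {act : ℕ → ℕ+}

/-- The indicator function of the pure strategies that are compatible with a history. -/
noncomputable def histIndicator (act : ℕ → ℕ+) (h : List GameAction) (σ : PureStrategy act) :
    ℝ :=
  if ∀ l ∈ h, (σ l.1 : ℕ) = l.2 then 1 else 0

theorem histIndicator_nil : histIndicator act [] = 1 := by
  funext σ
  simp [histIndicator]

theorem histIndicator_cons (l : GameAction) (h : List GameAction) (σ : PureStrategy act) :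
    histIndicator act (l :: h) σ =
      (if (σ l.1 : ℕ) = l.2 then 1 else 0) * histIndicator act h σ := by
  unfold histIndicator
  by_cases h₁ : (σ l.1 : ℕ) = l.2 <;>
    simp only [List.forall_mem_cons, h₁, true_and, false_and, if_true, if_false, one_mul, zero_mul]

/-- The evaluation of polynomials at a pure strategy. -/
noncomputable def evalStrategy (σ : PureStrategy act) : MvPolynomial GameAction ℝ →+* ℝ :=
  eval fun l => if (σ l.1 : ℕ) = l.2 then 1 else 0

theorem evalStrategy_histMonomial (σ : PureStrategy act) (h : List GameAction) :
    evalStrategy σ (histMonomial h) = histIndicator act h σ := by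
  induction h with
  | nil => simp [histMonomial, histIndicator]
  | cons l h ih =>
    rw [histIndicator_cons, ← ih]
    simp [histMonomial, evalStrategy]

/-- A pure strategy plays exactly one action of `I`, so the substituted sum takes the value `1`. -/
theorem evalStrategy_of_reducesTo (σ : PureStrategy act) {f g : MvPolynomial GameAction ℝ}
    (h : ReducesTo act f g) : evalStrategy σ f = evalStrategy σ g := by
  induction h with
  | refl => rfl
  | tail _ hs ih =>
    obtain ⟨I, q, r, rfl, rfl⟩ := hs
    rw [ih, map_add, map_add, map_mul, map_sum]
    have : ∑ i ∈ Finset.range (act I : ℕ), evalStrategy σ (X (I, i)) = 1 := by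
      simp [evalStrategy, (σ I).2]
    rw [this, mul_one]

/-- The span of the indicator functions of the leaves of some trees. -/
noncomputable def indicatorSpan (act : ℕ → ℕ+) (F : Multiset GameTree) :
    Submodule ℝ (PureStrategy act → ℝ) :=
  Submodule.span ℝ {f | ∃ T ∈ F, ∃ h ∈ T.leafHists, histIndicator act h = f}

/-- Evaluation at all pure strategies erases the reductions and turns spanning into a purely linear
condition on functions. -/
theorem histIndicator_mem_of_isALRSpan {T T' : GameTree} (h : IsALRSpan act T' T)
    {μ : List GameAction} (hμ : μ ∈ T.leafHists) : histIndicator act μ ∈ indicatorSpan act {T'} := by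
  obtain ⟨c, hc⟩ := h.2 _ (GameTree.mem_leafMonomials.mpr ⟨μ, hμ, rfl⟩)
  have : histIndicator act μ = ∑ μ' ∈ T'.leafMonomials, c μ' • fun σ => evalStrategy σ μ' := by
    funext σ
    have := evalStrategy_of_reducesTo σ hc
    rw [evalStrategy_histMonomial, map_sum] at this
    rw [← this, Finset.sum_apply]
    refine Finset.sum_congr rfl fun ν _ => ?_
    simp [evalStrategy, smul_eval]
  rw [this]
  refine sum_mem fun ν hν => Submodule.smul_mem _ _ (Submodule.subset_span ?_)
  obtain ⟨h, hh, rfl⟩ := GameTree.mem_leafMonomials.mp hν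
  exact ⟨T', by simp, h, hh, funext fun σ => (evalStrategy_histMonomial σ h).symm⟩

/-- One tree suffices: at a chance node any child will do, and at a player node `1` is the sum over
all actions. The arity condition ensures that every chosen action has a child. -/
theorem one_mem_indicatorSpan {F : Multiset GameTree} (hF : F ≠ 0) (hA : ∀ T ∈ F, T.Arity act) :
    1 ∈ indicatorSpan act F := by
  obtain ⟨T, hT⟩ := Multiset.exists_mem_of_ne_zero hF
  have key : ∀ T : GameTree, T.Arity act →
      1 ∈ Submodule.span ℝ {f | ∃ h ∈ T.leafHists, histIndicator act h = f} := by
    intro T hA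
    induction T with
    | leaf => exact Submodule.subset_span ⟨[], by simp [GameTree.leafHists], histIndicator_nil⟩
    | chance n c ih =>
      refine Submodule.span_mono ?_ (ih 0 (hA 0))
      rintro _ ⟨h, hh, rfl⟩
      exact ⟨h, GameTree.mem_leafHists_chance.mpr ⟨0, hh⟩, rfl⟩
    | player I n c ih =>
      have h₁ : (1 : PureStrategy act → ℝ) =
          ∑ i : Fin (n + 1), (fun σ => if (σ I : ℕ) = i then (1 : ℝ) else 0) * 1 := by
        funext σ
        have hlt : (σ I : ℕ) < n + 1 := (σ I).2.trans_eq hA.1.symm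
        simp only [mul_one, Finset.sum_apply, Pi.one_apply]
        rw [Finset.sum_eq_single (⟨σ I, hlt⟩ : Fin (n + 1))]
        · simp
        · intro j _ hj
          rw [if_neg]
          intro h
          exact hj (Fin.ext h.symm)
        · simp
      rw [h₁]
      refine sum_mem fun i _ => ?_
      refine Submodule.span_induction ?_ ?_ ?_ ?_ (ih i (hA.2 i))
      · rintro _ ⟨h, hh, rfl⟩
        refine Submodule.subset_span ⟨(I, (i : ℕ)) :: h,
          GameTree.mem_leafHists_player.mpr ⟨i, h, hh, rfl⟩, ?_⟩
        funext σ
        rw [histIndicator_cons]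
        rfl
      · simp
      · intro x y _ _ hx hy
        rw [mul_add]
        exact add_mem hx hy
      · intro a x _ hx
        rw [mul_smul_comm]
        exact Submodule.smul_mem _ _ hx
  refine Submodule.span_mono ?_ (key T (hA T hT))
  rintro _ ⟨h, hh, rfl⟩
  exact ⟨T, hT, h, hh, rfl⟩

/-- Functions in the span depend only on the information sets occurring in the forest, because the
spanning indicators do. -/
theorem eq_of_mem_indicatorSpan {F : Multiset GameTree} {f : PureStrategy act → ℝ}
    (hf : f ∈ indicatorSpan act F) {σ τ : PureStrategy act}
    (h : ∀ I, (∃ T ∈ F, ∃ h, T.HasNode h I) → σ I = τ I) : f σ = f τ := by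
  refine Submodule.span_induction ?_ ?_ ?_ ?_ hf
  · rintro _ ⟨T, hT, μ, hμ, rfl⟩
    have : ∀ l ∈ μ, σ l.1 = τ l.1 := fun l hl =>
      h l.1 ⟨T, hT, GameTree.exists_hasNode_iff.mpr ⟨μ, hμ, l, hl, rfl⟩⟩
    unfold histIndicator
    congr 1
    rw [eq_iff_iff]
    exact forall₂_congr fun l hl => by rw [this l hl]
  · rfl
  · intro x y _ _ hx hy
    simp only [Pi.add_apply, hx, hy]
  · intro a x _ hx
    simp only [Pi.smul_apply, hx]

/-- Histories without repeated information sets, all of whose actions exist. -/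
def Consistent (act : ℕ → ℕ+) (μ : List GameAction) : Prop :=
  (μ.map Prod.fst).Nodup ∧ ∀ l ∈ μ, l.2 < (act l.1 : ℕ)

theorem Consistent.sublist {μ ν : List GameAction} (h : Consistent act μ) (hs : ν.Sublist μ) :
    Consistent act ν :=
  ⟨h.1.sublist (hs.map _), fun l hl => h.2 l (hs.subset hl)⟩

theorem Consistent.exists_histIndicator_eq_one {μ : List GameAction} (h : Consistent act μ) :
    ∃ σ, histIndicator act μ σ = 1 := by
  classical
  -- Play the actions of `μ`, and action `0` at the information sets it does not mention.
  refine ⟨fun I => if hI : ∃ a, (I, a) ∈ μ then ⟨hI.choose, h.2 _ hI.choose_spec⟩ else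
    ⟨0, (act I).2⟩, if_pos ?_⟩
  rintro ⟨I, a⟩ hl
  have hI : ∃ a, (I, a) ∈ μ := ⟨a, hl⟩
  simp only [dif_pos hI]
  have := List.inj_on_of_nodup_map h.1 hI.choose_spec hl rfl
  exact congrArg Prod.snd this

theorem exists_ne_of_two_le {I : ℕ} (hI : 2 ≤ (act I : ℕ)) (i : Fin (act I)) : ∃ j, j ≠ i := by
  have : Nontrivial (Fin (act I)) := Fin.nontrivial_iff_two_le.mpr hI
  exact exists_ne i

theorem histIndicator_eq_zero {μ : List GameAction} {l : GameAction} (hl : l ∈ μ)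
    {σ τ : PureStrategy act} (h : histIndicator act μ σ = 1) (hτ : τ l.1 ≠ σ l.1) :
    histIndicator act μ τ = 0 := by
  unfold histIndicator at *
  rw [if_neg]
  intro h'
  have h₁ : ∀ l ∈ μ, (σ l.1 : ℕ) = l.2 := by
    by_contra h₂
    rw [if_neg h₂] at h
    exact zero_ne_one h
  exact hτ (Fin.ext ((h' l hl).trans (h₁ l hl).symm))

/-- A monomial that is a sum of two functions of disjoint sets of coordinates depends on only one
of these sets. -/
theorem forall_mem_or_forall_notMem {μ : List GameAction} (hμ : Consistent act μ)
    (h2 : ∀ l ∈ μ, 2 ≤ (act l.1 : ℕ)) {P : Set ℕ} {g h : PureStrategy act → ℝ}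
    (hf : histIndicator act μ = g + h) (hg : ∀ σ τ, (∀ I ∈ P, σ I = τ I) → g σ = g τ)
    (hh : ∀ σ τ, (∀ I ∉ P, σ I = τ I) → h σ = h τ) :
    (∀ l ∈ μ, l.1 ∈ P) ∨ ∀ l ∈ μ, l.1 ∉ P := by
  by_contra! hc
  obtain ⟨⟨l₁, hl₁, hP₁⟩, l₂, hl₂, hP₂⟩ := hc
  obtain ⟨σ, hσ⟩ := hμ.exists_histIndicator_eq_one
  obtain ⟨b₁, hb₁⟩ := exists_ne_of_two_le (h2 l₁ hl₁) (σ l₁.1)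
  obtain ⟨b₂, hb₂⟩ := exists_ne_of_two_le (h2 l₂ hl₂) (σ l₂.1)
  have hne : l₁.1 ≠ l₂.1 := fun h => hP₁ (h ▸ hP₂)
  -- Changing `σ` at `l₁`, at `l₂` and at both gives a mixed difference `f σ - f σ₁ - f σ₂ + f σ₁₂`.
  -- It vanishes for `g + h`, but equals `1` for the indicator.
  have e₁ := histIndicator_eq_zero hl₁ hσ (τ := Function.update σ l₁.1 b₁) (by simpa using hb₁)
  have e₂ := histIndicator_eq_zero hl₂ hσ (τ := Function.update σ l₂.1 b₂) (by simpa using hb₂)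
  have e₃ := histIndicator_eq_zero hl₁ hσ (τ := Function.update (Function.update σ l₂.1 b₂) l₁.1 b₁)
    (by simpa using hb₁)
  have g₁ := hg (Function.update σ l₁.1 b₁) σ fun I hI =>
    Function.update_of_ne (by rintro rfl; exact hP₁ hI) _ _
  have g₂ := hg (Function.update (Function.update σ l₂.1 b₂) l₁.1 b₁) (Function.update σ l₂.1 b₂)
    fun I hI => Function.update_of_ne (by rintro rfl; exact hP₁ hI) _ _
  have h₁ := hh (Function.update σ l₂.1 b₂) σ fun I hI =>
    Function.update_of_ne (by rintro rfl; exact hI hP₂) _ _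
  have h₂ := hh (Function.update (Function.update σ l₂.1 b₂) l₁.1 b₁) (Function.update σ l₁.1 b₁)
    fun I hI => by
      rw [Function.update_comm hne.symm]
      exact Function.update_of_ne (by rintro rfl; exact hI hP₂) _ _
  simp only [hf, Pi.add_apply] at hσ e₁ e₂ e₃
  linarith

/-- With a second action available at each factor, deviating there kills the indicator; this fails
for single-action information sets. -/
theorem eq_nil_of_histIndicator_const {μ : List GameAction} (hμ : Consistent act μ)
    (h2 : ∀ l ∈ μ, 2 ≤ (act l.1 : ℕ)) (h : ∀ σ τ, histIndicator act μ σ = histIndicator act μ τ) :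
    μ = [] := by
  by_contra hne
  obtain ⟨l, hl⟩ := List.exists_mem_of_ne_nil μ hne
  obtain ⟨σ, hσ⟩ := hμ.exists_histIndicator_eq_one
  obtain ⟨b, hb⟩ := exists_ne_of_two_le (h2 l hl) (σ l.1)
  have := histIndicator_eq_zero hl hσ (τ := Function.update σ l.1 b) (by simpa using hb)
  rw [h _ σ, hσ] at this
  exact one_ne_zero this

/-- The semantic content of `condition`: fixing the choice at `I` deletes the factors at `I` of a
compatible monomial. -/
theorem histIndicator_update {μ : List GameAction} {I a : ℕ} (ha : a < (act I : ℕ))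
    (h : ∀ l ∈ μ, l.1 = I → l.2 = a) (σ : PureStrategy act) :
    histIndicator act μ (Function.update σ I ⟨a, ha⟩) =
      histIndicator act (μ.filter fun l => !decide (l.1 = I)) σ := by
  unfold histIndicator
  congr 1
  rw [eq_iff_iff]
  simp only [List.mem_filter, Bool.not_eq_true', decide_eq_false_iff_not, and_imp]
  refine forall₂_congr fun l hl => ?_
  by_cases hI : l.1 = I
  · obtain ⟨K, b⟩ := l
    dsimp only at hI
    subst hI
    have := h _ hl rfl
    simp [← this]
  · rw [Function.update_of_ne hI]
    simp [hI]

end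

section

/-! ### Existence of derivations -/

/-- The total degree of the monomials. -/
def literals {ν : Type} (M : List (List (ν × ℕ))) : ℕ := (M.map List.length).sum

section

variable {ν : Type}

theorem literals_filter_add {M : List (List (ν × ℕ))} (p : List (ν × ℕ) → Bool) :
    literals (M.filter p) + literals (M.filter fun μ => !p μ) = literals M := by
  induction M with
  | nil => rfl
  | cons μ M ih => cases h : p μ <;> simp_all [literals] <;> omega

theorem literals_reverse (M : List (List (ν × ℕ))) : literals M.reverse = literals M := by
  simp [literals, List.sum_reverse]

theorem literals_pos {M : List (List (ν × ℕ))} {μ : List (ν × ℕ)} (h : μ ∈ M) (hμ : μ ≠ []) :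
    1 ≤ literals M := by
  have := List.single_le_sum (l := M.map List.length) (fun _ _ => Nat.zero_le _) μ.length
    (List.mem_map.mpr ⟨μ, h, rfl⟩)
  have h' := List.length_pos_iff.mpr hμ
  unfold literals
  omega

theorem literals_map_filter_le (M : List (List (ν × ℕ))) (p : List (ν × ℕ) → Bool)
    (q : ν × ℕ → Bool) : literals ((M.filter p).map fun μ => μ.filter q) ≤ literals M := by
  induction M with
  | nil => rfl
  | cons μ M ih =>
    have := List.length_filter_le q μ
    cases h : p μ <;> simp_all [literals] <;> omega

variable [DecidableEq ν]

/-- A monomial with a factor at `I` is either discarded or loses that factor, so queries strictly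
lower the total degree. -/
theorem literals_condition_lt {M : List (List (ν × ℕ))} {I : ν} (h : mentions M I) (a : ℕ) :
    literals (condition I M a) + 1 ≤ literals M := by
  obtain ⟨μ, hμ, l, hl, hI⟩ := mentions_iff.mp h
  clear h
  induction M with
  | nil => simp at hμ
  | cons μ' M ih =>
    have h₁ := List.length_filter_le (fun l => !decide (l.1 = I)) μ'
    have h₂ := literals_map_filter_le M
      (fun μ => μ.all fun l => !decide (l.1 = I) || decide (l.2 = a)) fun l => !decide (l.1 = I)
    rcases List.mem_cons.mp hμ with rfl | hμ
    · have h₃ : (μ.filter fun l => !decide (l.1 = I)).length < μ.length :=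
        List.length_filter_lt_length_iff_exists.mpr ⟨l, hl, by simpa using hI⟩
      unfold condition
      cases h : (μ.all fun l => !decide (l.1 = I) || decide (l.2 = a)) <;>
        simp only [List.filter_cons, h, literals, List.map_cons, List.sum_cons, Bool.false_eq_true,
          if_false, if_true] at h₂ ⊢ <;> omega
    · have h₃ := ih hμ
      unfold condition at *
      cases h : (μ'.all fun l => !decide (l.1 = I) || decide (l.2 = a)) <;>
        simp only [List.filter_cons, h, literals, List.map_cons, List.sum_cons, Bool.false_eq_true,
          if_false, if_true] at h₃ ⊢ <;> omega

/-- There is a short derivation for `M` that leaves at most `s` trivial sets. -/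
def Derivable (act : ν → ℕ) (s : ℕ) (M : List (List (ν × ℕ))) : Prop :=
  ∃ n m, 1 ≤ n ∧ n ≤ s ∧ m ≤ n * (2 * literals M + 1) ∧ QueryDerivation act [M] n m

variable {act : ν → ℕ} {M : List (List (ν × ℕ))} {s t : ℕ}

theorem Derivable.mono (h : Derivable act s M) (hst : s ≤ t) : Derivable act t M := by
  obtain ⟨n, m, h₁, h₂, h₃⟩ := h
  exact ⟨n, m, h₁, h₂.trans hst, h₃⟩

theorem derivable_of_trivial (hM : ∀ μ ∈ M, μ = []) (hs : 1 ≤ s) : Derivable act s M :=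
  ⟨1, 1, le_rfl, hs, by omega, .leaf (by simpa using hM) .nil⟩

theorem QueryDerivation.map_range {k : ℕ} {f : ℕ → List (List (ν × ℕ))} {n m : ℕ → ℕ}
    (h : ∀ a < k, QueryDerivation act [f a] (n a) (m a)) :
    QueryDerivation act ((List.range k).reverse.map f) (∑ a ∈ Finset.range k, n a)
      (∑ a ∈ Finset.range k, m a) := by
  induction k with
  | zero => exact .nil
  | succ k ih =>
    have := (h k (by omega)).append (ih fun a ha => h a (by omega))
    rw [Finset.sum_range_succ, Finset.sum_range_succ, List.range_succ, List.reverse_append,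
      Nat.add_comm _ (n k), Nat.add_comm _ (m k)]
    simpa using this

/-- Leaf counts add up over the actions. As the degree drops in every branch and at least one leaf
is left, the bound on rules gains enough room for the query itself. -/
theorem derivable_branch {I : ν} (hI : mentions M I) (ha : 0 < act I) {s : ℕ → ℕ}
    (h : ∀ a < act I, Derivable act (s a) (condition I M a))
    (hs : ∑ a ∈ Finset.range (act I), s a ≤ t) : Derivable act t M := by
  unfold Derivable at h
  choose! n m h₁ h₂ h₃ h₄ using h
  refine ⟨∑ a ∈ Finset.range (act I), n a, ∑ a ∈ Finset.range (act I), m a + 1, ?_, ?_, ?_,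
    .branch I hI (by simpa using QueryDerivation.map_range h₄)⟩
  · exact (h₁ 0 ha).trans (Finset.single_le_sum (f := n) (fun _ _ => Nat.zero_le _)
      (Finset.mem_range.mpr ha))
  · exact (Finset.sum_le_sum fun a ha => h₂ a (Finset.mem_range.mp ha)).trans hs
  · obtain ⟨L, hL⟩ : ∃ L, literals M = L + 1 :=
      ⟨literals M - 1, by have := literals_condition_lt hI 0; omega⟩
    have h₅ : ∑ a ∈ Finset.range (act I), m a ≤
        (∑ a ∈ Finset.range (act I), n a) * (2 * L + 1) := by
      rw [Finset.sum_mul]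
      refine Finset.sum_le_sum fun a ha => (h₃ a (Finset.mem_range.mp ha)).trans ?_
      have := literals_condition_lt hI a
      gcongr
      omega
    have h₆ : 1 ≤ ∑ a ∈ Finset.range (act I), n a :=
      (h₁ 0 ha).trans (Finset.single_le_sum (f := n) (fun _ _ => Nat.zero_le _)
        (Finset.mem_range.mpr ha))
    rw [hL]
    nlinarith

/-- Both parts contain a non-empty monomial, so both degrees are positive. The cross terms of `(n +
n') * (2 * (L + L') + 1)` then pay for the rule. -/
theorem derivable_split (p : List (ν × ℕ) → Bool)
    (hp : separated (M.filter p).reverse (M.filter fun μ => !p μ).reverse)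
    (h₁ : Derivable act s (M.filter p).reverse)
    (h₂ : Derivable act t (M.filter fun μ => !p μ).reverse)
    (hA : ∃ μ ∈ M, μ ≠ [] ∧ p μ) (hB : ∃ μ ∈ M, μ ≠ [] ∧ !p μ) :
    Derivable act (s + t) M := by
  obtain ⟨n, m, hn, hns, hm, hd⟩ := h₁
  obtain ⟨n', m', hn', hns', hm', hd'⟩ := h₂
  obtain ⟨μ, hμ, hμ₁, hμ₂⟩ := hA
  obtain ⟨μ', hμ', hμ₁', hμ₂'⟩ := hB
  have hA := literals_pos (List.mem_filter.mpr ⟨hμ, hμ₂⟩) hμ₁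
  have hB := literals_pos (List.mem_filter (p := fun μ => !p μ).mpr ⟨hμ', hμ₂'⟩) hμ₁'
  have hsum := literals_filter_add (M := M) p
  rw [literals_reverse] at hm hm'
  refine ⟨n + n', m + m' + 1, by omega, by omega, ?_, .split (M.map p) ?_ ?_⟩
  · generalize literals (M.filter p) = L at *
    generalize literals (M.filter fun μ => !p μ) = L' at *
    rw [← hsum]
    nlinarith
  · rw [splitBy_map]
    exact hp
  · rw [splitBy_map]
    exact hd.append hd'

end

/-! ### Forests that span sets of monomials -/

namespace GameTree

/-- The number of nodes. -/
def nodeCount : GameTree → ℕ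
  | leaf => 1
  | chance _ c => ∑ i, (c i).nodeCount + 1
  | player _ _ c => ∑ i, (c i).nodeCount + 1

/-- The information set of the root. -/
def rootSet : GameTree → Option ℕ
  | player I _ _ => some I
  | _ => none

/-- The subtree below the `a`-th action at the root. -/
def child (a : ℕ) : GameTree → GameTree
  | player _ n c => if h : a < n + 1 then c ⟨a, h⟩ else leaf
  | _ => leaf

end GameTree

open GameTree

/-- The trees in `F` have A-loss recall in common, and the linear combinations of their leaf
monomials yield the monomials in `M`. -/
structure SpannedBy (act : ℕ → ℕ+) (F : Multiset GameTree) (M : List (List GameAction)) : Prop where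
  ne_zero : F ≠ 0
  arity : ∀ T ∈ F, T.Arity act
  alr : ∀ T ∈ F, ∀ T' ∈ F, ∀ I h h', T.HasNode h I → T'.HasNode h' I → h = h' ∨ Branching h h'
  consistent : ∀ μ ∈ M, Consistent act μ
  mem_span : ∀ μ ∈ M, histIndicator act μ ∈ indicatorSpan act F

namespace SpannedBy

variable {act : ℕ → ℕ+} {F : Multiset GameTree} {M : List (List GameAction)}

theorem of_subset {G : Multiset GameTree} {N : List (List GameAction)} (h : SpannedBy act F M)
    (hG : G ⊆ F) (h0 : G ≠ 0) (hN : ∀ μ ∈ N, Consistent act μ)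
    (hm : ∀ μ ∈ N, histIndicator act μ ∈ indicatorSpan act G) : SpannedBy act G N :=
  ⟨h0, fun T hT => h.arity T (hG hT), fun T hT T' hT' => h.alr T (hG hT) T' (hG hT'), hN, hm⟩

/-- Information sets with a single action can be dropped. -/
theorem condition_of_act_eq_one (h : SpannedBy act F M) {I : ℕ} (hI : (act I : ℕ) = 1) :
    SpannedBy act F (condition I M 0) := by
  refine h.of_subset (Multiset.Subset.refl F) h.ne_zero ?_ ?_
  · intro μ hμ
    obtain ⟨μ, hμ₀, -, rfl⟩ := mem_condition.mp hμ
    exact (h.consistent μ hμ₀).sublist List.filter_sublist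
  · intro μ hμ
    obtain ⟨μ, hμ₀, hc, rfl⟩ := mem_condition.mp hμ
    have : histIndicator act (μ.filter fun l => !decide (l.1 = I)) = histIndicator act μ := by
      funext σ
      rw [← histIndicator_update (by omega : 0 < (act I : ℕ)) hc]
      congr 1
      have : (⟨0, by omega⟩ : Fin (act I)) = σ I := Fin.ext (by have := (σ I).2; dsimp only; omega)
      rw [this, Function.update_eq_self]
    rw [this]
    exact h.mem_span μ hμ₀

/-- A chance node at a root can be removed. -/
theorem of_chance {n : ℕ} {c : Fin (n + 1) → GameTree}
    (h : SpannedBy act (chance n c ::ₘ F) M) :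
    SpannedBy act ((Finset.univ.val.map c) + F) M := by
  have hmem : ∀ T ∈ (Finset.univ.val.map c) + F, ∃ T' ∈ chance n c ::ₘ F,
      (T'.Arity act → T.Arity act) ∧ ∀ h I, T.HasNode h I → T'.HasNode h I := by
    intro T hT
    rcases Multiset.mem_add.mp hT with hT | hT
    · obtain ⟨i, -, rfl⟩ := Multiset.mem_map.mp hT
      exact ⟨_, Multiset.mem_cons_self _ _, fun hA => hA i, fun h I hh =>
        hasNode_chance.mpr ⟨i, hh⟩⟩
    · exact ⟨T, Multiset.mem_cons_of_mem hT, fun h => h, fun _ _ h => h⟩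
  refine ⟨?_, ?_, ?_, h.consistent, fun μ hμ => Submodule.span_mono ?_ (h.mem_span μ hμ)⟩
  · intro h0
    have : c 0 ∈ (Finset.univ.val.map c) + F :=
      Multiset.mem_add.mpr (.inl (Multiset.mem_map.mpr ⟨0, Finset.mem_univ_val _, rfl⟩))
    rw [h0] at this
    exact Multiset.notMem_zero _ this
  · intro T hT
    obtain ⟨T', hT', h₁, -⟩ := hmem T hT
    exact h₁ (h.arity T' hT')
  · intro T hT U hU I μ μ' hμ hμ'
    obtain ⟨T', hT', -, h₁⟩ := hmem T hT
    obtain ⟨U', hU', -, h₂⟩ := hmem U hU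
    exact h.alr T' hT' U' hU' I μ μ' (h₁ _ _ hμ) (h₂ _ _ hμ')
  · rintro _ ⟨T, hT, μ, hμ, rfl⟩
    rcases Multiset.mem_cons.mp hT with rfl | hT
    · obtain ⟨i, hi⟩ := mem_leafHists_chance.mp hμ
      exact ⟨c i, Multiset.mem_add.mpr (.inl (Multiset.mem_map.mpr ⟨i, Finset.mem_univ_val _, rfl⟩)), μ,
        hi, rfl⟩
    · exact ⟨T, Multiset.mem_add.mpr (.inr hT), μ, hμ, rfl⟩

/-- Without chance nodes at the roots, the trees with root `I` and the other trees have no common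
information sets. -/
theorem disjoint_nodes (h : SpannedBy act F M) (hF : ∀ n c, chance n c ∉ F) {I K : ℕ}
    {T T' : GameTree} (hT : T ∈ F) (hT' : T' ∈ F) (hI : T.rootSet = some I)
    (hI' : T'.rootSet ≠ some I) {μ μ' : List GameAction} (hμ : T.HasNode μ K)
    (hμ' : T'.HasNode μ' K) : False := by
  have hr := h.alr T hT T' hT' K μ μ' hμ hμ'
  cases T with
  | leaf => exact not_hasNode_leaf _ _ hμ
  | chance n c => exact hF n c hT
  | player I n c =>
    obtain rfl := Option.some.inj hI
    cases T' with
    | leaf => exact not_hasNode_leaf _ _ hμ'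
    | chance n c => exact hF n c hT'
    | player J m d =>
      have hne : I ≠ J := fun h => hI' (by rw [h]; rfl)
      -- Non-empty histories start at the different sets `I` and `J`, so they neither agree nor
      -- branch; an empty history branches with none.
      rcases hasNode_player.mp hμ with ⟨rfl, rfl⟩ | ⟨i, μ, rfl, -⟩ <;>
        rcases hasNode_player.mp hμ' with ⟨rfl, h₀⟩ | ⟨j, μ', rfl, -⟩
      · exact hne h₀
      · exact hr.elim (fun h => by simp at h) (not_branching_nil_left _)
      · exact hr.elim (fun h => by simp at h) (not_branching_nil_right _)
      · rw [branching_cons] at hr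
        simp [hne] at hr

/-- Restriction to one action at a common root. -/
theorem child (h : SpannedBy act F M) {I a : ℕ} (hF : ∀ T ∈ F, T.rootSet = some I)
    (ha : a < (act I : ℕ)) {N : List (List GameAction)}
    (hN : ∀ μ ∈ N, ∃ μ₀ ∈ M, (∀ l ∈ μ₀, l.1 = I → l.2 = a) ∧
      μ₀.filter (fun l => !decide (l.1 = I)) = μ) :
    SpannedBy act (F.map (GameTree.child a)) N := by
  have hroot : ∀ T ∈ F, ∃ n c, T = player I n c ∧ ∃ h : a < n + 1, T.child a = c ⟨a, h⟩ := by
    intro T hT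
    have h₁ := hF T hT
    have h₂ := h.arity T hT
    cases T with
    | leaf => simp [rootSet] at h₁
    | chance n c => simp [rootSet] at h₁
    | player J n c =>
      obtain rfl := Option.some.inj h₁
      have h₃ : a < n + 1 := ha.trans_eq h₂.1.symm
      exact ⟨n, c, rfl, h₃, by rw [GameTree.child, dif_pos h₃]⟩
  -- The root has the empty history, so A-loss recall forbids a second node of `I` below it.
  have hnam : ∀ n c, player I n c ∈ F → ∀ i μ, ¬ (c i).HasNode μ I := by
    intro n c hc i μ hμ
    have := h.alr _ hc _ hc I [] ((I, (i : ℕ)) :: μ) (hasNode_player.mpr (.inl ⟨rfl, rfl⟩))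
      (hasNode_player.mpr (.inr ⟨i, μ, rfl, hμ⟩))
    exact this.elim (fun h => by simp at h) (not_branching_nil_left _)
  -- Fixing action `a` at `I` is linear; it sends a leaf below `a` to a leaf of the child, and any
  -- other leaf to zero.
  have key : ∀ f ∈ indicatorSpan act F, (fun σ => f (Function.update σ I ⟨a, ha⟩)) ∈
      indicatorSpan act (F.map (GameTree.child a)) := by
    intro f hf
    refine Submodule.span_induction ?_ ?_ ?_ ?_ hf
    · rintro _ ⟨T, hT, μ, hμ, rfl⟩
      obtain ⟨n, c, rfl, hn, hc⟩ := hroot T hT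
      obtain ⟨i, μ, hi, rfl⟩ := mem_leafHists_player.mp hμ
      have hμI : ∀ l ∈ μ, l.1 ≠ I := by
        intro l hl hI
        obtain ⟨ν, hν⟩ := exists_hasNode_iff.mpr ⟨μ, hi, l, hl, hI⟩
        exact hnam n c hT i ν hν
      by_cases hai : (i : ℕ) = a
      · refine Submodule.subset_span ⟨c ⟨a, hn⟩, Multiset.mem_map.mpr ⟨_, hT, hc⟩, μ, ?_, ?_⟩
        · have : (⟨a, hn⟩ : Fin (n + 1)) = i := Fin.ext hai.symm
          rwa [this]
        · funext σ
          rw [histIndicator_cons]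
          simp only [Function.update_self, hai, if_true, one_mul]
          rw [histIndicator_update ha (fun l hl hI => (hμI l hl hI).elim)]
          congr 1
          symm
          rw [List.filter_eq_self]
          intro l hl
          simpa using hμI l hl
      · have : (fun σ : PureStrategy act => histIndicator act ((I, (i : ℕ)) :: μ)
            (Function.update σ I ⟨a, ha⟩)) = 0 := by
          funext σ
          rw [histIndicator_cons]
          simp [Ne.symm hai]
        rw [this]
        exact zero_mem _
    · exact zero_mem _
    · intro x y _ _ hx hy
      exact add_mem hx hy
    · intro b x _ hx
      exact Submodule.smul_mem _ b hx
  refine ⟨by simpa using h.ne_zero, ?_, ?_, ?_, ?_⟩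
  · intro T hT
    obtain ⟨T, hT₀, rfl⟩ := Multiset.mem_map.mp hT
    obtain ⟨n, c, rfl, hn, hc⟩ := hroot T hT₀
    rw [hc]
    exact (h.arity _ hT₀).2 _
  · intro T hT T' hT' K μ μ' hμ hμ'
    obtain ⟨T, hT₀, rfl⟩ := Multiset.mem_map.mp hT
    obtain ⟨n, c, rfl, hn, hc⟩ := hroot T hT₀
    obtain ⟨T', hT₀', rfl⟩ := Multiset.mem_map.mp hT'
    obtain ⟨n', c', rfl, hn', hc'⟩ := hroot T' hT₀'
    rw [hc] at hμ
    rw [hc'] at hμ'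
    have := h.alr _ hT₀ _ hT₀' K ((I, a) :: μ) ((I, a) :: μ')
      (hasNode_player.mpr (.inr ⟨⟨a, hn⟩, μ, rfl, hμ⟩))
      (hasNode_player.mpr (.inr ⟨⟨a, hn'⟩, μ', rfl, hμ'⟩))
    rw [branching_cons] at this
    simpa using this
  · intro μ hμ
    obtain ⟨μ, hμ₀, -, rfl⟩ := hN μ hμ
    exact (h.consistent μ hμ₀).sublist List.filter_sublist
  · intro μ hμ
    obtain ⟨μ, hμ₀, hc, rfl⟩ := hN μ hμ
    have := key _ (h.mem_span μ hμ₀)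
    refine (congrArg (· ∈ _) ?_).mp this
    funext σ
    exact histIndicator_update ha hc σ

end SpannedBy

namespace GameTree

variable {I : ℕ} {T : GameTree} {act : ℕ → ℕ+}

theorem one_le_nodeCount (T : GameTree) : 1 ≤ T.nodeCount := by
  cases T <;> simp [nodeCount]

/-- This also holds for actions out of range: the default child is a leaf, and the root together
with a genuine child has at least two nodes. -/
theorem child_nodeCount_lt (hT : T.rootSet = some I) (a : ℕ) :
    (T.child a).nodeCount < T.nodeCount := by
  cases T with
  | leaf => simp [rootSet] at hT
  | chance n c => simp [rootSet] at hT
  | player J n c =>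
    by_cases h : a < n + 1
    · rw [child, dif_pos h, nodeCount, Nat.lt_succ_iff]
      exact Finset.single_le_sum (f := fun i => (c i).nodeCount) (fun _ _ => Nat.zero_le _)
        (Finset.mem_univ _)
    · rw [child, dif_neg h, nodeCount, nodeCount, Nat.lt_succ_iff]
      exact (one_le_nodeCount (c 0)).trans (Finset.single_le_sum
        (f := fun i => (c i).nodeCount) (fun _ _ => Nat.zero_le _) (Finset.mem_univ _))

theorem sum_size_child (hT : T.rootSet = some I) (hA : T.Arity act) :
    ∑ a ∈ Finset.range (act I), (T.child a).size = T.size := by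
  cases T with
  | leaf => simp [rootSet] at hT
  | chance n c => simp [rootSet] at hT
  | player J n c =>
    obtain rfl := Option.some.inj hT
    rw [size_player, ← hA.1, Finset.sum_range]
    refine Finset.sum_congr rfl fun i _ => ?_
    rw [child, dif_pos i.2]

end GameTree

variable {act : ℕ → ℕ+} {F : Multiset GameTree} {M : List (List GameAction)}

theorem indicatorSpan_add (F G : Multiset GameTree) :
    indicatorSpan act (F + G) = indicatorSpan act F ⊔ indicatorSpan act G := by
  unfold indicatorSpan
  rw [← Submodule.span_union]
  congr 1
  ext f
  simp only [Multiset.mem_add, Set.mem_ofPred_eq, Set.mem_union]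
  constructor
  · rintro ⟨T, hT | hT, h⟩
    exacts [.inl ⟨T, hT, h⟩, .inr ⟨T, hT, h⟩]
  · rintro (⟨T, hT, h⟩ | ⟨T, hT, h⟩)
    exacts [⟨T, .inl hT, h⟩, ⟨T, .inr hT, h⟩]

theorem histIndicator_congr {μ : List GameAction} {σ τ : PureStrategy act}
    (h : ∀ l ∈ μ, σ l.1 = τ l.1) : histIndicator act μ σ = histIndicator act μ τ := by
  unfold histIndicator
  congr 1
  rw [eq_iff_iff]
  exact forall₂_congr fun l hl => by rw [h l hl]

theorem sum_size_pos (hF : F ≠ 0) : 1 ≤ (F.map size).sum := by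
  obtain ⟨T, hT⟩ := Multiset.exists_mem_of_ne_zero hF
  exact (one_le_size T).trans (Multiset.le_sum_of_mem (Multiset.mem_map_of_mem _ hT))

/-- A function which depends both only on the coordinates in `P` and only on those outside of `P` is
constant. -/
theorem eq_of_congr_of_congr_compl {f : PureStrategy act → ℝ} {P : Set ℕ}
    (h₁ : ∀ σ τ, (∀ I ∈ P, σ I = τ I) → f σ = f τ)
    (h₂ : ∀ σ τ, (∀ I ∉ P, σ I = τ I) → f σ = f τ) (σ τ : PureStrategy act) : f σ = f τ := by
  classical
  rw [h₁ σ (fun I => if I ∈ P then σ I else τ I) fun I hI => by simp [hI]]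
  exact h₂ _ _ fun I hI => by simp [hI]

/-- A constant can be absorbed by any non-empty forest; this allows constants to be moved between
the two sides of a decomposition. -/
theorem mem_indicatorSpan_of_const (hF : F ≠ 0) (hA : ∀ T ∈ F, T.Arity act)
    {f : PureStrategy act → ℝ} (h : ∀ σ τ, f σ = f τ) : f ∈ indicatorSpan act F := by
  have : f = f (fun I => ⟨0, (act I).2⟩) • (1 : PureStrategy act → ℝ) := by
    funext σ
    simp only [Pi.smul_apply, Pi.one_apply, smul_eq_mul, mul_one]
    exact h _ _
  rw [this]
  exact Submodule.smul_mem _ _ (one_mem_indicatorSpan hF hA)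

namespace SpannedBy

/-- Every monomial comes either from the trees with root `I` or from the other trees. -/
theorem mem_span_or (h : SpannedBy act F M) (hF : ∀ n c, chance n c ∉ F) {I : ℕ}
    (hI : ∃ T ∈ F, T.rootSet = some I) {μ : List GameAction} (hμ : μ ∈ M)
    (h2 : ∀ l ∈ μ, 2 ≤ (act l.1 : ℕ)) {F₁ F₂ : Multiset GameTree}
    (h₁ : F₁ = F.filter fun T => T.rootSet = some I)
    (h₂ : F₂ = F.filter fun T => T.rootSet ≠ some I) :
    ((∀ l ∈ μ, ∃ T ∈ F₁, ∃ ν, T.HasNode ν l.1) ∧ histIndicator act μ ∈ indicatorSpan act F₁) ∨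
    (F₂ ≠ 0 ∧ (∀ l ∈ μ, ¬ ∃ T ∈ F₁, ∃ ν, T.HasNode ν l.1) ∧
      histIndicator act μ ∈ indicatorSpan act F₂) := by
  obtain ⟨T₀, hT₀, hI₀⟩ := hI
  have hF₁ : F₁ ≠ 0 := by
    rintro rfl
    exact Multiset.notMem_zero T₀ (h₁ ▸ Multiset.mem_filter.mpr ⟨hT₀, hI₀⟩)
  have hA₁ : ∀ T ∈ F₁, T.Arity act := fun T hT => h.arity T (Multiset.mem_filter.mp (h₁ ▸ hT)).1
  have hA₂ : ∀ T ∈ F₂, T.Arity act := fun T hT => h.arity T (Multiset.mem_filter.mp (h₂ ▸ hT)).1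
  have hspan := h.mem_span μ hμ
  have hadd : F = F₁ + F₂ := by rw [h₁, h₂, Multiset.filter_add_not]
  rw [hadd, indicatorSpan_add] at hspan
  obtain ⟨f, hf, g, hg, hfg⟩ := Submodule.mem_sup.mp hspan
  set P : Set ℕ := {K | ∃ T ∈ F₁, ∃ ν, T.HasNode ν K} with hP
  have hfP : ∀ σ τ, (∀ K ∈ P, σ K = τ K) → f σ = f τ := fun σ τ hστ =>
    eq_of_mem_indicatorSpan hf fun K hK => hστ K hK
  have hgP : ∀ σ τ, (∀ K ∉ P, σ K = τ K) → g σ = g τ := fun σ τ hστ =>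
    eq_of_mem_indicatorSpan hg fun K ⟨T', hT', ν', hν'⟩ => hστ K <| by
      rintro ⟨T, hT, ν, hν⟩
      rw [h₁, Multiset.mem_filter] at hT
      rw [h₂, Multiset.mem_filter] at hT'
      exact h.disjoint_nodes hF hT.1 hT'.1 hT.2 hT'.2 hν hν'
  have hc := h.consistent μ hμ
  rcases forall_mem_or_forall_notMem hc h2 hfg.symm hfP hgP with hl | hl
  · refine .inl ⟨hl, ?_⟩
    rw [← hfg]
    -- Here `g` is the indicator minus `f`, so it depends on `P` only; it also depends only on the
    -- complement of `P`, hence is constant.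
    refine add_mem hf (mem_indicatorSpan_of_const hF₁ hA₁ fun σ τ => ?_)
    refine eq_of_congr_of_congr_compl (P := P) (fun σ τ hστ => ?_) hgP σ τ
    have h₃ := congrFun hfg σ
    have h₄ := congrFun hfg τ
    rw [Pi.add_apply] at h₃ h₄
    have h₅ := histIndicator_congr (μ := μ) (fun l h => hστ l.1 (hl l h))
    have h₆ := hfP σ τ hστ
    linarith
  -- Symmetrically, `f` is constant when all factors of `μ` lie outside of `P`.
  · have hfc : ∀ σ τ, f σ = f τ := by
      refine eq_of_congr_of_congr_compl hfP fun σ τ hστ => ?_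
      have h₃ := congrFun hfg σ
      have h₄ := congrFun hfg τ
      rw [Pi.add_apply] at h₃ h₄
      have h₅ := histIndicator_congr (μ := μ) (fun l h => hστ l.1 (hl l h))
      have h₆ := hgP σ τ hστ
      linarith
    -- Without other trees `g` vanishes and the indicator is constant, so the monomial is empty and
    -- belongs to the first side.
    by_cases h0 : F₂ = 0
    · have hg0 : g = 0 := by
        rw [h0] at hg
        simpa [indicatorSpan] using hg
      have hμ0 : μ = [] := eq_nil_of_histIndicator_const hc h2 fun σ τ => by
        rw [← hfg, hg0, add_zero]
        exact hfc σ τ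
      subst hμ0
      refine .inl ⟨by simp, ?_⟩
      rw [histIndicator_nil]
      exact one_mem_indicatorSpan hF₁ hA₁
    · refine .inr ⟨h0, hl, ?_⟩
      rw [← hfg]
      exact add_mem (mem_indicatorSpan_of_const h0 hA₂ hfc) hg

/-- Completeness of derivations, by induction on the number of nodes of the forest plus the degree
of the monomials. Each case removes a chance node, discards or separates trees, or conditions on an
action, and never increases the leaf count. -/
theorem derivable (h : SpannedBy act F M) :
    Derivable (fun I => (act I : ℕ)) (F.map size).sum M := by
  obtain ⟨N, hN⟩ : ∃ N, (F.map nodeCount).sum + literals M = N := ⟨_, rfl⟩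
  induction N using Nat.strong_induction_on generalizing F M with
  | _ N ih =>
  subst hN
  by_cases htriv : ∀ μ ∈ M, μ = []
  · exact derivable_of_trivial htriv (sum_size_pos h.ne_zero)
  -- Single-action sets are queried first: there is one branch, so the forest and the budget stay
  -- the same, and the dependence argument later has two actions everywhere.
  by_cases hone : ∃ I, mentions M I ∧ (act I : ℕ) = 1
  · obtain ⟨I, hI, h1⟩ := hone
    refine derivable_branch hI (by omega) (s := fun _ => (F.map size).sum) (fun a ha => ?_)
      (by rw [h1]; simp)
    obtain rfl : a = 0 := by omega
    have := literals_condition_lt hI 0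
    exact ih _ (by omega) (h.condition_of_act_eq_one h1) rfl
  by_cases hch : ∃ n c, chance n c ∈ F
  · obtain ⟨n, c, hc⟩ := hch
    obtain ⟨G, rfl⟩ := Multiset.exists_cons_of_mem hc
    have h₁ := ih _ ?_ h.of_chance rfl
    · refine h₁.mono (le_of_eq ?_)
      rw [Multiset.map_add, Multiset.sum_add, Multiset.map_map, Multiset.map_cons,
        Multiset.sum_cons, size_chance]
      rfl
    · rw [Multiset.map_add, Multiset.sum_add, Multiset.map_map, Multiset.map_cons,
        Multiset.sum_cons, nodeCount]
      have : (Finset.univ.val.map (nodeCount ∘ c)).sum = ∑ i, (c i).nodeCount := rfl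
      omega
  push Not at htriv hch
  obtain ⟨μ₀, hμ₀, hne⟩ := htriv
  have h2 : ∀ μ ∈ M, ∀ l ∈ μ, 2 ≤ (act l.1 : ℕ) := fun μ hμ l hl => by
    have h₁ : (act l.1 : ℕ) ≠ 1 := fun h1 => hone ⟨l.1, mentions_iff.mpr ⟨μ, hμ, l, hl, rfl⟩, h1⟩
    have h₂ : 0 < (act l.1 : ℕ) := (act l.1).2
    omega
  -- If all trees were leaves, only constants would be spanned, and `μ₀` would be empty.
  obtain ⟨T₀, hT₀, I, hI⟩ : ∃ T ∈ F, ∃ I, T.rootSet = some I := by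
    by_contra! hl
    refine hne (eq_nil_of_histIndicator_const (h.consistent _ hμ₀) (h2 _ hμ₀) fun σ τ =>
      eq_of_mem_indicatorSpan (h.mem_span _ hμ₀) ?_)
    rintro K ⟨T, hT, ν, hν⟩
    cases T with
    | leaf => exact (not_hasNode_leaf _ _ hν).elim
    | chance n c => exact (hch n c hT).elim
    | player J n c => exact (hl _ hT J rfl).elim
  obtain ⟨F₁, h₁⟩ : ∃ G, G = F.filter fun T => T.rootSet = some I := ⟨_, rfl⟩
  obtain ⟨F₂, h₂⟩ : ∃ G, G = F.filter fun T => T.rootSet ≠ some I := ⟨_, rfl⟩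
  have hadd : F = F₁ + F₂ := by rw [h₁, h₂, Multiset.filter_add_not]
  have hT₁ : T₀ ∈ F₁ := h₁ ▸ Multiset.mem_filter.mpr ⟨hT₀, hI⟩
  have hF₁ : F₁ ≠ 0 := fun h0 => Multiset.notMem_zero T₀ (h0 ▸ hT₁)
  have hsub₁ : F₁ ⊆ F := h₁ ▸ Multiset.filter_subset _ _
  have hsub₂ : F₂ ⊆ F := h₂ ▸ Multiset.filter_subset _ _
  have hroot : ∀ T ∈ F₁, T.rootSet = some I := fun T hT => by
    rw [h₁] at hT
    exact (Multiset.mem_filter.mp hT).2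
  have hnodes : (F.map nodeCount).sum = (F₁.map nodeCount).sum + (F₂.map nodeCount).sum := by
    rw [hadd, Multiset.map_add, Multiset.sum_add]
  have hsizes : (F.map size).sum = (F₁.map size).sum + (F₂.map size).sum := by
    rw [hadd, Multiset.map_add, Multiset.sum_add]
  have hpos₁ : 1 ≤ (F₁.map nodeCount).sum :=
    (one_le_nodeCount T₀).trans (Multiset.le_sum_of_mem (Multiset.mem_map_of_mem _ hT₁))
  have key := fun μ hμ => h.mem_span_or hch ⟨T₀, hT₀, hI⟩ hμ (h2 μ hμ) h₁ h₂
  set P : ℕ → Prop := fun K => ∃ T ∈ F₁, ∃ ν, T.HasNode ν K with hP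
  have hnil₁ : histIndicator act [] ∈ indicatorSpan act F₁ := by
    rw [histIndicator_nil]
    exact one_mem_indicatorSpan hF₁ fun T hT => h.arity T (hsub₁ hT)
  have hin : ∀ μ ∈ M, (∀ l ∈ μ, P l.1) → histIndicator act μ ∈ indicatorSpan act F₁ := by
    intro μ hμ hl
    rcases key μ hμ with h₃ | ⟨-, h₃, -⟩
    · exact h₃.2
    · obtain rfl : μ = [] := List.eq_nil_iff_forall_not_mem.mpr fun l hl' => h₃ l hl' (hl l hl')
      exact hnil₁
  by_cases hall : ∀ μ ∈ M, ∀ l ∈ μ, P l.1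
  · have hs := h.of_subset hsub₁ hF₁ h.consistent fun μ hμ => hin μ hμ (hall μ hμ)
    refine Derivable.mono ?_ (hsizes ▸ Nat.le_add_right _ _)
    -- All monomials now come from the trees with root `I`; if `I` occurs in them, it is queried.
    by_cases hm : mentions M I
    · refine derivable_branch hm (act I).2
        (s := fun a => ((F₁.map (GameTree.child a)).map size).sum) (fun a ha => ?_) ?_
      · have hlt := literals_condition_lt hm a
        have hle : ((F₁.map (GameTree.child a)).map nodeCount).sum ≤ (F₁.map nodeCount).sum := by
          rw [Multiset.map_map]
          exact Multiset.sum_map_le_sum_map _ _ fun T hT => (child_nodeCount_lt (hroot T hT) a).le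
        exact ih _ (by omega) (hs.child hroot ha fun μ hμ => mem_condition.mp hμ) rfl
      · refine le_of_eq ?_
        simp only [Multiset.map_map, Finset.sum, Function.comp_apply]
        rw [Multiset.sum_map_sum_map]
        refine congrArg Multiset.sum (Multiset.map_congr rfl fun T hT => ?_)
        exact sum_size_child (hroot T hT) (h.arity T (hsub₁ hT))
    -- If `I` does not occur, conditioning leaves `M` unchanged. No rule is needed: the subtrees
    -- below action `0` already span `M`.
    · have hlt : ((F₁.map (GameTree.child 0)).map nodeCount).sum < (F₁.map nodeCount).sum := by
        rw [Multiset.map_map]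
        exact Multiset.sum_lt_sum_of_nonempty hF₁ fun T hT => child_nodeCount_lt (hroot T hT) 0
      refine Derivable.mono (ih _ (by omega) (hs.child hroot (act I).2 (a := 0) (N := M)
        fun μ hμ => ⟨μ, hμ, fun l hl hI => ?_, ?_⟩) rfl) ?_
      · exact (hm (mentions_iff.mpr ⟨μ, hμ, l, hl, hI⟩)).elim
      · rw [List.filter_eq_self]
        intro l hl
        simpa using fun hI => hm (mentions_iff.mpr ⟨μ, hμ, l, hl, hI⟩)
      · rw [Multiset.map_map]
        refine Multiset.sum_map_le_sum_map _ _ fun T hT => ?_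
        rw [← sum_size_child (hroot T hT) (h.arity T (hsub₁ hT))]
        exact Finset.single_le_sum (f := fun a => (T.child a).size) (fun _ _ => Nat.zero_le _)
          (Finset.mem_range.mpr (act I).2)
  · push Not at hall
    obtain ⟨μ₁, hμ₁, l₁, hl₁, hPl₁⟩ := hall
    have hout : ∀ μ ∈ M, (¬ ∀ l ∈ μ, P l.1) → F₂ ≠ 0 ∧ (∀ l ∈ μ, ¬ P l.1) ∧
        histIndicator act μ ∈ indicatorSpan act F₂ := by
      intro μ hμ hl
      rcases key μ hμ with h₃ | h₃
      · exact (hl h₃.1).elim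
      · exact h₃
    have hex : ¬ ∀ l ∈ μ₁, P l.1 := fun h => hPl₁ (h l₁ hl₁)
    have hF₂ : F₂ ≠ 0 := (hout μ₁ hμ₁ hex).1
    have hpos₂ : 1 ≤ (F₂.map nodeCount).sum := by
      obtain ⟨T, hT⟩ := Multiset.exists_mem_of_ne_zero hF₂
      exact (one_le_nodeCount T).trans (Multiset.le_sum_of_mem (Multiset.mem_map_of_mem _ hT))
    -- Both sides own a non-empty monomial, so the split is non-trivial and the budgets of the two
    -- forests add up.
    by_cases hA : ∃ μ ∈ M, μ ≠ [] ∧ ∀ l ∈ μ, P l.1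
    · classical
      set p : List GameAction → Bool := fun μ => decide (∀ l ∈ μ, P l.1) with hp
      have hle := literals_filter_add (M := M) p
      obtain ⟨μ₂, hμ₂, hne₂, hP₂⟩ := hA
      rw [hsizes]
      refine derivable_split p ?_ ?_ ?_ ⟨μ₂, hμ₂, hne₂, by simpa [hp] using hP₂⟩
        ⟨μ₁, hμ₁, List.ne_nil_of_mem hl₁, by simpa [hp] using hex⟩
      · rw [separated_iff]
        simp only [mentions_iff, List.mem_reverse, List.mem_filter, not_exists, not_and, hp,
          decide_eq_true_eq, Bool.not_eq_true', decide_eq_false_iff_not]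
        rintro K ⟨μ, ⟨-, hμP⟩, l, hl, rfl⟩ ν ⟨hν, hνP⟩ l' hl' hll
        exact (hout ν hν hνP).2.1 l' hl' (hll ▸ hμP l hl)
      · refine ih _ ?_ (h.of_subset hsub₁ hF₁ (fun μ hμ => ?_) fun μ hμ => ?_) rfl
        · rw [literals_reverse]
          omega
        · exact h.consistent μ (List.mem_filter.mp (List.mem_reverse.mp hμ)).1
        · obtain ⟨hμ, hμP⟩ := List.mem_filter.mp (List.mem_reverse.mp hμ)
          exact hin μ hμ (of_decide_eq_true hμP)
      · refine ih _ ?_ (h.of_subset hsub₂ hF₂ (fun μ hμ => ?_) fun μ hμ => ?_) rfl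
        · rw [literals_reverse]
          omega
        · exact h.consistent μ (List.mem_filter.mp (List.mem_reverse.mp hμ)).1
        · obtain ⟨hμ, hμP⟩ := List.mem_filter.mp (List.mem_reverse.mp hμ)
          exact (hout μ hμ (by simpa [hp] using hμP)).2.2
    -- All non-empty monomials belong to the other trees and the empty one is spanned by any forest,
    -- so the trees with root `I` are dropped.
    · push Not at hA
      refine Derivable.mono (ih _ (by omega) (h.of_subset hsub₂ hF₂ h.consistent fun μ hμ => ?_)
        rfl) (hsizes ▸ Nat.le_add_left _ _)
      by_cases hμ0 : μ = []
      · rw [hμ0, histIndicator_nil]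
        exact one_mem_indicatorSpan hF₂ fun T hT => h.arity T (hsub₂ hT)
      · obtain ⟨l, hl, hlP⟩ := hA μ hμ hμ0
        exact (hout μ hμ fun h' => hlP (h' l hl)).2.2

end SpannedBy

theorem derivable_of_isALRSpan {T T' : GameTree} (hT : T.Arity act) (hN : T.NAM)
    (hT' : T'.Arity act) (h : IsALRSpan act T' T) :
    Derivable (fun I => (act I : ℕ)) T'.size T.leafHists := by
  have : SpannedBy act {T'} T.leafHists := by
    refine ⟨by simp, by simpa using hT', ?_, fun μ hμ => ⟨nam_iff.mp hN μ hμ, lt_act_of_mem hT hμ⟩,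
      fun μ hμ => histIndicator_mem_of_isALRSpan h hμ⟩
    simp only [Multiset.mem_singleton]
    rintro _ rfl _ rfl I h₁ h₂
    exact alr_iff.mp h.1 I h₁ h₂
  simpa using this.derivable

end

section

/-! ### Renaming information sets in derivations -/

section

variable {ν ν' : Type} [DecidableEq ν] [DecidableEq ν']

/-- Rename the information sets. -/
def renameSets (φ : ν → ν') (M : List (List (ν × ℕ))) : List (List (ν' × ℕ)) :=
  M.map fun μ => μ.map fun l => (φ l.1, l.2)

variable {φ : ν → ν'} {M A B : List (List (ν × ℕ))} {I : ν}

theorem mentions_renameSets_of (h : mentions M I) : mentions (renameSets φ M) (φ I) := by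
  obtain ⟨μ, hμ, l, hl, rfl⟩ := mentions_iff.mp h
  exact mentions_iff.mpr ⟨_, List.mem_map.mpr ⟨μ, hμ, rfl⟩, _, List.mem_map.mpr ⟨l, hl, rfl⟩, rfl⟩

theorem exists_of_mentions_renameSets {J : ν'} (h : mentions (renameSets φ M) J) :
    ∃ I, mentions M I ∧ φ I = J := by
  obtain ⟨_, hμ, _, hl, rfl⟩ := mentions_iff.mp h
  obtain ⟨μ, hμ₀, rfl⟩ := List.mem_map.mp hμ
  obtain ⟨l, hl₀, rfl⟩ := List.mem_map.mp hl
  exact ⟨l.1, mentions_iff.mpr ⟨μ, hμ₀, l, hl₀, rfl⟩, rfl⟩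

/-- Conditioning only asks whether a factor is at `I`, so it is enough that no other occurring set
is renamed to `φ I`. -/
theorem condition_renameSets (h : ∀ J, mentions M J → (φ J = φ I ↔ J = I)) (a : ℕ) :
    condition (φ I) (renameSets φ M) a = renameSets φ (condition I M a) := by
  have h' : ∀ μ ∈ M, ∀ l ∈ μ, (φ l.1 = φ I ↔ l.1 = I) := fun μ hμ l hl =>
    h l.1 (mentions_iff.mpr ⟨μ, hμ, l, hl, rfl⟩)
  clear h
  induction M with
  | nil => rfl
  | cons μ M ih =>
    have h₁ := ih fun ν hν => h' ν (List.mem_cons_of_mem _ hν)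
    have h₂ := h' μ List.mem_cons_self
    have h₃ : (μ.map fun l => (φ l.1, l.2)).all (fun l => !decide (l.1 = φ I) || decide (l.2 = a)) =
        μ.all fun l => !decide (l.1 = I) || decide (l.2 = a) := by
      rw [Bool.eq_iff_iff]
      simp +contextual [h₂]
    have h₄ : (μ.map fun l => (φ l.1, l.2)).filter (fun l => !decide (l.1 = φ I)) =
        (μ.filter fun l => !decide (l.1 = I)).map fun l => (φ l.1, l.2) := by
      rw [List.filter_map]
      refine congrArg _ (List.filter_congr fun l hl => ?_)
      simp [h₂ l hl]
    unfold condition renameSets at *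
    cases hc : (μ.all fun l => !decide (l.1 = I) || decide (l.2 = a))
    · rw [hc] at h₃
      simpa [List.filter_cons, h₃, hc] using h₁
    · rw [hc] at h₃
      simpa [List.filter_cons, h₃, hc, h₄] using h₁

theorem splitBy_map_map {α β : Type} (f : α → β) (bits : List Bool) (l : List α) :
    splitBy bits (l.map f) = ((splitBy bits l).1.map f, (splitBy bits l).2.map f) := by
  have key : ∀ (l u v : List α) (bits : List Bool),
      (l.map f).foldl splitStep (bits, u.map f, v.map f) =
        ((l.foldl splitStep (bits, u, v)).1, (l.foldl splitStep (bits, u, v)).2.1.map f,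
          (l.foldl splitStep (bits, u, v)).2.2.map f) := by
    intro l
    induction l with
    | nil => intros; rfl
    | cons a l ih =>
      intro u v bits
      rw [List.map_cons, List.foldl_cons, List.foldl_cons, splitStep, splitStep]
      dsimp only
      split_ifs
      · exact ih (a :: u) v _
      · exact ih u (a :: v) _
  exact congrArg Prod.snd (key l [] [] bits)

/-- Superfluous marks are ignored, so a split needs at most one certificate bit per monomial. -/
theorem splitBy_take {α : Type} (bits : List Bool) (l : List α) :
    splitBy (bits.take l.length) l = splitBy bits l := by
  have key : ∀ (l u v : List α) (bits : List Bool),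
      (l.foldl splitStep (bits.take l.length, u, v)).2 = (l.foldl splitStep (bits, u, v)).2 := by
    intro l
    induction l with
    | nil => intros; rfl
    | cons a l ih =>
      intro u v bits
      rw [List.foldl_cons, List.foldl_cons, splitStep, splitStep]
      cases bits with
      | nil => simp
      | cons b bits =>
        simp only [List.length_cons, List.take_succ_cons, List.tail_cons, List.head?_cons]
        split_ifs <;> exact ih _ _ _
  exact key l [] [] bits

theorem mentions_splitBy {bits : List Bool}
    (h : mentions (splitBy bits M).1 I ∨ mentions (splitBy bits M).2 I) : mentions M I := by
  simp only [mentions_iff] at *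
  rcases h with ⟨μ, hμ, h⟩ | ⟨μ, hμ, h⟩
  · exact ⟨μ, (mem_splitBy bits M μ).mp (.inl hμ), h⟩
  · exact ⟨μ, (mem_splitBy bits M μ).mp (.inr hμ), h⟩

/-- Derivations touch only occurring information sets, so injectivity and the right arities are
needed only there. This covers both `binName` and its partial inverse. -/
theorem QueryDerivation.rename {act : ν → ℕ} {act' : ν' → ℕ} {S : List (List (List (ν × ℕ)))}
    {n m : ℕ} (φ : ν → ν')
    (hφ : ∀ M ∈ S, ∀ I, mentions M I → ∀ J, mentions M J → φ J = φ I → J = I)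
    (hact : ∀ M ∈ S, ∀ I, mentions M I → act' (φ I) = act I) (h : QueryDerivation act S n m) :
    QueryDerivation act' (S.map (renameSets φ)) n m := by
  induction h with
  | nil => exact .nil
  | leaf hM _ ih =>
    refine .leaf ?_ (ih (fun M hM => hφ M (List.mem_cons_of_mem _ hM))
      fun M hM => hact M (List.mem_cons_of_mem _ hM))
    simpa [renameSets] using hM
  | @branch M S n m I hI _ ih =>
    refine .branch (φ I) (mentions_renameSets_of hI) ?_
    rw [hact M List.mem_cons_self I hI]
    have h₁ : ∀ N ∈ (List.range (act I)).reverse.map (condition I M) ++ S,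
        N ∈ S ∨ ∃ a, condition I M a = N := by
      intro N hN
      rcases List.mem_append.mp hN with hN | hN
      · obtain ⟨a, -, rfl⟩ := List.mem_map.mp hN
        exact .inr ⟨a, rfl⟩
      · exact .inl hN
    have h₂ := ih ?_ ?_
    · rw [List.map_append, List.map_map] at h₂
      refine Eq.mp ?_ h₂
      congr 2
      refine List.map_congr_left fun a _ => (condition_renameSets (fun J hJ => ?_) a).symm
      exact ⟨hφ M List.mem_cons_self I hI J hJ, fun h => h ▸ rfl⟩
    · intro N hN K hK J hJ hJK
      rcases h₁ N hN with hN | ⟨a, rfl⟩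
      · exact hφ N (List.mem_cons_of_mem _ hN) K hK J hJ hJK
      · exact hφ M List.mem_cons_self K (mentions_condition hK).1 J (mentions_condition hJ).1 hJK
    · intro N hN K hK
      rcases h₁ N hN with hN | ⟨a, rfl⟩
      · exact hact N (List.mem_cons_of_mem _ hN) K hK
      · exact hact M List.mem_cons_self K (mentions_condition hK).1
  | @split M S n m bits hb _ ih =>
    have h₁ : splitBy bits (renameSets φ M) =
        (renameSets φ (splitBy bits M).1, renameSets φ (splitBy bits M).2) :=
      splitBy_map_map _ bits M
    refine .split bits ?_ ?_
    · rw [h₁, separated_iff]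
      intro J hA hB
      obtain ⟨I, hI, rfl⟩ := exists_of_mentions_renameSets hA
      obtain ⟨K, hK, hKI⟩ := exists_of_mentions_renameSets hB
      have := hφ M List.mem_cons_self I (mentions_splitBy (.inl hI)) K
        (mentions_splitBy (.inr hK)) hKI
      exact separated_iff.mp hb I hI (this ▸ hK)
    · rw [h₁]
      refine ih ?_ ?_
      · simp only [List.mem_cons, forall_eq_or_imp] at hφ ⊢
        exact ⟨fun I hI J hJ => hφ.1 I (mentions_splitBy (.inl hI)) J (mentions_splitBy (.inl hJ)),
          fun I hI J hJ => hφ.1 I (mentions_splitBy (.inr hI)) J (mentions_splitBy (.inr hJ)), hφ.2⟩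
      · simp only [List.mem_cons, forall_eq_or_imp] at hact ⊢
        exact ⟨fun I hI => hact.1 I (mentions_splitBy (.inl hI)),
          fun I hI => hact.1 I (mentions_splitBy (.inr hI)), hact.2⟩

end

/-! ### Certificates -/

/-- The alphabet of certificates. -/
inductive Command : Type
  | zero | one | leaf | branch | split
  deriving DecidableEq

instance : Fintype Command where
  elems := {.zero, .one, .leaf, .branch, .split}
  complete c := by cases c <;> simp

/-- Names of information sets: binary numbers, most significant bit first. -/
abbrev Name := List Bool

/-- The states of the checker: a flag, a buffer of bits, a stack of sets of monomials and a
budget of trivial sets. -/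
abbrev CheckState := Bool × List Bool × List (List (List (Name × ℕ))) × ℕ

/-- The checker executes one command. -/
def checkStep (arity : Name → ℕ) (s : CheckState) (c : Command) : CheckState :=
  match c with
  | .zero => (s.1, false :: s.2.1, s.2.2)
  | .one => (s.1, true :: s.2.1, s.2.2)
  | .leaf => match s.2.2.1 with
    | [] => (false, [], [], 0)
    | M :: S => (s.1 && (M.all List.isEmpty && !decide (s.2.2.2 = 0)), [], S, s.2.2.2 - 1)
  | .branch => match s.2.2.1 with
    | [] => (false, [], [], 0)
    | M :: S => (s.1 && mentions M s.2.1, [],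
        (List.range (arity s.2.1)).reverse.map (condition s.2.1 M) ++ S, s.2.2.2)
  | .split => match s.2.2.1 with
    | [] => (false, [], [], 0)
    | M :: S => (s.1 && separated (splitBy s.2.1 M).1 (splitBy s.2.1 M).2, [],
        (splitBy s.2.1 M).1 :: (splitBy s.2.1 M).2 :: S, s.2.2.2)

variable {arity : Name → ℕ}

theorem checkStep_false {s : CheckState} (h : s.1 = false) (c : Command) :
    (checkStep arity s c).1 = false := by
  obtain ⟨ok, buf, S, k⟩ := s
  dsimp only at h
  subst h
  cases c <;> cases S <;> rfl

theorem foldl_checkStep_false {s : CheckState} (h : s.1 = false) (w : List Command) :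
    (w.foldl (checkStep arity) s).1 = false := by
  induction w generalizing s with
  | nil => exact h
  | cons c w ih => exact ih (checkStep_false h c)

/-- The flag never recovers once it is lowered, so in an accepting run every command is a valid
rule, with the buffer as its name or its marks. -/
theorem exists_queryDerivation {w : List Command} {buf : List Bool}
    {S : List (List (List (Name × ℕ)))} {k : ℕ}
    (h : (w.foldl (checkStep arity) (true, buf, S, k)).1 = true)
    (h' : (w.foldl (checkStep arity) (true, buf, S, k)).2.2.1 = []) :
    ∃ n m, n ≤ k ∧ QueryDerivation arity S n m := by
  induction w generalizing buf S k with
  | nil =>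
    obtain rfl : S = [] := h'
    exact ⟨0, 0, Nat.zero_le _, .nil⟩
  | cons c w ih =>
    rw [List.foldl_cons] at h h'
    have hok : (checkStep arity (true, buf, S, k) c).1 = true := by
      by_contra hc
      rw [foldl_checkStep_false (by simpa using hc)] at h
      exact Bool.false_ne_true h
    cases c with
    | zero => exact ih h h'
    | one => exact ih h h'
    | leaf =>
      cases S with
      | nil => simp [checkStep] at hok
      | cons M S =>
        simp only [checkStep] at h h'
        simp only [checkStep, Bool.true_and, Bool.and_eq_true, Bool.not_eq_true',
          decide_eq_false_iff_not] at hok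
        simp only [hok.1, hok.2] at h h'
        obtain ⟨n, m, hn, hd⟩ := ih h h'
        -- The check that the budget is positive makes the truncated subtraction exact.
        exact ⟨n + 1, m + 1, by omega, .leaf hok.1 hd⟩
    | branch =>
      cases S with
      | nil => simp [checkStep] at hok
      | cons M S =>
        simp only [checkStep, Bool.true_and] at hok h h'
        simp only [hok] at h h'
        obtain ⟨n, m, hn, hd⟩ := ih h h'
        exact ⟨n, m + 1, hn, .branch buf hok hd⟩
    | split =>
      cases S with
      | nil => simp [checkStep] at hok
      | cons M S =>
        simp only [checkStep, Bool.true_and] at hok h h'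
        simp only [hok] at h h'
        obtain ⟨n, m, hn, hd⟩ := ih h h'
        exact ⟨n, m + 1, hn, .split buf hok hd⟩

/-- The commands that write some bits into the buffer. -/
def bitCommands (bits : List Bool) : List Command :=
  bits.reverse.map fun b => if b then .one else .zero

theorem foldl_bitCommands (bits : List Bool) (ok : Bool) (S : List (List (List (Name × ℕ)))) (k : ℕ) :
    (bitCommands bits).foldl (checkStep arity) (ok, [], S, k) = (ok, bits, S, k) := by
  induction bits with
  | nil => rfl
  | cons b bits ih =>
    unfold bitCommands at *
    rw [List.reverse_cons, List.map_append, List.foldl_append, ih]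
    cases b <;> rfl

theorem length_splitBy {α : Type} (bits : List Bool) (l : List α) :
    (splitBy bits l).1.length + (splitBy bits l).2.length = l.length := by
  have key : ∀ (l u v : List α) (bits : List Bool),
      (l.foldl splitStep (bits, u, v)).2.1.length + (l.foldl splitStep (bits, u, v)).2.2.length =
        l.length + u.length + v.length := by
    intro l
    induction l with
    | nil => intros; simp
    | cons a l ih =>
      intro u v bits
      rw [List.foldl_cons, splitStep]
      split_ifs <;> rw [ih] <;> simp only [List.length_cons] <;> omega
  simpa [splitBy] using key l [] [] bits

/-- A rule costs one command and at most `L` bits: `L` bounds the names for queries and the number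
of monomials for splits. Neither rule increases these quantities. -/
theorem QueryDerivation.exists_commands {S : List (List (List (Name × ℕ)))} {n m L : ℕ}
    (h : QueryDerivation arity S n m) (hlen : ∀ M ∈ S, M.length ≤ L)
    (hname : ∀ M ∈ S, ∀ I, mentions M I → I.length ≤ L) :
    ∃ w : List Command, w.length ≤ m * (L + 1) ∧ ∀ k, n ≤ k →
      w.foldl (checkStep arity) (true, [], S, k) = (true, [], [], k - n) := by
  induction h with
  | nil => exact ⟨[], by simp, by simp⟩
  | leaf hM _ ih =>
    obtain ⟨w, hw, hr⟩ := ih (fun M hM => hlen M (List.mem_cons_of_mem _ hM))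
      fun M hM => hname M (List.mem_cons_of_mem _ hM)
    refine ⟨.leaf :: w, ?_, fun k hk => ?_⟩
    · rw [List.length_cons, Nat.add_mul]
      omega
    · have hk0 : k ≠ 0 := by omega
      rw [List.foldl_cons]
      simp only [checkStep, hM, hk0, decide_false, Bool.not_false, Bool.and_self]
      rw [hr (k - 1) (by omega)]
      rw [Nat.sub_sub, Nat.add_comm 1]
  | @branch M S n m I hI _ ih =>
    have h₁ : ∀ N ∈ (List.range (arity I)).reverse.map (condition I M) ++ S,
        N ∈ S ∨ ∃ a, condition I M a = N := by
      intro N hN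
      rcases List.mem_append.mp hN with hN | hN
      · obtain ⟨a, -, rfl⟩ := List.mem_map.mp hN
        exact .inr ⟨a, rfl⟩
      · exact .inl hN
    have h₂ : ∀ N ∈ (List.range (arity I)).reverse.map (condition I M) ++ S, N.length ≤ L := by
      intro N hN
      rcases h₁ N hN with hN | ⟨a, rfl⟩
      · exact hlen N (List.mem_cons_of_mem _ hN)
      · refine le_trans ?_ (hlen M List.mem_cons_self)
        rw [condition, List.length_map]
        exact List.length_filter_le _ _
    obtain ⟨w, hw, hr⟩ := ih h₂ fun N hN J hJ => by
      rcases h₁ N hN with hN | ⟨a, rfl⟩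
      · exact hname N (List.mem_cons_of_mem _ hN) J hJ
      · exact hname M List.mem_cons_self J (mentions_condition hJ).1
    refine ⟨bitCommands I ++ .branch :: w, ?_, fun k hk => ?_⟩
    · have := hname M List.mem_cons_self I hI
      simp only [List.length_append, List.length_cons, bitCommands, List.length_map,
        List.length_reverse, Nat.add_mul]
      omega
    · rw [List.foldl_append, foldl_bitCommands, List.foldl_cons]
      simp only [checkStep, hI, Bool.and_self]
      exact hr k hk
  | @split M S n m bits hb _ ih =>
    have hsum := length_splitBy bits M
    simp only [List.mem_cons, forall_eq_or_imp] at hlen hname ih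
    obtain ⟨w, hw, hr⟩ := ih ⟨by omega, by omega, hlen.2⟩
      ⟨fun J hJ => hname.1 J (mentions_splitBy (.inl hJ)),
        fun J hJ => hname.1 J (mentions_splitBy (.inr hJ)), hname.2⟩
    refine ⟨bitCommands (bits.take M.length) ++ .split :: w, ?_, fun k hk => ?_⟩
    · have := hlen.1
      simp only [List.length_append, List.length_cons, bitCommands, List.length_map,
        List.length_reverse, Nat.add_mul, List.length_take]
      omega
    · rw [List.foldl_append, foldl_bitCommands, List.foldl_cons]
      simp only [checkStep, splitBy_take, hb, Bool.and_self]
      exact hr k hk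

end

section

/-! ### Parsing instances -/

/-- The frame of a node on the current path: whether it is a player node, the name of its
information set, and the number of its children that were read. -/
abbrev Frame := Bool × Name × ℕ

/-- The states of the parser: the path to the current node (innermost frame first; the empty path
is an error state), the histories of the leaves and the arities of the player nodes (last one
first), and the number of ticks. -/
abbrev ParseState := List Frame × List (List (Name × ℕ)) × List (Name × ℕ) × ℕ

/-- The history of the current node. -/
def pathHist (path : List Frame) : List (Name × ℕ) :=
  (path.filter fun f => f.1).reverse.map fun f => f.2

/-- One more child of a node was read. -/
def Frame.next (f : Frame) : Frame := (f.1, f.2.1, f.2.2 + 1)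

/-- The parser reads a token in the state `s`, the path of which is `f :: ps`. -/
def parseToken (t : Token) (s : ParseState) (f : Frame) (ps : List Frame) : ParseState :=
  match t with
  | .tick => (f :: ps, s.2.1, s.2.2.1, s.2.2.2 + 1)
  | .leaf => (f.next :: ps, pathHist (f :: ps) :: s.2.1, s.2.2)
  | .chance => ((false, [], 0) :: f :: ps, s.2)
  | .player => ((true, [], 0) :: f :: ps, s.2)
  | .zero => bif f.1 && decide (f.2.2 = 0) then ((true, false :: f.2.1, 0) :: ps, s.2) else ([], s.2)
  | .one => bif f.1 && decide (f.2.2 = 0) then ((true, true :: f.2.1, 0) :: ps, s.2) else ([], s.2)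
  | .close => match ps with
    | [] => ([], s.2)
    | g :: qs => bif decide (f.2.2 = 0) || decide (f.2.1.head? = some false) then ([], s.2) else
        (g.next :: qs, s.2.1, bif f.1 then f.2 :: s.2.2.1 else s.2.2.1, s.2.2.2)

/-- The parser reads a token. -/
def parseStep (s : ParseState) (t : Token) : ParseState :=
  match s.1 with
  | [] => s
  | f :: ps => bif decide (t = .tick) || decide (s.2.2.2 = 0) then parseToken t s f ps else ([], s.2)

/-- The result of parsing a word. -/
def parse (x : List Token) : ParseState := x.foldl parseStep ([(false, [], 0)], [], [], 0)

/-- The name of an information set as it is read by the parser. -/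
def binName (I : ℕ) : Name := I.bits.reverse

/-- The tokens for some bits. -/
def bitTokens (bits : List Bool) : List Token := bits.map fun b => if b then Token.one else Token.zero

theorem binName_injective : Function.Injective binName := by
  intro I J h
  have h : I.bits = J.bits := List.reverse_injective h
  have key : ∀ n : ℕ, n.bits.foldr (fun b n => Nat.bit b n) 0 = n := by
    intro n
    induction n using Nat.binaryRec' with
    | zero => rfl
    | bit b n hn ih => rw [Nat.bits_append_bit _ _ hn, List.foldr_cons, ih]
  rw [← key I, h, key]

/-- Bit lists without a leading zero are exactly the binary names, which is why the parser rejects a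
leading zero. -/
theorem exists_bits_eq (bits : List Bool) (h : bits.reverse.head? ≠ some false) :
    ∃ I : ℕ, I.bits = bits := by
  induction bits with
  | nil => exact ⟨0, rfl⟩
  | cons b bits ih =>
    cases bits with
    | nil =>
      cases b with
      | false => simp at h
      | true => exact ⟨1, rfl⟩
    | cons c bits =>
      obtain ⟨I, hI⟩ := ih fun h' => h (by
        rw [List.reverse_cons, List.head?_append, h']
        rfl)
      refine ⟨Nat.bit b I, ?_⟩
      rw [Nat.bits_append_bit, hI]
      rintro rfl
      simp at hI

namespace GameTree

/-- The information sets and arities of all player nodes, in the order of the parser. -/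
def records : GameTree → List (Name × ℕ)
  | leaf => []
  | chance _ c => (List.ofFn fun i => (c i).records).reverse.flatten
  | player I n c => (binName I, n + 1) :: (List.ofFn fun i => (c i).records).reverse.flatten

end GameTree

section

variable {f : Frame} {ps : List Frame} {out : List (List (Name × ℕ))} {recs : List (Name × ℕ)}

theorem parseStep_cons (t : Token) :
    parseStep (f :: ps, out, recs, 0) t = parseToken t (f :: ps, out, recs, 0) f ps := by
  simp [parseStep]

theorem foldl_bitTokens (bits : List Bool) (nm : Name) :
    (bitTokens bits).foldl parseStep ((true, nm, 0) :: ps, out, recs, 0) =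
      ((true, bits.reverse ++ nm, 0) :: ps, out, recs, 0) := by
  induction bits generalizing nm with
  | nil => rfl
  | cons b bits ih =>
    rw [bitTokens, List.map_cons, List.foldl_cons, List.reverse_cons, List.append_assoc,
      parseStep_cons]
    cases b <;> exact ih _

theorem pathHist_chance (nm : Name) (i : ℕ) : pathHist ((false, nm, i) :: ps) = pathHist ps := by
  simp [pathHist]

theorem pathHist_player (nm : Name) (i : ℕ) :
    pathHist ((true, nm, i) :: ps) = pathHist ps ++ [(nm, i)] := by
  simp [pathHist]

open GameTree

/-- The histories of the leaves of `T`, in the notation of the parser, below a node with history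
`h`. -/
def GameTree.parsedHists (h : List (Name × ℕ)) (T : GameTree) : List (List (Name × ℕ)) :=
  (renameSets binName T.leafHists).map (h ++ ·)

/-- The number of children read so far is the index of the next action, hence enters the history of
each child. Outputs are put in front, so they accumulate in reversed order. -/
theorem foldl_encode_forest {n : ℕ} (c : Fin n → GameTree)
    (hc : ∀ i, ∀ f ps out recs, (c i).encode.foldl parseStep (f :: ps, out, recs, 0) =
      (f.next :: ps, ((c i).parsedHists (pathHist (f :: ps))).reverse ++ out,
        (c i).records ++ recs, 0)) (b : Bool) (nm : Name) (i : ℕ) :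
    (List.ofFn fun j => (c j).encode).flatten.foldl parseStep ((b, nm, i) :: ps, out, recs, 0) =
      ((b, nm, i + n) :: ps,
        (List.ofFn fun j : Fin n => (c j).parsedHists
          (pathHist ((b, nm, i + (j : ℕ)) :: ps))).flatten.reverse ++ out,
        (List.ofFn fun j => (c j).records).reverse.flatten ++ recs, 0) := by
  induction n generalizing i out recs with
  | zero => simp
  | succ n ih =>
    rw [List.ofFn_succ, List.flatten_cons, List.foldl_append, hc, Frame.next,
      ih (fun j => c j.succ) (fun j => hc j.succ)]
    simp [List.ofFn_succ, Nat.add_comm, Nat.add_left_comm]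

theorem foldl_encode (T : GameTree) : ∀ f ps out recs,
    T.encode.foldl parseStep (f :: ps, out, recs, 0) =
      (f.next :: ps, (T.parsedHists (pathHist (f :: ps))).reverse ++ out, T.records ++ recs, 0) := by
  induction T with
  | leaf =>
    intro f ps out recs
    simp [encode, parseStep_cons, parseToken, parsedHists, leafHists, renameSets, records]
  | chance n c ih =>
    intro f ps out recs
    rw [encode, List.foldl_cons, List.foldl_append, parseStep_cons, parseToken,
      foldl_encode_forest c ih, List.foldl_cons, List.foldl_nil, parseStep_cons]
    simp [parseToken, records, pathHist_chance, parsedHists, leafHists, renameSets, List.map_flatten,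
      List.map_ofFn, Function.comp_def]
  | player I n c ih =>
    intro f ps out recs
    -- The most significant bit of a number is never `false`, so the closing bracket is accepted.
    have hcan : ¬ (I.bits.reverse.head? = some false) := by
      intro h
      have key : ∀ I : ℕ, I.bits.getLast? ≠ some false := by
        intro I
        induction I using Nat.binaryRec' with
        | zero => simp
        | bit b n hn ih =>
          rw [Nat.bits_append_bit _ _ hn, List.getLast?_cons]
          cases h : n.bits.getLast? with
          | none =>
            have h0 : n = 0 := by
              have h₁ : n.bits = [] := List.getLast?_eq_none_iff.mp h
              exact binName_injective (by unfold binName; rw [h₁]; rfl)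
            simp [hn h0]
          | some d => simpa [h] using ih
      exact key I (by rwa [List.head?_reverse] at h)
    rw [List.head?_reverse] at hcan
    rw [encode, List.cons_append, List.foldl_cons, List.foldl_append, List.foldl_append,
      parseStep_cons, parseToken]
    have := foldl_bitTokens (ps := f :: ps) (out := out) (recs := recs) I.bits []
    unfold bitTokens at this
    rw [this, List.append_nil, foldl_encode_forest c ih, List.foldl_cons, List.foldl_nil,
      parseStep_cons]
    simp [parseToken, records, pathHist_player, parsedHists, leafHists, renameSets,
      List.map_flatten, List.map_ofFn, Function.comp_def, binName, hcan]

theorem foldl_encode_list (L : List GameTree) (b : Bool) (nm : Name) (i : ℕ) :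
    ∃ out' recs', (L.map encode).flatten.foldl parseStep ((b, nm, i) :: ps, out, recs, 0) =
      ((b, nm, i + L.length) :: ps, out', recs', 0) := by
  induction L generalizing i out recs with
  | nil => exact ⟨_, _, rfl⟩
  | cons T L ih =>
    rw [List.map_cons, List.flatten_cons, List.foldl_append, foldl_encode, Frame.next]
    obtain ⟨out', recs', h⟩ := ih (i := i + 1)
      (out := (T.parsedHists (pathHist ((b, nm, i) :: ps))).reverse ++ out)
      (recs := T.records ++ recs)
    exact ⟨out', recs', h.trans (by
      rw [List.length_cons, Nat.add_assoc, Nat.add_comm 1])⟩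

theorem foldl_replicate_tick (k m : ℕ) :
    (List.replicate k Token.tick).foldl parseStep (f :: ps, out, recs, m) =
      (f :: ps, out, recs, m + k) := by
  induction k generalizing m with
  | zero => rfl
  | succ k ih =>
    rw [List.replicate_succ, List.foldl_cons]
    exact (ih (m + 1)).trans (by rw [Nat.add_assoc, Nat.add_comm 1])

theorem parse_encodeInstance (T : GameTree) (k : ℕ) : parse (encodeInstance T k) =
    ([(false, [], 1)], (renameSets binName T.leafHists).reverse, T.records, k) := by
  rw [parse, encodeInstance, List.foldl_append, foldl_encode, foldl_replicate_tick]
  simp [parsedHists, pathHist, Frame.next]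

theorem foldl_parseStep_nil {s : ParseState} (h : s.1 = []) (w : List Token) :
    w.foldl parseStep s = s := by
  induction w with
  | nil => rfl
  | cons t w ih =>
    rw [List.foldl_cons]
    have : parseStep s t = s := by rw [parseStep, h]
    rw [this, ih]

/-- After the first tick every other token leads to the error state, and ticks do not change the
path. -/
theorem eq_replicate_of_foldl {w : List Token} {k : ℕ}
    (h : (w.foldl parseStep (f :: ps, out, recs, k + 1)).1.length = 1) :
    ps = [] ∧ ∃ m, w = List.replicate m .tick := by
  induction w generalizing k with
  | nil => exact ⟨by simpa using h, 0, rfl⟩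
  | cons t w ih =>
    rw [List.foldl_cons] at h
    by_cases ht : t = .tick
    · subst ht
      obtain ⟨h₁, m, rfl⟩ := ih (k := k + 1) h
      exact ⟨h₁, m + 1, rfl⟩
    · have : parseStep (f :: ps, out, recs, k + 1) t = ([], out, recs, k + 1) := by
        simp [parseStep, ht]
      rw [this, foldl_parseStep_nil rfl] at h
      simp at h

theorem exists_bitTokens (w : List Token) : ∃ bits w', w = bitTokens bits ++ w' ∧
    ∀ t ∈ w'.head?, t ≠ .zero ∧ t ≠ .one := by
  induction w with
  | nil => exact ⟨[], [], rfl, by simp⟩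
  | cons t w ih =>
    obtain ⟨bits, w', rfl, h⟩ := ih
    by_cases h₁ : t = .zero
    · exact ⟨false :: bits, w', by simp [bitTokens, h₁], h⟩
    by_cases h₂ : t = .one
    · exact ⟨true :: bits, w', by simp [bitTokens, h₂], h⟩
    · exact ⟨[], t :: (bitTokens bits ++ w'), rfl, by simpa using ⟨h₁, h₂⟩⟩

theorem exists_ofFn_encode {L : List GameTree} (h : L.length ≠ 0) :
    ∃ n, ∃ c : Fin (n + 1) → GameTree,
      (List.ofFn fun i => (c i).encode).flatten = (L.map encode).flatten := by
  cases L with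
  | nil => simp at h
  | cons T L =>
    refine ⟨L.length, fun i => (T :: L).get i, ?_⟩
    have h₁ : (T :: L).map encode = List.ofFn fun i => ((T :: L).get i).encode := by
      conv_lhs => rw [← List.ofFn_get (T :: L), List.map_ofFn]
      rfl
    rw [h₁]
    rfl

/-- A word that leads the parser back to the top level consists of the words of some trees, which
are followed by a closing bracket or, at the top level, by ticks. -/
theorem exists_forest (w : List Token) : ∀ f ps out recs,
    (f.1 = true → f.2.2 = 0 → ∀ t ∈ w.head?, t ≠ .zero ∧ t ≠ .one) →
    (w.foldl parseStep (f :: ps, out, recs, 0)).1.length = 1 →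
    ∃ (L : List GameTree) (rest : List Token), w = (L.map encode).flatten ++ rest ∧
      ((ps = [] ∧ ∃ k, rest = List.replicate k .tick) ∨
        ∃ rest', rest = .close :: rest' ∧ ps ≠ [] ∧ f.2.2 + L.length ≠ 0 ∧
          f.2.1.head? ≠ some false) := by
  obtain ⟨N, hN⟩ : ∃ N, w.length = N := ⟨_, rfl⟩
  induction N using Nat.strong_induction_on generalizing w with
  | _ N ih =>
  subst hN
  intro f ps out recs hbit hw
  cases w with
  | nil => exact ⟨[], [], rfl, .inl ⟨by simpa using hw, 0, rfl⟩⟩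
  | cons t w =>
    -- Once a first tree is recognised, the rest of the word is a forest by induction, read with the
    -- child counter advanced by one.
    have hnext : ∀ (T : GameTree) (w' : List Token), t :: w = T.encode ++ w' →
        ∃ (L : List GameTree) (rest : List Token), t :: w = (L.map encode).flatten ++ rest ∧
          ((ps = [] ∧ ∃ k, rest = List.replicate k .tick) ∨
            ∃ rest', rest = .close :: rest' ∧ ps ≠ [] ∧ f.2.2 + L.length ≠ 0 ∧
              f.2.1.head? ≠ some false) := by
      intro T w' h
      rw [h, List.foldl_append, foldl_encode] at hw
      have hlen : w'.length < (t :: w).length := by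
        rw [h, List.length_append]
        have : T.encode ≠ [] := by cases T <;> simp [encode]
        have := List.length_pos_iff.mpr this
        omega
      obtain ⟨L, rest, rfl, h'⟩ := ih _ hlen w' rfl f.next ps _ _ (by simp [Frame.next]) hw
      refine ⟨T :: L, rest, by rw [h]; simp, ?_⟩
      rcases h' with h' | ⟨rest', h₁, h₂, -, h₃⟩
      · exact .inl h'
      · exact .inr ⟨rest', h₁, h₂, by simp, h₃⟩
    rw [List.foldl_cons, parseStep_cons] at hw
    cases t with
    | tick =>
      obtain ⟨rfl, m, rfl⟩ := eq_replicate_of_foldl (k := 0) hw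
      exact ⟨[], _, rfl, .inl ⟨rfl, m + 1, rfl⟩⟩
    | leaf => exact hnext .leaf w rfl
    | chance =>
      obtain ⟨L, rest, rfl, h'⟩ := ih _ (by simp) w rfl _ _ _ _ (by simp) hw
      rcases h' with ⟨h', -⟩ | ⟨rest', rfl, -, h₁, -⟩
      · simp at h'
      · obtain ⟨n, c, hc⟩ := exists_ofFn_encode (L := L) (by simpa using h₁)
        exact hnext (.chance n c) rest' (by rw [encode, hc]; simp)
    | player =>
      obtain ⟨bits, w, rfl, hb⟩ := exists_bitTokens w
      rw [List.foldl_append, parseToken, foldl_bitTokens, List.append_nil] at hw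
      obtain ⟨L, rest, rfl, h'⟩ := ih _ (by simp only [List.length_cons, List.length_append]; omega)
        w rfl _ _ _ _ (fun _ _ => hb) hw
      rcases h' with ⟨h', -⟩ | ⟨rest', rfl, -, h₁, h₂⟩
      · simp at h'
      · obtain ⟨n, c, hc⟩ := exists_ofFn_encode (L := L) (by simpa using h₁)
        obtain ⟨I, rfl⟩ := exists_bits_eq bits h₂
        exact hnext (.player I n c) rest' (by rw [encode, hc]; simp [bitTokens])
    | zero =>
      -- A bit is legal only directly after the start of a player node, where `hbit` excludes it;
      -- elsewhere the parser fails.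
      cases h₁ : f.1 <;> by_cases h₂ : f.2.2 = 0 <;>
        first
        | exact absurd rfl (hbit h₁ h₂ .zero rfl).1
        | (simp only [parseToken, h₁, h₂] at hw
           rw [foldl_parseStep_nil (by simp)] at hw
           simp at hw)
    | one =>
      cases h₁ : f.1 <;> by_cases h₂ : f.2.2 = 0 <;>
        first
        | exact absurd rfl (hbit h₁ h₂ .one rfl).2
        | (simp only [parseToken, h₁, h₂] at hw
           rw [foldl_parseStep_nil (by simp)] at hw
           simp at hw)
    | close =>
      cases ps with
      | nil =>
        rw [parseToken, foldl_parseStep_nil rfl] at hw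
        simp at hw
      | cons g qs =>
        by_cases hc : f.2.2 = 0 ∨ f.2.1.head? = some false
        · have hc' : (decide (f.2.2 = 0) || decide (f.2.1.head? = some false)) = true := by
            simpa using hc
          simp only [parseToken, hc', cond_true] at hw
          rw [foldl_parseStep_nil rfl] at hw
          simp at hw
        · push Not at hc
          exact ⟨[], _, rfl, .inr ⟨w, rfl, by simp, by simpa using hc.1, hc.2⟩⟩

theorem exists_of_parse {x : List Token} (h : (parse x).1 = [(false, [], 1)]) :
    ∃ T k, x = encodeInstance T k := by
  obtain ⟨L, rest, rfl, h'⟩ := exists_forest x (false, [], 0) [] [] [] (by simp)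
    (by unfold parse at h; rw [h]; rfl)
  rcases h' with ⟨-, k, rfl⟩ | ⟨_, -, h', -⟩
  · obtain ⟨out', recs', h₁⟩ := foldl_encode_list (ps := []) (out := []) (recs := []) L false [] 0
    rw [parse, List.foldl_append, h₁, foldl_replicate_tick] at h
    have hL : L.length = 1 := by simpa using h
    obtain ⟨T, rfl⟩ := List.length_eq_one_iff.mp hL
    exact ⟨T, k, by simp [encodeInstance]⟩
  · exact absurd rfl h'

end

end

section

/-! ### The verifier -/

/-- The arity that is recorded for an information set. -/
def arityOf (recs : List (Name × ℕ)) (I : Name) : ℕ :=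
  match recs.filter fun r => decide (r.1 = I) with
  | [] => 0
  | r :: _ => r.2

/-- Whether a history does not repeat an information set. -/
def nodupNames (h : List (Name × ℕ)) : Bool :=
  h.all fun l => decide ((h.filter fun l' => decide (l'.1 = l.1)).length = 1)

/-- Whether a word is an instance. -/
def isInstance (x : List Token) (s : ParseState) : Bool :=
  decide (s.1 = [(false, [], 1)]) && (!decide (s.2.2.2 = 0) && (!decide (x.head? = some .leaf) &&
    ((s.2.2.1.all fun r => decide (arityOf s.2.2.1 r.1 = r.2)) && s.2.1.all nodupNames)))

/-- Run the checker on an instance and a certificate. -/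
def check (s : ParseState) (w : List Command) : CheckState :=
  w.foldl (checkStep (arityOf s.2.2.1)) (true, [], [s.2.1.reverse], s.2.2.2)

/-- The verifier. -/
def verify (z : List Token × List Command) : Bool :=
  isInstance z.1 (parse z.1) && ((check (parse z.1) z.2).1 && (check (parse z.1) z.2).2.2.1.isEmpty)

theorem nodupNames_iff {h : List (Name × ℕ)} : nodupNames h ↔ (h.map Prod.fst).Nodup := by
  rw [List.nodup_iff_count_eq_one]
  simp [nodupNames, List.count, List.countP_eq_length_filter, List.filter_map, Function.comp_def,
    beq_eq_decide]

theorem nodup_renamed {h : List GameAction} :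
    ((h.map fun l => (binName l.1, l.2)).map Prod.fst).Nodup ↔ (h.map Prod.fst).Nodup := by
  rw [List.map_map, show (Prod.fst ∘ fun l : GameAction => (binName l.1, l.2)) = binName ∘ Prod.fst
    from rfl, ← List.map_map, List.nodup_map_iff binName_injective]

theorem arityOf_eq {recs : List (Name × ℕ)} {r : Name × ℕ} (hr : r ∈ recs)
    (h : ∀ r' ∈ recs, r'.1 = r.1 → r'.2 = r.2) : arityOf recs r.1 = r.2 := by
  unfold arityOf
  split
  · rename_i h₁
    rw [List.filter_eq_nil_iff] at h₁
    simpa using h₁ r hr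
  · rename_i r' l h₁
    have h₂ := List.mem_filter.mp (h₁ ▸ List.mem_cons_self : r' ∈ recs.filter _)
    exact h r' h₂.1 (by simpa using h₂.2)

namespace GameTree

theorem mem_records_children {n : ℕ} {c : Fin n → GameTree} {r : Name × ℕ} :
    r ∈ (List.ofFn fun i => (c i).records).reverse.flatten ↔ ∃ i, r ∈ (c i).records := by
  simp only [List.mem_flatten, List.mem_reverse, List.mem_ofFn]
  constructor
  · rintro ⟨_, ⟨i, rfl⟩, h⟩
    exact ⟨i, h⟩
  · rintro ⟨i, h⟩
    exact ⟨_, ⟨i, rfl⟩, h⟩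

theorem exists_of_mem_records {T : GameTree} {r : Name × ℕ} (h : r ∈ T.records) :
    ∃ I n, r = (binName I, n + 1) := by
  induction T with
  | leaf => simp [records] at h
  | chance n c ih =>
    obtain ⟨i, hi⟩ := mem_records_children.mp h
    exact ih i hi
  | player I n c ih =>
    rcases List.mem_cons.mp h with rfl | h
    · exact ⟨I, n, rfl⟩
    · obtain ⟨i, hi⟩ := mem_records_children.mp h
      exact ih i hi

/-- The arity function is constrained only by the recorded player nodes, so testing that the records
agree decides whether a suitable one exists. -/
theorem arity_iff_records {act : ℕ → ℕ+} {T : GameTree} :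
    T.Arity act ↔ ∀ I n, (binName I, n) ∈ T.records → n = (act I : ℕ) := by
  induction T with
  | leaf => simp [Arity, records]
  | chance n c ih =>
    simp only [Arity, ih, records, mem_records_children]
    exact ⟨fun h I n ⟨i, hi⟩ => h i I n hi, fun h i I n hi => h I n ⟨i, hi⟩⟩
  | player J m c ih =>
    simp only [Arity, ih, records, List.mem_cons, mem_records_children]
    constructor
    · rintro ⟨h₁, h₂⟩ I n (h | ⟨i, hi⟩)
      · obtain ⟨hI, rfl⟩ := Prod.mk.inj h
        rw [binName_injective hI, h₁]
      · exact h₂ i I n hi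
    · intro h
      exact ⟨h J _ (.inl rfl), fun i I n hi => h I n (.inr ⟨i, hi⟩)⟩

theorem exists_mem_records {T : GameTree} {h : List GameAction} (hh : h ∈ T.leafHists)
    {l : GameAction} (hl : l ∈ h) : ∃ n, (binName l.1, n) ∈ T.records := by
  induction T generalizing h with
  | leaf =>
    obtain rfl : h = [] := by simpa [leafHists] using hh
    simp at hl
  | chance n c ih =>
    obtain ⟨i, hi⟩ := mem_leafHists_chance.mp hh
    obtain ⟨n, hn⟩ := ih i hi hl
    exact ⟨n, mem_records_children.mpr ⟨i, hn⟩⟩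
  | player I n c ih =>
    obtain ⟨i, h, hi, rfl⟩ := mem_leafHists_player.mp hh
    rcases List.mem_cons.mp hl with rfl | hl
    · exact ⟨n + 1, List.mem_cons_self⟩
    · obtain ⟨n, hn⟩ := ih i hi hl
      exact ⟨n, List.mem_cons_of_mem _ (mem_records_children.mpr ⟨i, hn⟩)⟩

theorem arityOf_records {act : ℕ → ℕ+} {T : GameTree} (hT : T.Arity act) {r : Name × ℕ}
    (hr : r ∈ T.records) : arityOf T.records r.1 = r.2 := by
  rw [arity_iff_records] at hT
  refine arityOf_eq hr fun r' hr' h => ?_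
  obtain ⟨I, n, rfl⟩ := exists_of_mem_records hr
  obtain ⟨J, m, rfl⟩ := exists_of_mem_records hr'
  obtain rfl := binName_injective h
  exact (hT _ _ hr').trans (hT _ _ hr).symm

theorem arityOf_records_of_mentions {act : ℕ → ℕ+} {T : GameTree} (hT : T.Arity act) {I : ℕ}
    (h : mentions T.leafHists I) : arityOf T.records (binName I) = act I := by
  obtain ⟨μ, hμ, l, hl, rfl⟩ := mentions_iff.mp h
  obtain ⟨n, hn⟩ := exists_mem_records hμ hl
  exact (arityOf_records hT hn).trans (arity_iff_records.mp hT _ _ hn)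

theorem length_encode_child_le {n : ℕ} (c : Fin n → GameTree) (i : Fin n) :
    (c i).encode.length ≤ (List.ofFn fun i => (c i).encode).flatten.length :=
  (List.sublist_flatten_of_mem (List.mem_ofFn (f := fun i => (c i).encode).mpr ⟨i, rfl⟩)).length_le

theorem length_leafHists_le (T : GameTree) : T.leafHists.length ≤ T.encode.length := by
  have key : ∀ {n : ℕ} (c : Fin n → GameTree),
      (∀ i, (c i).leafHists.length ≤ (c i).encode.length) →
      ∑ i, (c i).leafHists.length ≤ (List.ofFn fun i => (c i).encode).flatten.length := by
    intro n c h
    rw [List.length_flatten, List.map_ofFn, List.sum_ofFn]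
    exact Finset.sum_le_sum fun i _ => h i
  induction T with
  | leaf => simp [leafHists, encode]
  | chance n c ih =>
    have := key c ih
    rw [leafHists, List.length_flatten, List.map_ofFn, List.sum_ofFn]
    simp only [encode, List.length_cons, List.length_append, List.length_nil, Function.comp_def]
    omega
  | player I n c ih =>
    have := key c ih
    rw [leafHists, List.length_flatten, List.map_ofFn, List.sum_ofFn]
    simp only [encode, List.length_cons, List.length_append, List.length_nil, Function.comp_def,
      List.length_map]
    omega

theorem length_le_of_mem_leafHists {T : GameTree} {h : List GameAction} (hh : h ∈ T.leafHists) :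
    h.length ≤ T.encode.length ∧ ∀ l ∈ h, (binName l.1).length ≤ T.encode.length := by
  induction T generalizing h with
  | leaf =>
    obtain rfl : h = [] := by simpa [leafHists] using hh
    simp
  | chance n c ih =>
    obtain ⟨i, hi⟩ := mem_leafHists_chance.mp hh
    have h₁ := length_encode_child_le c i
    have h₂ := ih i hi
    simp only [encode, List.length_cons, List.length_append, List.length_nil]
    exact ⟨by omega, fun l hl => (h₂.2 l hl).trans (by omega)⟩
  | player I n c ih =>
    obtain ⟨i, h, hi, rfl⟩ := mem_leafHists_player.mp hh
    have h₁ := length_encode_child_le c i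
    have h₂ := ih i hi
    simp only [encode, List.length_cons, List.length_append, List.length_nil, List.length_map]
    refine ⟨by omega, fun l hl => ?_⟩
    rcases List.mem_cons.mp hl with rfl | hl
    · simp only [binName, List.length_reverse]
      omega
    · exact (h₂.2 l hl).trans (by omega)

end GameTree

open GameTree

theorem isInstance_encodeInstance {T : GameTree} {k : ℕ} :
    isInstance (encodeInstance T k) (parse (encodeInstance T k)) ↔
      k ≠ 0 ∧ T ≠ leaf ∧ (∀ r ∈ T.records, arityOf T.records r.1 = r.2) ∧ T.NAM := by
  have h₁ : (encodeInstance T k).head? = some .leaf ↔ T = leaf := by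
    cases T <;> simp [encodeInstance, encode]
  rw [isInstance, parse_encodeInstance, nam_iff]
  simp only [decide_true, Bool.true_and, Bool.and_eq_true, Bool.not_eq_true',
    decide_eq_false_iff_not, h₁, List.all_eq_true, decide_eq_true_eq, List.mem_reverse, ne_eq,
    nodupNames_iff, renameSets, List.forall_mem_map, nodup_renamed]

theorem mem_minALRSpan_of_verify {x : List Token} {w : List Command} (h : verify (x, w)) :
    x ∈ MinALRSpan := by
  simp only [verify, Bool.and_eq_true] at h
  obtain ⟨hx, hok, hS⟩ := h
  obtain ⟨T, k, rfl⟩ := exists_of_parse (x := x) (by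
    simp only [isInstance, Bool.and_eq_true, decide_eq_true_eq] at hx
    exact hx.1)
  obtain ⟨hk, hleaf, harity, hN⟩ := isInstance_encodeInstance.mp hx
  rw [check, parse_encodeInstance, List.reverse_reverse] at hok hS
  obtain ⟨n, m, hn, hd⟩ := exists_queryDerivation hok (List.isEmpty_iff.mp hS)
  dsimp only at hn hd
  -- Arities are read off the tree; information sets that do not occur get the default arity `1`.
  let act : ℕ → ℕ+ := fun I => (arityOf T.records (binName I)).toPNat'
  have hT : T.Arity act := by
    refine arity_iff_records.mpr fun I n hI => ?_
    obtain ⟨J, m, hJ⟩ := exists_of_mem_records hI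
    have h₁ := harity _ hI
    have h₂ : 0 < arityOf T.records (binName I) := by
      rw [(Prod.mk.inj hJ).2] at h₁
      dsimp only at h₁
      omega
    simp only [act, Nat.toPNat'_coe, if_pos h₂]
    exact h₁.symm
  have hinv : ∀ I, Function.invFun binName (binName I) = I :=
    Function.leftInverse_invFun binName_injective
  -- The checker's derivation is translated back from binary names. The inverse is only trusted on
  -- names of the form `binName I`, the only ones that occur.
  have hd' := hd.rename (act' := fun I => (act I : ℕ)) (Function.invFun binName)
    (by
      simp only [List.mem_singleton, forall_eq]
      intro I hI J hJ hIJ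
      obtain ⟨I, -, rfl⟩ := exists_of_mentions_renameSets hI
      obtain ⟨J, -, rfl⟩ := exists_of_mentions_renameSets hJ
      rw [hinv, hinv] at hIJ
      rw [hIJ])
    (by
      simp only [List.mem_singleton, forall_eq]
      intro I hI
      obtain ⟨I, hI₀, rfl⟩ := exists_of_mentions_renameSets hI
      rw [hinv, arityOf_records_of_mentions hT hI₀])
  have hM : renameSets (Function.invFun binName) (renameSets binName T.leafHists) = T.leafHists := by
    simp [renameSets, Function.comp_def, hinv]
  rw [List.map_singleton, hM] at hd'
  obtain ⟨T', hT', hsize, hspan⟩ := exists_alrSpan hT hN hd'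
  exact ⟨act, T, k, isGameStructure_iff.mpr ⟨hleaf, hT⟩, hN, Nat.pos_of_ne_zero hk, rfl, T', hT',
    hsize.trans_le hn, hspan⟩

/-- In terms of the word length `X`: the leaf count is at most `k ≤ X`, the degree at most `X * X`
(at most `X` histories of length at most `X`), and a rule costs at most `X + 1` commands. -/
theorem exists_verify {x : List Token} (h : x ∈ MinALRSpan) : ∃ w : List Command,
    w.length ≤ x.length * (2 * (x.length * x.length) + 1) * (x.length + 1) ∧ verify (x, w) := by
  obtain ⟨act, T, k, hT, hN, hk, rfl, T', hT', hsize, hspan⟩ := h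
  rw [isGameStructure_iff] at hT hT'
  obtain ⟨n, m, -, hn, hm, hd⟩ := derivable_of_isALRSpan hT.2 hN hT'.2 hspan
  obtain ⟨X, hX⟩ : ∃ X, (encodeInstance T k).length = X := ⟨_, rfl⟩
  have hX' : T.encode.length + k = X := by
    rw [← hX, encodeInstance, List.length_append, List.length_replicate]
  have hd' := hd.rename (act' := arityOf T.records) binName
    (fun _ _ I _ J _ h => binName_injective h)
    (by
      simp only [List.mem_singleton, forall_eq]
      exact fun I hI => arityOf_records_of_mentions hT.2 hI)
  rw [List.map_singleton] at hd'
  obtain ⟨w, hw, hr⟩ := hd'.exists_commands (L := X)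
    (by
      simp only [List.mem_singleton, forall_eq, renameSets, List.length_map]
      have := length_leafHists_le T
      omega)
    (by
      simp only [List.mem_singleton, forall_eq]
      intro I hI
      obtain ⟨I, hI₀, rfl⟩ := exists_of_mentions_renameSets hI
      obtain ⟨μ, hμ, l, hl, rfl⟩ := mentions_iff.mp hI₀
      have := (length_le_of_mem_leafHists hμ).2 l hl
      omega)
  refine ⟨w, ?_, ?_⟩
  · have h₁ : literals T.leafHists ≤ X * X := by
      have h₂ : literals T.leafHists ≤ T.leafHists.length * X := by
        have := List.sum_le_card_nsmul (T.leafHists.map List.length) X (by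
          simp only [List.forall_mem_map]
          intro μ hμ
          have := (length_le_of_mem_leafHists hμ).1
          omega)
        simpa [literals] using this
      have := length_leafHists_le T
      exact h₂.trans (Nat.mul_le_mul_right _ (by omega))
    rw [hX]
    calc w.length ≤ m * (X + 1) := hw
      _ ≤ n * (2 * literals T.leafHists + 1) * (X + 1) := Nat.mul_le_mul_right _ hm
      _ ≤ X * (2 * (X * X) + 1) * (X + 1) := by
        have : n ≤ X := by omega
        gcongr
  · have h₁ : isInstance (encodeInstance T k) (parse (encodeInstance T k)) :=
      isInstance_encodeInstance.mpr ⟨hk.ne', hT.1, fun r hr => arityOf_records hT.2 hr, hN⟩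
    simp only [verify, h₁, Bool.true_and]
    rw [check, parse_encodeInstance, List.reverse_reverse, hr k (hn.trans hsize)]
    rfl

end

section

open DataCode PolyTime

/-! ### The verifier runs in polynomial time -/

instance : DataCode Token where
  toData t := toData (match t with
    | .leaf => 0 | .chance => 1 | .player => 2 | .close => 3 | .zero => 4 | .one => 5 | .tick => (6 : ℕ))

instance : DataCode Command where
  toData c := toData (match c with
    | .zero => 0 | .one => 1 | .leaf => 2 | .branch => 3 | .split => (4 : ℕ))

theorem toData_token_injective : Function.Injective (toData : Token → Data) := by
  intro a b
  revert a b
  decide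

theorem toData_command_injective : Function.Injective (toData : Command → Data) := by
  intro a b
  revert a b
  decide

section

variable {α β κ : Type} [DataCode α] [DataCode β] [DataCode κ]

/-- A chain of tests against the finitely many values, with a separate program for each of them. -/
theorem PolyTime.finite_cases [Finite κ] {t : α → κ} {f : κ → α → β}
    (h : Function.Injective (toData : κ → Data)) (ht : PolyTime t) (hf : ∀ c, PolyTime (f c)) :
    PolyTime fun a => f (t a) a := by
  classical
  have key : ∀ l : List κ, ∃ g : α → List β, PolyTime g ∧ ∀ a, t a ∈ l → g a = [f (t a) a] := by
    intro l
    induction l with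
    | nil => exact ⟨fun _ => [], const _, by simp⟩
    | cons c l ih =>
      obtain ⟨g, hg, h'⟩ := ih
      refine ⟨fun a => if t a = c then [f c a] else g a, ite
        (of_eq ((beq_data (toData c)).comp (data.comp ht)) fun a => by simp [h.eq_iff])
        (cons (hf c) (const [])) hg, fun a ha => ?_⟩
      by_cases hc : t a = c
      · simp [hc]
      · dsimp only
        rw [if_neg hc]
        exact h' a ((List.mem_cons.mp ha).resolve_left hc)
  obtain ⟨l, hl⟩ : ∃ l : List κ, ∀ c, c ∈ l := by
    have := Fintype.ofFinite κ
    exact ⟨Finset.univ.toList, fun c => by simp⟩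
  obtain ⟨g, hg, h'⟩ := key l
  refine of_code (dataFst.comp (data.comp hg)) fun a => ?_
  rw [h' a (hl _)]
  rfl

variable {I J : α → Name} {M N : α → List (List (Name × ℕ))}

theorem PolyTime.beq_name (hI : PolyTime I) (hJ : PolyTime J) :
    PolyTime fun a => decide (I a = J a) := beq_list hI hJ beq_bool

theorem polyTime_arityOf {recs : α → List (Name × ℕ)} (hr : PolyTime recs) (hI : PolyTime I) :
    PolyTime fun a => arityOf (recs a) (I a) :=
  of_eq (list_cases (g := fun _ r _ => r.2)
    (filter (f := fun a r => decide (r.1 = I a)) hr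
      (beq_name (fst (snd id)) (hI.comp (fst id)))) (const 0) (snd (fst (snd id)))) fun a => by
    unfold arityOf
    cases List.filter _ _ <;> rfl

theorem polyTime_mentions (hM : PolyTime M) (hI : PolyTime I) :
    PolyTime fun a => mentions (M a) (I a) :=
  of_eq (any (f := fun a μ => μ.any fun l => decide (l.1 = I a)) hM
    (any (f := fun (y : α × List (Name × ℕ)) l => decide (l.1 = I y.1)) (snd id)
      (beq_name (fst (snd id)) (hI.comp (fst (fst id)))))) fun _ => rfl

theorem polyTime_separated (hM : PolyTime M) (hN : PolyTime N) :
    PolyTime fun a => separated (M a) (N a) :=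
  of_eq (all (f := fun a μ => (N a).all fun μ' => μ.all fun l => μ'.all fun l' =>
    !decide (l.1 = l'.1)) hM
    (all (f := fun (y : α × List (Name × ℕ)) μ' => y.2.all fun l => μ'.all fun l' => !decide (l.1 = l'.1)) (hN.comp (fst id))
      (all (f := fun (y : (α × List (Name × ℕ)) × List (Name × ℕ)) l => y.2.all fun l' => !decide (l.1 = l'.1)) (snd (fst id))
        (all (f := fun (y : ((α × List (Name × ℕ)) × List (Name × ℕ)) × Name × ℕ) l' =>
          !decide (y.2.1 = l'.1)) (snd (fst id))
          (not (beq_name (fst (snd (fst id))) (fst (snd id)))))))) fun _ => rfl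

theorem polyTime_condition {n : α → ℕ} (hI : PolyTime I) (hM : PolyTime M) (hn : PolyTime n) :
    PolyTime fun a => condition (I a) (M a) (n a) :=
  of_eq (map (f := fun a μ => μ.filter fun l => !decide (l.1 = I a))
    (filter (f := fun a μ => μ.all fun l => !decide (l.1 = I a) || decide (l.2 = n a)) hM
      (all (f := fun (y : α × List (Name × ℕ)) l => !decide (l.1 = I y.1) || decide (l.2 = n y.1)) (snd id)
        (or (not (beq_name (fst (snd id)) (hI.comp (fst (fst id)))))
          (beq_nat (snd (snd id)) (hn.comp (fst (fst id)))))))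
    (filter (f := fun (y : α × List (Name × ℕ)) l => !decide (l.1 = I y.1)) (snd id)
      (not (beq_name (fst (snd id)) (hI.comp (fst (fst id))))))) fun _ => rfl

/-- Splitting conserves size: every item moves to exactly one part. -/
theorem dsize_foldl_splitStep (l u v : List α) (bits : List Bool) :
    dsize (l.foldl splitStep (bits, u, v)).2.1 + dsize (l.foldl splitStep (bits, u, v)).2.2 + 1 =
      dsize l + dsize u + dsize v ∧ dsize (l.foldl splitStep (bits, u, v)).1 ≤ dsize bits := by
  induction l generalizing u v bits with
  | nil => simp only [List.foldl_nil, dsize_nil]; omega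
  | cons a l ih =>
    rw [List.foldl_cons, splitStep]
    have h₂ := dsize_le_of_sublist (List.tail_sublist bits)
    dsimp only
    split_ifs
    · have h₁ := ih (a :: u) v bits.tail
      simp only [dsize_cons] at h₁ ⊢
      omega
    · have h₁ := ih u (a :: v) bits.tail
      simp only [dsize_cons] at h₁ ⊢
      omega

theorem dsize_splitBy (bits : List Bool) (l : List α) :
    dsize (splitBy bits l).1 + dsize (splitBy bits l).2 = dsize l + 1 := by
  have := (dsize_foldl_splitStep l [] [] bits).1
  simp only [dsize_nil] at this
  unfold splitBy
  omega

theorem polyTime_splitBy {bits : α → List Bool} {l : α → List β} (hb : PolyTime bits)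
    (hl : PolyTime l) : PolyTime fun a => splitBy (bits a) (l a) := by
  have hhead : PolyTime fun y : List Bool × List β × List β => decide (y.1.head? = some true) :=
    of_eq (list_cases (g := fun _ b _ => b) (fst id) (const false) (fst (snd id))) fun y => by
      rcases y with ⟨_ | ⟨_ | _, _⟩, _⟩ <;> simp
  have hstep : PolyTime fun y : (List Bool × List β × List β) × β × α => splitStep y.1 y.2.1 :=
    prod (tail (fst (fst id))) (ite (p := fun y : (List Bool × List β × List β) × β × α =>
        y.1.1.head? = some true) (hhead.comp (fst id))
      (prod (cons (fst (snd id)) (fst (snd (fst id)))) (snd (snd (fst id))))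
      (prod (fst (snd (fst id))) (cons (fst (snd id)) (snd (snd (fst id))))))
  refine snd (foldl (f := fun _ => splitStep) (i := fun a => (bits a, [], []))
    (B := fun a => dsize (bits a) + dsize (l a) + 10) hl
    (prod hb (const (([], []) : List β × List β))) hstep
    ((hb.size_bounded.add hl.size_bounded).add (.const 10)) fun a l' h => ?_)
  have h₁ := dsize_foldl_splitStep l' [] [] (bits a)
  have h₂ := dsize_le_of_sublist h.sublist
  generalize l'.foldl splitStep (bits a, [], []) = s at h₁ ⊢
  obtain ⟨b, u, v⟩ := s
  simp only [dsize_prod, dsize_nil] at h₁ ⊢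
  omega

end

/-! #### Parsing -/

section

variable {α : Type} [DataCode α]

theorem polyTime_pathHist {p : α → List Frame} (hp : PolyTime p) :
    PolyTime fun a => pathHist (p a) :=
  map (f := fun _ (f : Frame) => f.2)
    (reverse (filter (f := fun _ (f : Frame) => f.1) hp (fst (snd id)))) (snd (snd id))

theorem polyTime_next {f : α → Frame} (hf : PolyTime f) : PolyTime fun a => (f a).next :=
  prod (fst hf) (prod (fst (snd hf)) (succ (snd (snd hf))))

theorem polyTime_parseToken (t : Token) :
    PolyTime fun y : ParseState × Frame × List Frame => parseToken t y.1 y.2.1 y.2.2 := by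
  have hs : PolyTime fun y : ParseState × Frame × List Frame => y.1.2 := snd (fst id)
  have hf : PolyTime fun y : ParseState × Frame × List Frame => y.2.1 := fst (snd id)
  have hps : PolyTime fun y : ParseState × Frame × List Frame => y.2.2 := snd (snd id)
  have herr : PolyTime fun y : ParseState × Frame × List Frame =>
      (([], y.1.2) : ParseState) := prod (const []) hs
  have hbit : ∀ b, PolyTime fun y : ParseState × Frame × List Frame =>
      bif y.2.1.1 && decide (y.2.1.2.2 = 0) then
        (((true, b :: y.2.1.2.1, 0) :: y.2.2, y.1.2) : ParseState) else ([], y.1.2) := fun b =>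
    cond (and (fst hf) (beq_nat (snd (snd hf)) (const 0)))
      (prod (cons (prod (const true) (prod (cons (const b) (fst (snd hf))) (const 0))) hps) hs) herr
  cases t with
  | tick => exact prod (cons hf hps) (prod (fst hs) (prod (fst (snd hs)) (succ (snd (snd hs)))))
  | leaf => exact prod (cons (polyTime_next hf) hps) (prod (cons (polyTime_pathHist (cons hf hps)) (fst hs)) (snd hs))
  | chance => exact prod (cons (const (false, [], 0)) (cons hf hps)) hs
  | player => exact prod (cons (const (true, [], 0)) (cons hf hps)) hs
  | zero => exact hbit false
  | one => exact hbit true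
  | close =>
    have hhead : PolyTime fun l : List Bool => decide (l.head? = some false) :=
      of_eq (list_cases (g := fun _ b _ => !b) id (const false) (not (fst (snd id)))) fun l => by
        rcases l with _ | ⟨_ | _, _⟩ <;> simp
    refine of_eq (list_cases (g := fun y g qs =>
      bif decide (y.2.1.2.2 = 0) || decide (y.2.1.2.1.head? = some false) then
        (([], y.1.2) : ParseState) else (g.next :: qs, y.1.2.1,
          bif y.2.1.1 then y.2.1.2 :: y.1.2.2.1 else y.1.2.2.1, y.1.2.2.2)) hps herr ?_) fun y => by
      rcases y with ⟨s, f, _ | ⟨g, qs⟩⟩ <;> rfl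
    refine cond (or (beq_nat (snd (snd (hf.comp (fst id)))) (const 0))
      (hhead.comp (fst (snd (hf.comp (fst id)))))) (herr.comp (fst id)) ?_
    exact prod (cons (polyTime_next (fst (snd id))) (snd (snd id))) (prod (fst (hs.comp (fst id))) (prod
      (cond (fst (hf.comp (fst id))) (cons (snd (hf.comp (fst id))) (fst (snd (hs.comp (fst id)))))
        (fst (snd (hs.comp (fst id))))) (snd (snd (hs.comp (fst id))))))

theorem polyTime_parseStep : PolyTime fun y : ParseState × Token => parseStep y.1 y.2 := by
  refine of_eq (list_cases (l := fun y : ParseState × Token => y.1.1) (f := fun y => y.1)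
    (g := fun y f ps => bif decide (y.2 = .tick) || decide (y.1.2.2.2 = 0) then
      parseToken y.2 y.1 f ps else ([], y.1.2)) (fst (fst id)) (fst id) ?_) fun y => ?_
  · refine cond (or ((of_finite toData_token_injective fun t => decide (t = .tick)).comp
      (snd (fst id))) (beq_nat (snd (snd (snd (fst (fst id))))) (const 0))) ?_
      (prod (const []) (snd (fst (fst id))))
    exact finite_cases (f := fun t (y : (ParseState × Token) × Frame × List Frame) =>
      parseToken t y.1.1 y.2.1 y.2.2) toData_token_injective (snd (fst id)) fun t =>
      (polyTime_parseToken t).comp (prod (fst (fst id)) (prod (fst (snd id)) (snd (snd id))))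
  · rcases y with ⟨⟨_ | ⟨f, ps⟩, s⟩, t⟩ <;> rfl

theorem dsize_pathHist_le (p : List Frame) : dsize (pathHist p) ≤ dsize p := by
  have key : ∀ l : List Frame, dsize (l.map fun f => f.2) ≤ dsize l := by
    intro l
    induction l with
    | nil => rfl
    | cons f l ih =>
      obtain ⟨b, f⟩ := f
      simp only [List.map_cons, dsize_cons, dsize_prod b f]
      omega
  refine (key _).trans ?_
  rw [dsize_reverse]
  exact dsize_le_of_sublist List.filter_sublist

theorem dsize_next (f : Frame) : dsize f.next = dsize f + 2 := by
  obtain ⟨b, nm, i⟩ := f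
  simp only [Frame.next, dsize_prod, dsize_nat]
  omega

/-- The components of a state of the parser are bounded by `p`, `o`, `r` and `k`. -/
def ParseBound (p o r k : ℕ) (s : ParseState) : Prop :=
  dsize s.1 ≤ p ∧ dsize s.2.1 ≤ o ∧ dsize s.2.2.1 ≤ r ∧ s.2.2.2 ≤ k

/-- A token opens at most one frame, of constant size, and outputs at most one history or record, no
larger than the path. So the path grows linearly and the outputs quadratically. -/
theorem parseBound_parseStep {p o r k : ℕ} {s : ParseState} (h : ParseBound p o r k s)
    (t : Token) : ParseBound (p + 10) (o + p + 1) (r + p + 1) (k + 1) (parseStep s t) := by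
  obtain ⟨path, out, recs, m⟩ := s
  obtain ⟨h₁, h₂, h₃, h₄⟩ := h
  dsimp only at h₁ h₂ h₃ h₄
  have hp := one_le_dsize path
  cases path with
  | nil => exact ⟨by simp [parseStep], by dsimp only [parseStep]; omega,
      by dsimp only [parseStep]; omega, by dsimp only [parseStep]; omega⟩
  | cons f ps =>
    have hh := dsize_pathHist_le (f :: ps)
    have hn := dsize_next f
    obtain ⟨b, nm, i⟩ := f
    have hb := dsize_bool_le b
    have hps := one_le_dsize ps
    have hb₀ := dsize_bool_le false
    have hb₁ := dsize_bool_le true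
    have hb₂ := one_le_dsize b
    have hnil : dsize ([] : List Frame) = 1 := rfl
    rw [parseStep]
    dsimp only
    cases decide (t = .tick) || decide (m = 0)
    · refine ⟨?_, ?_, ?_, ?_⟩ <;> dsimp only [cond_false] <;> omega
    · dsimp only [cond_true]
      cases t with
      | close =>
        cases ps with
        | nil => refine ⟨?_, ?_, ?_, ?_⟩ <;> dsimp only [parseToken] <;> omega
        | cons g qs =>
          have hg := dsize_next g
          have hr : dsize (bif b then (nm, i) :: recs else recs) ≤ r + p + 1 := by
            cases b <;> simp only [cond_true, cond_false, dsize_cons, dsize_prod] at * <;> omega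
          dsimp only [parseToken]
          cases decide (i = 0) || decide (nm.head? = some false)
          · refine ⟨?_, ?_, hr, ?_⟩ <;> dsimp only [cond_false] <;>
              simp only [dsize_cons, dsize_prod, hg] at * <;> omega
          · refine ⟨?_, ?_, ?_, ?_⟩ <;> dsimp only [cond_true] <;> omega
      | zero =>
        dsimp only [parseToken]
        cases b && decide (i = 0) <;>
          refine ⟨?_, ?_, ?_, ?_⟩ <;> dsimp only [cond_true, cond_false] <;>
          simp only [dsize_cons, dsize_prod, dsize_nat] at * <;> omega
      | one =>
        dsimp only [parseToken]
        cases b && decide (i = 0) <;>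
          refine ⟨?_, ?_, ?_, ?_⟩ <;> dsimp only [cond_true, cond_false] <;>
          simp only [dsize_cons, dsize_prod, dsize_nat] at * <;> omega
      | _ => refine ⟨?_, ?_, ?_, ?_⟩ <;> dsimp only [parseToken] <;>
          simp only [dsize_cons, dsize_prod, dsize_nat, dsize_nil, hn] at * <;> omega

theorem parseBound_foldl {N : ℕ} (x : List Token) (h : x.length ≤ N) :
    ParseBound (10 * x.length + 10) (x.length * (10 * N + 20) + 1)
      (x.length * (10 * N + 20) + 1) x.length (parse x) := by
  induction x using List.reverseRecOn with
  | nil =>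
    refine ⟨?_, by simp [parse], by simp [parse], by simp [parse]⟩
    have := dsize_bool_le false
    simp only [parse, List.foldl_nil, dsize_cons, dsize_prod, dsize_nil, dsize_nat]
    omega
  | append_singleton x t ih =>
    rw [List.length_append, List.length_singleton] at *
    have := parseBound_parseStep (ih (by omega)) t
    rw [parse, List.foldl_append]
    change ParseBound _ _ _ _ (parseStep (parse x) t)
    obtain ⟨h₁, h₂, h₃, h₄⟩ := this
    simp only [Nat.add_mul]
    exact ⟨by omega, by omega, by omega, h₄⟩

theorem polyTime_parse : PolyTime parse := by
  refine foldl (α := List Token) (f := fun _ => parseStep)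
    (B := fun x => 30 * dsize x + 2 * (dsize x * (10 * dsize x + 20)) + 30) id (const _)
    (polyTime_parseStep.comp (prod (fst id) (fst (snd id))))
    (((PolyBounded.mul (.const 30) .size).add (PolyBounded.mul (.const 2) (PolyBounded.mul .size
      ((PolyBounded.mul (.const 10) .size).add (.const 20))))).add (.const 30)) fun x l' h => ?_
  have h₁ := h.length_le
  have h₂ := length_lt_dsize x
  obtain ⟨h₃, h₄, h₅, h₆⟩ := parseBound_foldl l' (N := dsize x) (by omega)
  have h₇ := Nat.mul_le_mul_right (10 * dsize x + 20) (show l'.length ≤ dsize x by omega)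
  change dsize (parse l') ≤ _
  generalize parse l' = s at *
  obtain ⟨p, o, r, k⟩ := s
  simp only [dsize_prod, dsize_nat] at *
  omega

end

/-! #### Checking -/

section

variable {α : Type} [DataCode α]

theorem polyTime_checkStep (c : Command) : PolyTime fun y : CheckState × List (Name × ℕ) =>
    checkStep (arityOf y.2) y.1 c := by
  have hok : PolyTime fun y : CheckState × List (Name × ℕ) => y.1.1 := fst (fst id)
  have hbuf : PolyTime fun y : CheckState × List (Name × ℕ) => y.1.2.1 := fst (snd (fst id))
  have hS : PolyTime fun y : CheckState × List (Name × ℕ) => y.1.2.2.1 :=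
    fst (snd (snd (fst id)))
  have herr : PolyTime fun _ : CheckState × List (Name × ℕ) =>
      ((false, [], [], 0) : CheckState) := const _
  have hok' : PolyTime fun z : (CheckState × List (Name × ℕ)) × List (List (Name × ℕ)) ×
      List (List (List (Name × ℕ))) => z.1.1.1 := fst (fst (fst id))
  have hbuf' : PolyTime fun z : (CheckState × List (Name × ℕ)) × List (List (Name × ℕ)) ×
      List (List (List (Name × ℕ))) => z.1.1.2.1 := fst (snd (fst (fst id)))
  have hk' : PolyTime fun z : (CheckState × List (Name × ℕ)) × List (List (Name × ℕ)) ×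
      List (List (List (Name × ℕ))) => z.1.1.2.2.2 := snd (snd (snd (fst (fst id))))
  have hrecs' : PolyTime fun z : (CheckState × List (Name × ℕ)) × List (List (Name × ℕ)) ×
      List (List (List (Name × ℕ))) => z.1.2 := snd (fst id)
  have hM' : PolyTime fun z : (CheckState × List (Name × ℕ)) × List (List (Name × ℕ)) ×
      List (List (List (Name × ℕ))) => z.2.1 := fst (snd id)
  have hS' : PolyTime fun z : (CheckState × List (Name × ℕ)) × List (List (Name × ℕ)) ×
      List (List (List (Name × ℕ))) => z.2.2 := snd (snd id)
  have hnil' : PolyTime fun _ : (CheckState × List (Name × ℕ)) × List (List (Name × ℕ)) ×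
      List (List (List (Name × ℕ))) => ([] : List Bool) := const []
  cases c with
  | zero => exact prod hok (prod (cons (const false) hbuf) (snd (snd (fst id))))
  | one => exact prod hok (prod (cons (const true) hbuf) (snd (snd (fst id))))
  | leaf =>
    have hall : PolyTime fun z : (CheckState × List (Name × ℕ)) × List (List (Name × ℕ)) ×
        List (List (List (Name × ℕ))) => z.2.1.all List.isEmpty :=
      all (f := fun _ (μ : List (Name × ℕ)) => μ.isEmpty) hM' (isEmpty (snd id))
    refine of_eq (list_cases (g := fun y M S =>
      (y.1.1 && (M.all List.isEmpty && !decide (y.1.2.2.2 = 0)), [], S, y.1.2.2.2 - 1)) hS herr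
      (prod (and hok' (and hall (not (beq_nat hk' (const 0)))))
        (prod hnil' (prod hS' (pred hk'))))) fun y => ?_
    rcases y with ⟨⟨ok, buf, _ | ⟨M, S⟩, k⟩, recs⟩ <;> rfl
  | branch =>
    have hcond : PolyTime fun u : ((CheckState × List (Name × ℕ)) × List (List (Name × ℕ)) ×
        List (List (List (Name × ℕ)))) × ℕ => condition u.1.1.1.2.1 u.1.2.1 u.2 :=
      polyTime_condition (I := fun u : ((CheckState × List (Name × ℕ)) × List (List (Name × ℕ)) ×
        List (List (List (Name × ℕ)))) × ℕ => u.1.1.1.2.1) (M := fun u => u.1.2.1)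
        (n := fun u => u.2) (hbuf'.comp (fst id)) (hM'.comp (fst id)) (snd id)
    have hchildren := map (f := fun z : (CheckState × List (Name × ℕ)) × List (List (Name × ℕ)) ×
        List (List (List (Name × ℕ))) => condition z.1.1.2.1 z.2.1)
      (PolyTime.downFrom (polyTime_arityOf hrecs' hbuf')) hcond
    refine of_eq (list_cases (g := fun y M S =>
      (y.1.1 && mentions M y.1.2.1, [],
        (downFrom (arityOf y.2 y.1.2.1)).map (condition y.1.2.1 M) ++ S, y.1.2.2.2)) hS herr
      (prod (and hok' (polyTime_mentions hM' hbuf')) (prod hnil'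
        (prod (append hchildren hS') hk')))) fun y => ?_
    -- `downFrom` unfolds to the reversed range that the checker uses.
    rcases y with ⟨⟨ok, buf, _ | ⟨M, S⟩, k⟩, recs⟩ <;> rfl
  | split =>
    have hsplit := polyTime_splitBy hbuf' hM'
    have hA : PolyTime fun z : (CheckState × List (Name × ℕ)) × List (List (Name × ℕ)) ×
        List (List (List (Name × ℕ))) => (splitBy z.1.1.2.1 z.2.1).1 := fst hsplit
    have hB : PolyTime fun z : (CheckState × List (Name × ℕ)) × List (List (Name × ℕ)) ×
        List (List (List (Name × ℕ))) => (splitBy z.1.1.2.1 z.2.1).2 := snd hsplit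
    have hsep := and hok' (polyTime_separated hA hB)
    have hstack := cons hA (cons hB hS')
    have hall := prod hsep (prod hnil' (prod hstack hk'))
    refine of_eq (list_cases (g := fun y M S =>
      (y.1.1 && separated (splitBy y.1.2.1 M).1 (splitBy y.1.2.1 M).2, [],
        (splitBy y.1.2.1 M).1 :: (splitBy y.1.2.1 M).2 :: S, y.1.2.2.2)) hS herr
      hall) fun y => ?_
    rcases y with ⟨⟨ok, buf, _ | ⟨M, S⟩, k⟩, recs⟩ <;> rfl

end

section

theorem arityOf_le (recs : List (Name × ℕ)) (I : Name) : arityOf recs I ≤ dsize recs := by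
  unfold arityOf
  split
  · exact Nat.zero_le _
  · rename_i r l h
    have h₁ := dsize_le_of_mem
      (List.mem_filter.mp (h ▸ List.mem_cons_self : r ∈ recs.filter _)).1
    obtain ⟨nm, n⟩ := r
    simp only [dsize_prod, dsize_nat] at h₁ ⊢
    omega

theorem dsize_condition_le (I : Name) (M : List (List (Name × ℕ))) (a : ℕ) :
    dsize (condition I M a) ≤ dsize M := by
  unfold condition
  generalize (fun μ : List (Name × ℕ) => μ.all fun l => !decide (l.1 = I) || decide (l.2 = a)) = p
  induction M with
  | nil => rfl
  | cons μ M ih =>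
    have h₁ := dsize_le_of_sublist
      (List.filter_sublist (p := fun l : Name × ℕ => !decide (l.1 = I)) (l := μ))
    cases h : p μ <;> simp only [List.filter_cons, h, if_true, Bool.false_eq_true, if_false,
      List.map_cons, dsize_cons] <;> omega

/-- Bounds for the components of a state of the checker. -/
def CheckBound (b D c k : ℕ) (s : CheckState) : Prop :=
  dsize s.2.1 ≤ b ∧ (∀ M ∈ s.2.2.1, dsize M ≤ D) ∧ s.2.2.1.length ≤ c ∧ s.2.2.2 ≤ k

/-- Conditioning and splitting never enlarge a set, and one command adds at most `A + 1` sets. The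
bound needs no valid rule, since the fold must be controlled for arbitrary certificates. -/
theorem checkBound_checkStep {b D c k A : ℕ} {arity : Name → ℕ} (hA : ∀ I, arity I ≤ A)
    {s : CheckState} (h : CheckBound b D c k s) (w : Command) :
    CheckBound (b + 4) D (c + (A + 1)) k (checkStep arity s w) := by
  obtain ⟨ok, buf, S, m⟩ := s
  obtain ⟨h₁, h₂, h₃, h₄⟩ := h
  dsimp only at h₁ h₂ h₃ h₄
  have hb₀ := dsize_bool_le false
  have hb₁ := dsize_bool_le true
  have hbuf := one_le_dsize buf
  have herr : CheckBound (b + 4) D (c + (A + 1)) k (false, [], [], 0) :=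
    ⟨by dsimp only; rw [dsize_nil]; omega, by simp, by simp, by simp⟩
  cases w with
  | zero => exact ⟨by dsimp only [checkStep]; rw [dsize_cons]; omega, h₂, by
      dsimp only [checkStep]; omega, h₄⟩
  | one => exact ⟨by dsimp only [checkStep]; rw [dsize_cons]; omega, h₂, by
      dsimp only [checkStep]; omega, h₄⟩
  | leaf =>
    cases S with
    | nil => exact herr
    | cons M S =>
      rw [List.length_cons] at h₃
      exact ⟨by dsimp only [checkStep]; rw [dsize_nil]; omega,
        fun N hN => h₂ N (List.mem_cons_of_mem _ hN), by dsimp only [checkStep]; omega,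
        by dsimp only [checkStep]; omega⟩
  | branch =>
    cases S with
    | nil => exact herr
    | cons M S =>
      have := hA buf
      rw [List.length_cons] at h₃
      refine ⟨by dsimp only [checkStep]; rw [dsize_nil]; omega, fun N hN => ?_, ?_, h₄⟩
      · rcases List.mem_append.mp hN with hN | hN
        · obtain ⟨a, -, rfl⟩ := List.mem_map.mp hN
          exact (dsize_condition_le _ _ _).trans (h₂ M List.mem_cons_self)
        · exact h₂ N (List.mem_cons_of_mem _ hN)
      · simp only [checkStep, List.length_append, List.length_map, List.length_reverse,
          List.length_range]
        omega
  | split =>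
    cases S with
    | nil => exact herr
    | cons M S =>
      have h₅ := dsize_splitBy buf M
      have h₆ := one_le_dsize (splitBy buf M).1
      have h₇ := one_le_dsize (splitBy buf M).2
      simp only [List.mem_cons, forall_eq_or_imp, List.length_cons] at h₂ h₃
      refine ⟨by dsimp only [checkStep]; rw [dsize_nil]; omega, ?_, ?_, h₄⟩
      · simp only [checkStep, List.mem_cons, forall_eq_or_imp]
        exact ⟨by omega, by omega, h₂.2⟩
      · simp only [checkStep, List.length_cons]
        omega

theorem checkBound_foldl {b D c k A : ℕ} {arity : Name → ℕ} (hA : ∀ I, arity I ≤ A)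
    {s : CheckState} (h : CheckBound b D c k s) (w : List Command) :
    CheckBound (b + 4 * w.length) D (c + w.length * (A + 1)) k (w.foldl (checkStep arity) s) := by
  induction w generalizing s b c with
  | nil => simpa using h
  | cons x w ih =>
    have := ih (checkBound_checkStep hA h x)
    rw [List.length_cons, Nat.add_mul, Nat.mul_add]
    have h₁ : b + (4 * w.length + 4 * 1) = b + 4 + 4 * w.length := by omega
    have h₂ : c + (w.length * (A + 1) + 1 * (A + 1)) = c + (A + 1) + w.length * (A + 1) := by omega
    rw [h₁, h₂]
    exact this

theorem dsize_check_le (s : ParseState) {N : ℕ} (w : List Command) (hs : dsize s ≤ N)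
    (hw : w.length ≤ N) :
    dsize (check s w) ≤ 20 + 4 * N + (1 + N * (N + 1)) * (N + 1) + 2 * N := by
  obtain ⟨path, out, recs, k⟩ := s
  simp only [dsize_prod, dsize_nat] at hs
  have hb := checkBound_foldl (arity := arityOf recs) (A := N) (b := 1) (D := N) (c := 1)
    (k := k) (s := (true, [], [out.reverse], k))
    (fun I => (arityOf_le recs I).trans (by omega))
    ⟨le_rfl, by
      simp only [List.mem_singleton, forall_eq, dsize_reverse]
      omega, le_rfl, le_rfl⟩ w
  rw [check]
  dsimp only
  generalize w.foldl (checkStep (arityOf recs)) (true, [], [out.reverse], k) = s at hb ⊢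
  obtain ⟨ok, buf, S, m⟩ := s
  obtain ⟨h₁, h₂, h₃, h₄⟩ := hb
  dsimp only at h₁ h₂ h₃ h₄
  have h₅ := dsize_le_length_mul h₂
  have h₆ : S.length ≤ 1 + N * (N + 1) :=
    h₃.trans (Nat.add_le_add_left (Nat.mul_le_mul_right _ hw) _)
  have h₇ := Nat.mul_le_mul_right (N + 1) h₆
  have hok := dsize_bool_le ok
  simp only [dsize_prod, dsize_nat]
  omega

theorem polyTime_check : PolyTime fun y : ParseState × List Command => check y.1 y.2 := by
  have hs : PolyTime fun y : ParseState × List Command => y.1 := fst id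
  have hinit : PolyTime fun y : ParseState × List Command =>
      ((true, [], [y.1.2.1.reverse], y.1.2.2.2) : CheckState) :=
    prod (const true) (prod (const []) (prod
      (cons (reverse (fst (snd hs))) (const [])) (snd (snd (snd hs)))))
  have hstep : PolyTime fun y : CheckState × Command × ParseState × List Command =>
      checkStep (arityOf y.2.2.1.2.2.1) y.1 y.2.1 := by
    have hr : PolyTime fun y : CheckState × Command × ParseState × List Command =>
        (y.1, y.2.2.1.2.2.1) := prod (fst id) (fst (snd (snd (fst (snd (snd id))))))
    exact finite_cases (f := fun c (y : CheckState × Command × ParseState × List Command) =>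
      checkStep (arityOf y.2.2.1.2.2.1) y.1 c) toData_command_injective
      (fst (snd id)) fun c => (polyTime_checkStep c).comp hr
  have hB : PolyBounded fun y : ParseState × List Command =>
      20 + 4 * dsize y + (1 + dsize y * (dsize y + 1)) * (dsize y + 1) + 2 * dsize y :=
    (((PolyBounded.const 20).add (PolyBounded.mul (.const 4) .size)).add
      (((PolyBounded.const 1).add (PolyBounded.mul .size (PolyBounded.size.add (.const 1)))).mul
        (PolyBounded.size.add (.const 1)))).add (PolyBounded.mul (.const 2) .size)
  have hsize : ∀ (y : ParseState × List Command) (w : List Command), w <+: y.2 →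
      dsize (check y.1 w) ≤
        20 + 4 * dsize y + (1 + dsize y * (dsize y + 1)) * (dsize y + 1) + 2 * dsize y := by
    rintro ⟨s, w⟩ w' h
    have hw := h.length_le
    have hw' := length_lt_dsize w
    refine dsize_check_le s w' ?_ ?_ <;> simp only [dsize_prod] at * <;> omega
  exact foldl (α := ParseState × List Command) (β := Command) (σ := CheckState) (l := fun y => y.2)
    (i := fun y => (true, [], [y.1.2.1.reverse], y.1.2.2.2))
    (f := fun y => checkStep (arityOf y.1.2.2.1)) (snd id) hinit hstep hB hsize

end

/-! ### The complete verifier in polynomial time -/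

section

theorem polyTime_nodupNames : PolyTime nodupNames := by
  have hname : PolyTime fun y : (List (Name × ℕ) × Name × ℕ) × Name × ℕ =>
      decide (y.2.1 = y.1.2.1) := beq_name (fst (snd id)) (fst (snd (fst id)))
  have hfilter : PolyTime fun y : List (Name × ℕ) × Name × ℕ =>
      y.1.filter fun l => decide (l.1 = y.2.1) :=
    filter (f := fun (y : List (Name × ℕ) × Name × ℕ) l => decide (l.1 = y.2.1)) (fst id) hname
  exact all (α := List (Name × ℕ)) (l := fun h => h) (f := fun h l =>
    decide ((h.filter fun l' => decide (l'.1 = l.1)).length = 1)) id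
    (beq_nat (length hfilter) (const 1))

theorem polyTime_isInstance : PolyTime fun y : List Token × ParseState => isInstance y.1 y.2 := by
  have hpath : PolyTime fun y : List Token × ParseState => y.2.1 := fst (snd id)
  have hout : PolyTime fun y : List Token × ParseState => y.2.2.1 := fst (snd (snd id))
  have hrecs : PolyTime fun y : List Token × ParseState => y.2.2.2.1 := fst (snd (snd (snd id)))
  have hk : PolyTime fun y : List Token × ParseState => y.2.2.2.2 := snd (snd (snd (snd id)))
  have hbeq : PolyTime fun y : Frame × Frame => decide (y.1 = y.2) := by
    have h₁ : PolyTime fun y : Frame × Frame => decide (y.1.1 = y.2.1) :=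
      beq_bool.comp (prod (fst (fst id)) (fst (snd id)))
    have h₂ : PolyTime fun y : Frame × Frame => decide (y.1.2.1 = y.2.2.1) :=
      beq_name (fst (snd (fst id))) (fst (snd (snd id)))
    have h₃ : PolyTime fun y : Frame × Frame => decide (y.1.2.2 = y.2.2.2) :=
      beq_nat (snd (snd (fst id))) (snd (snd (snd id)))
    refine of_eq (and h₁ (and h₂ h₃)) fun y => ?_
    rw [Bool.eq_iff_iff]
    simp [Prod.ext_iff]
  have hhead : PolyTime fun l : List Token => decide (l.head? = some .leaf) :=
    of_eq (list_cases (g := fun _ t _ => decide (t = .leaf)) id (const false)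
      ((of_finite toData_token_injective fun t => decide (t = .leaf)).comp (fst (snd id))))
      fun l => by cases l <;> simp
  have harity : PolyTime fun y : (List Token × ParseState) × Name × ℕ =>
      decide (arityOf y.1.2.2.2.1 y.2.1 = y.2.2) :=
    beq_nat (polyTime_arityOf (hrecs.comp (fst id)) (fst (snd id))) (snd (snd id))
  have h₁ : PolyTime fun y : List Token × ParseState => decide (y.2.1 = [(false, [], 1)]) :=
    beq_list hpath (const _) hbeq
  have h₂ : PolyTime fun y : List Token × ParseState => decide (y.2.2.2.2 = 0) :=
    beq_nat hk (const 0)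
  have h₃ : PolyTime fun y : List Token × ParseState => decide (y.1.head? = some .leaf) :=
    hhead.comp (fst id)
  have h₄ : PolyTime fun y : List Token × ParseState =>
      y.2.2.2.1.all fun r => decide (arityOf y.2.2.2.1 r.1 = r.2) :=
    all (f := fun (y : List Token × ParseState) r => decide (arityOf y.2.2.2.1 r.1 = r.2))
      hrecs harity
  have h₅ : PolyTime fun y : List Token × ParseState => y.2.2.1.all nodupNames :=
    all (f := fun _ (h : List (Name × ℕ)) => nodupNames h) hout (polyTime_nodupNames.comp (snd id))
  exact and h₁ (and (not h₂) (and (not h₃) (and h₄ h₅)))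

theorem polyTime_verify : PolyTime verify := by
  have hparse : PolyTime fun z : List Token × List Command => parse z.1 :=
    polyTime_parse.comp (fst id)
  have hinst : PolyTime fun z : List Token × List Command => isInstance z.1 (parse z.1) :=
    polyTime_isInstance.comp (f := fun z : List Token × List Command => (z.1, parse z.1))
      (prod (fst id) hparse)
  have hcheck : PolyTime fun z : List Token × List Command => check (parse z.1) z.2 :=
    polyTime_check.comp (f := fun z : List Token × List Command => (parse z.1, z.2))
      (prod hparse (snd id))
  have hok : PolyTime fun z : List Token × List Command => (check (parse z.1) z.2).1 := fst hcheck
  have hstack : PolyTime fun z : List Token × List Command =>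
      (check (parse z.1) z.2).2.2.1.isEmpty := isEmpty (fst (snd (snd hcheck)))
  exact and hinst (and hok hstack)

end

/-! ### From the verifier to the Turing machine -/

instance {α β : Type} [DataCode α] [DataCode β] : DataCode (α ⊕ β) :=
  ⟨fun x => x.elim (fun a => toData (false, a)) fun b => toData (true, b)⟩

theorem toData_sum_injective {α β : Type} [DataCode α] [DataCode β]
    (hα : Function.Injective (toData : α → Data)) (hβ : Function.Injective (toData : β → Data)) :
    Function.Injective (toData : α ⊕ β → Data) := by
  have h₁ (a : α) : toData (Sum.inl a : α ⊕ β) = .cons .nil (toData a) := rfl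
  have h₂ (b : β) : toData (Sum.inr b : α ⊕ β) = .cons (.cons .nil .nil) (toData b) := rfl
  rintro (a | a) (b | b) h <;> simp only [h₁, h₂, Data.cons.injEq, reduceCtorEq, true_and,
    false_and] at h
  · rw [hα h]
  · rw [hβ h]

/-- The letters of a word that come from the first alphabet. -/
def lefts {α β : Type} (l : List (α ⊕ β)) : List α := l.flatMap (Sum.elim (fun a => [a]) fun _ => [])

/-- The letters of a word that come from the second alphabet. -/
def rights {α β : Type} (l : List (α ⊕ β)) : List β := l.flatMap (Sum.elim (fun _ => []) fun b => [b])

theorem lefts_encodePair {α β : Type} (x : List α × List β) : lefts (encodePair x) = x.1 := by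
  simp [lefts, encodePair, List.flatMap_map]

theorem rights_encodePair {α β : Type} (x : List α × List β) : rights (encodePair x) = x.2 := by
  simp [rights, encodePair, List.flatMap_map]

/-- The machine hands over its input in reversed order, so the word is reversed before it is taken
apart. -/
theorem polyTime_verify_word : PolyTime fun l : List (Token ⊕ Command) =>
    verify (lefts l.reverse, rights l.reverse) := by
  have hinj : Function.Injective (toData : Token ⊕ Command → Data) :=
    toData_sum_injective toData_token_injective toData_command_injective
  have hrev : PolyTime fun l : List (Token ⊕ Command) => l.reverse := reverse id
  have h₁ : PolyTime fun l : List (Token ⊕ Command) => lefts l :=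
    flatMap (f := fun _ => Sum.elim (fun a => [a]) fun _ => []) id
      ((of_finite hinj (Sum.elim (fun a => [a]) fun _ => [])).comp (snd id))
  have h₂ : PolyTime fun l : List (Token ⊕ Command) => rights l :=
    flatMap (f := fun _ => Sum.elim (fun _ => []) fun b => [b]) id
      ((of_finite hinj (Sum.elim (fun _ => []) fun b => [b])).comp (snd id))
  exact polyTime_verify.comp (prod (h₁.comp hrev) (h₂.comp hrev))

/-- A predicate that is computable in polynomial time on the code of a word, in reversed order, is
computed by a Turing machine in polynomial time. -/
theorem PolyTime.nonempty_computable {α X : Type} [Fintype α] [DataCode α] (e : X → List α)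
    {f : List α → Bool} (hf : PolyTime fun l : List α => f l.reverse) :
    Nonempty (Turing.TM2ComputableInPolyTime e Computability.encodeBool fun x => f (e x)) := by
  obtain ⟨P, T, ⟨p, hp⟩, -, hP⟩ := hf
  -- The alphabet is finite, so letters have codes of bounded size and the code of a word is linear
  -- in its length.
  obtain ⟨C, hC⟩ : ∃ C, ∀ a : α, dsize a ≤ C :=
    ⟨∑ a, dsize a, fun a => Finset.single_le_sum (f := fun a : α => dsize a)
      (fun _ _ => Nat.zero_le _) (Finset.mem_univ a)⟩
  have hword : ∀ l : List α, (toData l).word =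
      (l.map fun a => true :: (toData a).word).flatten ++ [false] := by
    intro l
    induction l with
    | nil => rfl
    | cons a l ih => simp [Data.word, ih]
  have hbool : ∀ b : Bool, (toData b).word = StackProg.boolWord b := by
    intro b
    cases b <;> rfl
  refine StackProg.nonempty_computable e f (P 0) (fun a => true :: (toData a).word)
    (p.comp (Polynomial.X * Polynomial.C (C + 1) + 1)) fun l => ?_
  obtain ⟨t, ht, hr⟩ := hP l.reverse 0
    (Function.update (fun _ => []) 0 (toData l.reverse).word) (by simp)
    (fun k hk => Function.update_of_ne (by omega) _ _)
  refine ⟨t, ht.trans ((hp _).trans ?_), ?_⟩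
  · rw [Polynomial.eval_comp]
    refine polynomial_eval_mono p ?_
    have := dsize_le_length_mul (l := l.reverse) fun a _ => hC a
    simpa using this
  · dsimp only at hr
    rw [Function.update_idem, List.reverse_reverse, hbool, hword] at hr
    simpa using hr

end

theorem mainTheorem7 : InNP MinALRSpan := by
  refine ⟨Command, inferInstance, Polynomial.X * (Polynomial.C 2 * (Polynomial.X * Polynomial.X) + 1) *
    (Polynomial.X + 1), verify, ?_, fun x => ⟨fun h => ?_, fun ⟨w, _, hw⟩ =>
      mem_minALRSpan_of_verify hw⟩⟩
  · have := PolyTime.nonempty_computable encodePair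
      (f := fun l : List (Token ⊕ Command) => verify (lefts l, rights l)) polyTime_verify_word
    simpa only [lefts_encodePair, rights_encodePair] using this
  · obtain ⟨w, hw, hv⟩ := exists_verify h
    refine ⟨w, ?_, hv⟩
    simpa using hw
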